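/- Theorem. Let $0\le p\le 1$, let $H(p)=-p\log_2 p-(1-p)\log_2(1-p)$, and let $X^n=(X_1,\dots,X_n)$ be i.i.d. Bernoulli($p$) bits. There is a constant $K$ (depending only on $p$) such that for every $\varepsilon>0$ there is a fixed-length compression scheme, i.e. for every $n$ a codeword length $m_n$, an encoder $\mathrm{enc}_n:\{0,1\}^n\to\{0,1\}^{m_n}$, a decoder $\mathrm{dec}_n:\{0,1\}^{m_n}\to\{0,1\}^n$, a local decoder for each $i\in[n]$, and a local updater for each $i\in[n]$ and each new value $b\in\{0,1\}$, with the following properties. (A local decoder is an adaptive algorithm (decision tree) that probes bits of the stored codeword and outputs a bit; a local updater is an adaptive algorithm that reads and overwrites bits of the stored codeword. Neither has any other information about the source sequence, and only bit accesses are charged.) 1. (Rate) $m_n\le n(H(p)+\varepsilon)$ for all $n$. 2. (Error) $\Pr[\mathrm{dec}_n(\mathrm{enc}_n(X^n))\ne X^n]\to 0$ as $n\to\infty$. 3. (Local decoding) On every $c\in\{0,1\}^{m_n}$ the local decoder for $i$ outputs the $i$-th bit of $\mathrm{dec}_n(c)$, and for all sufficiently large $n$ it probes at most $K\log_2\log_2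 n$ bits, for every $i$ and every $c$. 4. (Local update) Call a sequence $x\in\{0,1\}^n$ good if $\mathrm{dec}_n(\mathrm{enc}_n(x))=x$. If a good sequence is encoded and then finitely many single-bit changes are made, each processed on the stored codeword by the local updater, and the sequence is good after each change, then the stored codeword decodes under $\mathrm{dec}_n$ to the current sequence. For all sufficiently large $n$ (depending on $p$ and $\varepsilon$), the number of bit reads plus bit writes of one update is at most $\frac{K}{\varepsilon}\log_2\log_2 n$, for every $i$, every $b$ and every content of the codeword memory. 5. (Complexity) There are an encoding program and a decoding program for a random access machine with logarithmic cost (each one program for all $n$) that compute $\mathrm{enc}_n$ and $\mathrm{dec}_n$ in time quasilinear in $n$, i.e. $O(n(\log n)^k)$ for some $k$, on all inputs. -/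

import Mathlib

open Filter Topology Asymptotics

namespace LocalCompression

/-! ### Algorithms in the bit-probe model -/

/-- An adaptive (decision-tree) algorithm that probes bits of an `m`-bit word and answers with a bit.
Only the probes are charged. -/
inductive Decoder (m : ℕ) : Type
  | answer (b : Bool) : Decoder m
  | read (j : Fin m) (next : Bool → Decoder m) : Decoder m

namespace Decoder

/-- The answer on the word `c`. -/
def eval {m : ℕ} : Decoder m → (Fin m → Bool) → Bool
  | answer b, _ => b
  | read j next, c => (next (c j)).eval c

/-- The number of bits probed on the word `c`. -/
def probes {m : ℕ} : Decoder m → (Fin m → Bool) → ℕ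
  | answer _, _ => 0
  | read j next, c => (next (c j)).probes c + 1

end Decoder

/-- An adaptive (decision-tree) algorithm that reads and overwrites bits of an `m`-bit word. -/
inductive Updater (m : ℕ) : Type
  | done : Updater m
  | read (j : Fin m) (next : Bool → Updater m) : Updater m
  | write (j : Fin m) (b : Bool) (next : Updater m) : Updater m

namespace Updater

/-- The word that is left when the updater has been run on the word `c`. -/
def run {m : ℕ} : Updater m → (Fin m → Bool) → (Fin m → Bool)
  | done, c => c
  | read j next, c => (next (c j)).run c
  | write j b next, c => next.run (Function.update c j b)

/-- The number of bit reads plus the number of bit writes performed on the word `c`. -/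
def cost {m : ℕ} : Updater m → (Fin m → Bool) → ℕ
  | done, _ => 0
  | read j next, c => (next (c j)).cost c + 1
  | write j b next, c => next.cost (Function.update c j b) + 1

end Updater

/-! ### A random access machine with logarithmic cost -/

/-- Memory: natural-number registers and arrays of natural numbers. A program mentions only finitely
many registers and arrays. -/
structure Memory where
  reg : ℕ → ℕ
  arr : ℕ → ℕ → ℕ

/-- The memory after register `x` is set to `k`. -/
def Memory.setReg (s : Memory) (x k : ℕ) : Memory where
  reg := Function.update s.reg x k
  arr := s.arr

/-- The memory after entry `i` of array `a` is set to `k`. -/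
def Memory.setArr (s : Memory) (a i k : ℕ) : Memory where
  reg := s.reg
  arr := Function.update s.arr a (Function.update (s.arr a) i k)

/-- Arithmetic expressions (`sub` is truncated subtraction, `div` rounds down). -/
inductive Expr : Type
  | const (k : ℕ)
  | reg (x : ℕ)
  | get (a : ℕ) (i : Expr)
  | add (e f : Expr)
  | sub (e f : Expr)
  | mul (e f : Expr)
  | div (e f : Expr)
  | mod (e f : Expr)

namespace Expr

/-- The value of an expression. -/
def eval (s : Memory) : Expr → ℕ
  | const k => k
  | reg x => s.reg x
  | get a i => s.arr a (i.eval s)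
  | add e f => e.eval s + f.eval s
  | sub e f => e.eval s - f.eval s
  | mul e f => e.eval s * f.eval s
  | div e f => e.eval s / f.eval s
  | mod e f => e.eval s % f.eval s

/-- Logarithmic cost: every node of the expression is charged one plus the bit length of its value
(so that indices, operands and results are all paid for). -/
def cost (s : Memory) : Expr → ℕ
  | const k => 1 + Nat.size k
  | reg x => 1 + Nat.size (s.reg x)
  | get a i => i.cost s + (1 + Nat.size (s.arr a (i.eval s)))
  | add e f => e.cost s + f.cost s + (1 + Nat.size (e.eval s + f.eval s))
  | sub e f => e.cost s + f.cost s + (1 + Nat.size (e.eval s - f.eval s))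
  | mul e f => e.cost s + f.cost s + (1 + Nat.size (e.eval s * f.eval s))
  | div e f => e.cost s + f.cost s + (1 + Nat.size (e.eval s / f.eval s))
  | mod e f => e.cost s + f.cost s + (1 + Nat.size (e.eval s % f.eval s))

end Expr

/-- Programs of the machine; `loop e P` runs `P` as long as `e` holds. Conditions hold when the
expression is nonzero. -/
inductive Program : Type
  | skip
  | assign (x : ℕ) (e : Expr)
  | store (a : ℕ) (i e : Expr)
  | seq (P Q : Program)
  | ite (e : Expr) (P Q : Program)
  | loop (e : Expr) (P : Program)

/-- `Exec P s s' t`: started in the memory `s`, the program `P` halts in the memory `s'` after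
time `t`. -/
inductive Exec : Program → Memory → Memory → ℕ → Prop
  | skip (s : Memory) : Exec Program.skip s s 1
  | assign (x : ℕ) (e : Expr) (s : Memory) :
      Exec (Program.assign x e) s (s.setReg x (e.eval s)) (e.cost s + 1)
  | store (a : ℕ) (i e : Expr) (s : Memory) :
      Exec (Program.store a i e) s (s.setArr a (i.eval s) (e.eval s)) (i.cost s + e.cost s + 1)
  | seq {P Q : Program} {s s' s'' : Memory} {t t' : ℕ} :
      Exec P s s' t → Exec Q s' s'' t' → Exec (Program.seq P Q) s s'' (t + t')
  | ite_true {e : Expr} {P Q : Program} {s s' : Memory} {t : ℕ} :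
      e.eval s ≠ 0 → Exec P s s' t → Exec (Program.ite e P Q) s s' (e.cost s + 1 + t)
  | ite_false {e : Expr} {P Q : Program} {s s' : Memory} {t : ℕ} :
      e.eval s = 0 → Exec Q s s' t → Exec (Program.ite e P Q) s s' (e.cost s + 1 + t)
  | loop_true {e : Expr} {P : Program} {s s' s'' : Memory} {t t' : ℕ} :
      e.eval s ≠ 0 → Exec P s s' t → Exec (Program.loop e P) s' s'' t' →
      Exec (Program.loop e P) s s'' (e.cost s + 1 + t + t')
  | loop_false {e : Expr} {P : Program} {s : Memory} :
      e.eval s = 0 → Exec (Program.loop e P) s s (e.cost s + 1)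

/-- Initial memory for block length `n` and input word `w`: register 0 holds `n`, register 1 the
length of `w`, array 0 the bits of `w`; everything else is zero. -/
def inputMemory (n : ℕ) {m : ℕ} (w : Fin m → Bool) : Memory where
  reg := fun x => if x = 0 then n else if x = 1 then m else 0
  arr := fun a j => if h : a = 0 ∧ j < m then (w ⟨j, h.2⟩).toNat else 0

/-- The final memory holds the output word `v`: its length in register 1, its bits in array 1. -/
def HasOutput (s : Memory) {m : ℕ} (v : Fin m → Bool) : Prop :=
  s.reg 1 = m ∧ ∀ j : Fin m, s.arr 1 j = (v j).toNat

/-- On block length `n` and input `w`, the program halts with output `v` within time `T`. -/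
def ComputesWithin (P : Program) (n : ℕ) {m m' : ℕ} (w : Fin m → Bool) (v : Fin m' → Bool)
    (T : ℕ) : Prop :=
  ∃ s t, Exec P (inputMemory n w) s t ∧ HasOutput s v ∧ t ≤ T

/-- `T n = O(n (log n) ^ k)` for some `k`. -/
def Quasilinear (T : ℕ → ℕ) : Prop :=
  ∃ k : ℕ, (fun n : ℕ => (T n : ℝ)) =O[atTop] fun n : ℕ => (n : ℝ) * Real.log n ^ k

/-! ### Locally decodable and updatable compression schemes -/

/-- A fixed-length compression scheme with a local decoder and a local updater: for each block length
`n` the length of the codewords, global encoder and decoder, a bit-probe algorithm for each position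
`i`, and an updating algorithm for each position `i` and each new value `b`. -/
structure Scheme where
  len : ℕ → ℕ
  enc : (n : ℕ) → (Fin n → Bool) → (Fin (len n) → Bool)
  dec : (n : ℕ) → (Fin (len n) → Bool) → (Fin n → Bool)
  localDec : (n : ℕ) → Fin n → Decoder (len n)
  localUpd : (n : ℕ) → Fin n → Bool → Updater (len n)

/-- The entropy, in bits, of a Bernoulli(`p`) variable. -/
noncomputable def entropy (p : ℝ) : ℝ := Real.binEntropy p / Real.log 2

/-- The probability of the sequence `x` under `n` independent Bernoulli(`p`) bits. -/
noncomputable def bernoulliProb (p : ℝ) {n : ℕ} (x : Fin n → Bool) : ℝ :=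
  ∏ i, if x i then p else 1 - p

namespace Scheme

/-- The probability that the decoded sequence differs from the source sequence. -/
noncomputable def errorProb (S : Scheme) (p : ℝ) (n : ℕ) : ℝ :=
  ∑ x : Fin n → Bool with S.dec n (S.enc n x) ≠ x, bernoulliProb p x

/-- On every word, the local decoder for position `i` outputs bit `i` of the globally decoded
sequence. -/
def LocalDecoderCorrect (S : Scheme) : Prop :=
  ∀ (n : ℕ) (i : Fin n) (c : Fin (S.len n) → Bool), (S.localDec n i).eval c = S.dec n c i

/-- `S.Maintains n x c`: the current sequence is `x` and the stored codeword is `c`, after the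
encoder was run once and then finitely many (possibly no) single-bit updates were made with the local
updater, where the initial sequence and the sequence after each update belong to the sequences on which
the scheme makes no error. -/
inductive Maintains (S : Scheme) (n : ℕ) :
    (Fin n → Bool) → (Fin (S.len n) → Bool) → Prop
  | encode (x : Fin n → Bool) : S.dec n (S.enc n x) = x → Maintains S n x (S.enc n x)
  | update (x : Fin n → Bool) (c : Fin (S.len n) → Bool) (i : Fin n) (b : Bool) :
      Maintains S n x c →
      S.dec n (S.enc n (Function.update x i b)) = Function.update x i b →
      Maintains S n (Function.update x i b) ((S.localUpd n i b).run c)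

/-- After any number of such updates, the stored codeword still decodes to the current sequence. -/
def UpdaterCorrect (S : Scheme) : Prop :=
  ∀ (n : ℕ) (x : Fin n → Bool) (c : Fin (S.len n) → Bool), S.Maintains n x c → S.dec n c = x

/-- One encoding program and one decoding program, serving all block lengths, run in quasilinear
time. -/
def QuasilinearTime (S : Scheme) : Prop :=
  ∃ (P Q : Program) (T : ℕ → ℕ), Quasilinear T ∧
    ∀ n : ℕ, (∀ x : Fin n → Bool, ComputesWithin P n x (S.enc n x) (T n)) ∧
      ∀ c : Fin (S.len n) → Bool, ComputesWithin Q n c (S.dec n c) (T n)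

end Scheme

end LocalCompression

/-! Write λ for the bit length of the bit length of n, which is about log log n. The source word is
cut into blocks of b bits, where b is a constant multiple of λ, so that the description of one block
may be read and rewritten in full at each access. Bits get integer costs `α₁` and `α₀`, about v
times the ideal code lengths, with ρ ^ α₁ + ρ ^ α₀ ≤ 1 for ρ = 2 ^ (-1/v). A block is cheap if its
total cost is at most vλ. Kraft's inequality (`count_typ_le`) leaves at most 2 ^ λ cheap blocks, so
a cheap block is stored as its rank in λ bits. The mean cost of a bit is less than u, and u * b ≤
vλ, so by Chernoff's bound a block is expensive with probability at most γ ^ b for a constant γ < 1.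
The rate is close to u/v, which `exists_code` places close to the entropy.

Expensive blocks are stored verbatim in overflow slots. To keep pointers short, the blocks are put
into groups of 2 ^ λ, a number just above log n. Each group has a fraction 2 ^ (-d) of that number
as slots, addressed with fewer than λ bits, and its unused slots form a linked list inside the slots
themselves. A flag in the field of a block says whether the rest of the field is a rank or a slot
number. A reader therefore probes λ + 1 bits and perhaps one bit of a slot; an updater touches O(λ +
b) bits. The error event is that some group has more expensive blocks than slots. A union bound over
groups and over sets of blocks (`sum_not_fits_le`) shows that this is unlikely, because γ ^ b tends
to 0 while the groups have more than log n blocks (`tendsto_error_bound`).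

Updates are correct because of an invariant on the abstract store (`Layout.Inv`): in each group the
free slots and the expensive blocks add up to the capacity. If the updated word fits, a free slot is
there when it is needed (`Inv.head_lt`), and `Good.update` carries this over to the bits. The
encoder keeps the invariant even on words that do not fit, so correct decoding forces the word to
fit (`good_enc_of_eval`, `Inv.fits`).

For the running time, a fixed number of loops without nesting, each with O(n) passes, work on
numbers of O(log n) bits. The tables of ranks have only 2 ^ b entries, which is polylogarithmic. If
entropy plus ε is at least 1, the word is stored as it is. -/

namespace LocalCompression

/-! ### Numbers stored in consecutive bits -/

/-- The number whose binary digits are the `w` bits from position `pos` on, least significant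
first. -/
def val (c : ℕ → Bool) (pos : ℕ) : ℕ → ℕ
  | 0 => 0
  | w + 1 => val c pos w + (c (pos + w)).toNat * 2 ^ w

/-- The bits of a word, followed by zeros. -/
def ext {m : ℕ} (c : Fin m → Bool) (j : ℕ) : Bool := if h : j < m then c ⟨j, h⟩ else false

theorem ext_fin {m : ℕ} (c : Fin m → Bool) (j : Fin m) : ext c j = c j := by
  simp [ext]

theorem ext_of_lt {m : ℕ} (c : Fin m → Bool) {j : ℕ} (h : j < m) : ext c j = c ⟨j, h⟩ := by
  simp [ext, h]

theorem val_lt (c : ℕ → Bool) (pos w : ℕ) : val c pos w < 2 ^ w := by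
  induction w with
  | zero => simp [val]
  | succ w ih =>
    have : (c (pos + w)).toNat ≤ 1 := Bool.toNat_le _
    rw [val, pow_succ]
    nlinarith

theorem testBit_val (c : ℕ → Bool) (pos : ℕ) {w r : ℕ} (hr : r < w) :
    (val c pos w).testBit r = c (pos + r) := by
  induction w with
  | zero => omega
  | succ w ih =>
    rw [val, add_comm, mul_comm, Nat.testBit_two_pow_mul_add _ (val_lt c pos w)]
    split_ifs with h
    · exact ih h
    · obtain rfl : r = w := by omega
      cases c (pos + r) <;> simp

theorem val_eq {c : ℕ → Bool} {pos w v : ℕ} (hv : v < 2 ^ w)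
    (h : ∀ i < w, c (pos + i) = v.testBit i) : val c pos w = v := by
  refine Nat.eq_of_testBit_eq fun i => ?_
  rcases lt_or_ge i w with hi | hi
  · rw [testBit_val c pos hi, h i hi]
  · have hw := Nat.pow_le_pow_right two_pos hi
    rw [Nat.testBit_lt_two_pow ((val_lt c pos w).trans_le hw),
      Nat.testBit_lt_two_pow (hv.trans_le hw)]

theorem val_congr {c d : ℕ → Bool} {pos pos' w : ℕ} (h : ∀ i < w, c (pos + i) = d (pos' + i)) :
    val c pos w = val d pos' w :=
  val_eq (val_lt _ _ _) fun i hi => by rw [h i hi, testBit_val _ _ hi]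

theorem val_succ' (c : ℕ → Bool) (pos w : ℕ) :
    val c pos (w + 1) = 2 * val c (pos + 1) w + (c pos).toNat := by
  induction w with
  | zero => simp [val]
  | succ w ih =>
    rw [val, ih, val, show pos + 1 + w = pos + (w + 1) by ring]
    ring

/-- The number of ones among the binary digits. -/
def pop (w : ℕ) : ℕ := (Nat.digits 2 w).sum

theorem pop_zero : pop 0 = 0 := by simp [pop]

theorem pop_eq (w : ℕ) : pop w = pop (w / 2) + w % 2 := by
  rcases Nat.eq_zero_or_pos w with rfl | h
  · simp [pop]
  · rw [pop, Nat.digits_def' (by norm_num) h, List.sum_cons, add_comm, pop]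

theorem pop_two_mul (w : ℕ) : pop (2 * w) = pop w := by
  rw [pop_eq]; simp

theorem pop_two_mul_add_one (w : ℕ) : pop (2 * w + 1) = pop w + 1 := by
  rw [pop_eq]; congr 1
  · congr 1; omega
  · omega

theorem pop_val (c : ℕ → Bool) (pos w : ℕ) :
    pop (val c pos w) = ∑ i ∈ Finset.range w, (c (pos + i)).toNat := by
  induction w generalizing pos with
  | zero => simp [val, pop]
  | succ w ih =>
    rw [val_succ', Finset.sum_range_succ', pop_eq]
    have h1 : (2 * val c (pos + 1) w + (c pos).toNat) / 2 = val c (pos + 1) w := by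
      have : (c pos).toNat ≤ 1 := Bool.toNat_le _
      omega
    have h2 : (2 * val c (pos + 1) w + (c pos).toNat) % 2 = (c pos).toNat := by
      have : (c pos).toNat ≤ 1 := Bool.toNat_le _
      omega
    rw [h1, h2, ih, add_zero]
    congr 1
    exact Finset.sum_congr rfl fun i _ => by rw [add_assoc, add_comm 1]

theorem pop_le {w b : ℕ} (h : w < 2 ^ b) : pop w ≤ b := by
  induction b generalizing w with
  | zero => simp at h; simp [h, pop]
  | succ b ih =>
    rw [pop_eq]
    have := ih (w := w / 2) (by rw [pow_succ] at h; omega)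
    omega

theorem sum_range_two_mul {M : Type*} [AddCommMonoid M] (f : ℕ → M) (k : ℕ) :
    ∑ w ∈ Finset.range (2 * k), f w = ∑ w ∈ Finset.range k, (f (2 * w) + f (2 * w + 1)) := by
  induction k with
  | zero => simp
  | succ k ih =>
    rw [mul_add, mul_one, Finset.sum_range_succ, Finset.sum_range_succ, ih,
      Finset.sum_range_succ, add_assoc]

/-- The binomial theorem, sorted by words instead of weights. Splitting off the lowest digit of a
word gives the induction. -/
theorem sum_pow_pop (x y : ℝ) (b : ℕ) :
    ∑ w ∈ Finset.range (2 ^ b), x ^ pop w * y ^ (b - pop w) = (x + y) ^ b := by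
  induction b with
  | zero => simp [pop]
  | succ b ih =>
    rw [pow_succ, mul_comm (2 ^ b), sum_range_two_mul, pow_succ (x + y), ← ih, Finset.sum_mul]
    refine Finset.sum_congr rfl fun w hw => ?_
    have := pop_le (Finset.mem_range.1 hw)
    rw [pop_two_mul, pop_two_mul_add_one, Nat.add_sub_add_right, Nat.sub_add_comm this]
    ring

/-! ### The block store -/

/-- The numbers that describe the data structure for a source word of length `n`: blocks of `blk`
bits, in `grp` groups of `2 ^ lam` blocks with `cap` overflow slots each. A block is cheap if its cost,
`α₁` for each one and `α₀` for each zero, is at most `τ`. -/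
structure Layout where
  n : ℕ
  lam : ℕ
  blk : ℕ
  cap : ℕ
  grp : ℕ
  α₀ : ℕ
  α₁ : ℕ
  τ : ℕ

/-- The contents of the data structure: a field for each block, the overflow slots, and for each
group the head of the list of its free slots. -/
structure Store where
  fld : ℕ → ℕ
  slot : ℕ → ℕ
  head : ℕ → ℕ

namespace Layout

variable (Λ : Layout)

/-- The number of blocks in a group. -/
def num : ℕ := 2 ^ Λ.lam

/-- The number of blocks. -/
def blocks : ℕ := Λ.grp * Λ.num

/-- The block with value `w` is cheap. -/
def Typ (w : ℕ) : Prop := w < 2 ^ Λ.blk ∧ Λ.α₁ * pop w + Λ.α₀ * (Λ.blk - pop w) ≤ Λ.τ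

instance : DecidablePred Λ.Typ := fun _ => inferInstanceAs (Decidable (_ ∧ _))

/-- The number of a cheap block in the list of the cheap blocks. -/
def rank (w : ℕ) : ℕ := Nat.count Λ.Typ w

/-- The cheap block with number `k`. -/
noncomputable def unrank (k : ℕ) : ℕ :=
  if k < Nat.count Λ.Typ (2 ^ Λ.blk) then Nat.nth Λ.Typ k else 0

/-- The sizes fit together. -/
structure Valid : Prop where
  lam_le : Λ.lam ≤ Λ.blk
  cap_lt : Λ.cap < 2 ^ Λ.lam
  count_le : Nat.count Λ.Typ (2 ^ Λ.blk) ≤ 2 ^ Λ.lam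
  exists_typ : ∃ w, Λ.Typ w

variable {Λ}

theorem Typ.rank_lt {w : ℕ} (h : Λ.Typ w) : Λ.rank w < Nat.count Λ.Typ (2 ^ Λ.blk) :=
  Nat.count_strict_mono h h.1

theorem Typ.unrank_rank {w : ℕ} (h : Λ.Typ w) : Λ.unrank (Λ.rank w) = w := by
  rw [unrank, if_pos h.rank_lt, rank, Nat.nth_count h]

theorem unrank_lt (k : ℕ) : Λ.unrank k < 2 ^ Λ.blk := by
  rw [unrank]
  split_ifs with h
  · exact Nat.nth_lt_of_lt_count h
  · positivity

/-- A field that contains 0 must denote a cheap block: the empty store and released fields rely on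
it. -/
theorem exists_rank_zero (h : ∃ w, Λ.Typ w) : ∃ w, Λ.Typ w ∧ Λ.rank w = 0 := by
  refine ⟨Nat.nth Λ.Typ 0, ?_, Nat.count_nth_zero _⟩
  rw [Nat.nth_zero]
  exact Nat.sInf_mem h

variable (Λ)

/-- The block that the store holds at index `q`. -/
noncomputable def blockOf (st : Store) (q : ℕ) : ℕ :=
  if st.fld q % 2 = 0 then Λ.unrank (st.fld q / 2)
  -- Arbitrary codewords may contain slot numbers out of range; the value 0 for them is a convention
  -- that the decoders share.
  else if st.fld q / 2 < Λ.cap then st.slot (q / Λ.num * Λ.cap + st.fld q / 2) else 0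

/-- Store the block `w` at index `q`, whose present block must be cheap; if `w` is not cheap, a free
slot is used. -/
def put (st : Store) (q w : ℕ) : Store :=
  if Λ.Typ w then { st with fld := Function.update st.fld q (2 * Λ.rank w) }
  else if st.head (q / Λ.num) < Λ.cap then
    { fld := Function.update st.fld q (2 * st.head (q / Λ.num) + 1)
      slot := Function.update st.slot (q / Λ.num * Λ.cap + st.head (q / Λ.num)) w
      head := Function.update st.head (q / Λ.num)
        (st.slot (q / Λ.num * Λ.cap + st.head (q / Λ.num))) }
  else st

/-- Give back the slot that the block at index `q` uses, if any. -/
def release (st : Store) (q : ℕ) : Store :=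
  if st.fld q % 2 = 1 ∧ st.fld q / 2 < Λ.cap then
    { fld := Function.update st.fld q 0
      slot := Function.update st.slot (q / Λ.num * Λ.cap + st.fld q / 2) (st.head (q / Λ.num))
      head := Function.update st.head (q / Λ.num) (st.fld q / 2) }
  else st

/-- The store in which all blocks are the first cheap block and all slots are free. -/
def empty : Store where
  fld := fun _ => 0
  slot := fun z => if z < Λ.grp * Λ.cap then z % Λ.cap + 1 else 0
  head := fun _ => 0

/-- From `h` on, the slots in the list `L` form the list of free slots of group `g`. -/
def Chain (slot : ℕ → ℕ) (g : ℕ) : ℕ → List ℕ → Prop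
  | h, [] => h = Λ.cap
  | h, s :: L => h = s ∧ s < Λ.cap ∧ Chain slot g (slot (g * Λ.cap + s)) L

/-- The blocks of group `g` that are not cheap. -/
def atyp (W : ℕ → ℕ) (g : ℕ) : Finset ℕ :=
  {q ∈ Finset.range Λ.blocks | q / Λ.num = g ∧ ¬ Λ.Typ (W q)}

/-- The store is well formed and holds the blocks `W`. -/
structure Inv (W : ℕ → ℕ) (st : Store) : Prop where
  block : ∀ q < Λ.blocks, W q < 2 ^ Λ.blk ∧ ((Λ.Typ (W q) ∧ st.fld q = 2 * Λ.rank (W q)) ∨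
    (¬ Λ.Typ (W q) ∧ ∃ s < Λ.cap, st.fld q = 2 * s + 1 ∧ st.slot (q / Λ.num * Λ.cap + s) = W q))
  inj : ∀ q < Λ.blocks, ∀ q' < Λ.blocks, q / Λ.num = q' / Λ.num → ¬ Λ.Typ (W q) →
    ¬ Λ.Typ (W q') → st.fld q = st.fld q' → q = q'
  slot_lt : ∀ z < Λ.grp * Λ.cap, st.slot z < 2 ^ Λ.blk
  -- The last equation ties the free slots to the expensive blocks; it yields a free slot as long as
  -- fewer than `cap` blocks of the group are expensive.
  free : ∀ g < Λ.grp, ∃ L : List ℕ, Λ.Chain st.slot g (st.head g) L ∧ L.Nodup ∧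
    (∀ q < Λ.blocks, q / Λ.num = g → ¬ Λ.Typ (W q) → ∀ s ∈ L, st.fld q ≠ 2 * s + 1) ∧
    L.length + (Λ.atyp W g).card = Λ.cap

variable {Λ}

theorem num_pos : 0 < Λ.num := Nat.two_pow_pos _

theorem grp_lt {q : ℕ} (hq : q < Λ.blocks) : q / Λ.num < Λ.grp :=
  Nat.div_lt_of_lt_mul (by rwa [mul_comm])

theorem slotIdx_inj {g g' s s' : ℕ} (hs : s < Λ.cap) (hs' : s' < Λ.cap)
    (h : g * Λ.cap + s = g' * Λ.cap + s') : g = g' ∧ s = s' := by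
  have h0 : 0 < Λ.cap := by omega
  have h1 : (g * Λ.cap + s) / Λ.cap = (g' * Λ.cap + s') / Λ.cap := by rw [h]
  rw [mul_comm g, mul_comm g', Nat.mul_add_div h0, Nat.mul_add_div h0, Nat.div_eq_of_lt hs,
    Nat.div_eq_of_lt hs'] at h1
  obtain rfl : g = g' := by omega
  exact ⟨rfl, by omega⟩

theorem slotIdx_lt {g s : ℕ} (hg : g < Λ.grp) (hs : s < Λ.cap) :
    g * Λ.cap + s < Λ.grp * Λ.cap := by
  have := Nat.mul_le_mul_right Λ.cap hg
  rw [Nat.succ_mul] at this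
  omega

theorem Chain.congr {slot slot' : ℕ → ℕ} {g : ℕ} {L : List ℕ} {h : ℕ}
    (H : Λ.Chain slot g h L)
    (hs : ∀ s ∈ L, s < Λ.cap → slot' (g * Λ.cap + s) = slot (g * Λ.cap + s)) :
    Λ.Chain slot' g h L := by
  induction L generalizing h with
  | nil => exact H
  | cons s L ih =>
    obtain ⟨h1, h2, h3⟩ := H
    refine ⟨h1, h2, ?_⟩
    rw [hs s (by simp) h2]
    exact ih h3 fun t ht => hs t (by simp [ht])

theorem Chain.le {slot : ℕ → ℕ} {g : ℕ} {L : List ℕ} {h : ℕ} (H : Λ.Chain slot g h L) :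
    h ≤ Λ.cap := by
  cases L with
  | nil => exact le_of_eq H
  | cons s L => exact H.1 ▸ H.2.1.le

namespace Inv

variable {W : ℕ → ℕ} {st : Store}

theorem blockOf_eq (H : Λ.Inv W st) {q : ℕ} (hq : q < Λ.blocks) : Λ.blockOf st q = W q := by
  obtain ⟨-, ⟨h1, h2⟩ | ⟨-, s, hs, h1, h2⟩⟩ := H.block q hq
  · rw [blockOf, if_pos (by omega), h2, Nat.mul_div_cancel_left _ two_pos, h1.unrank_rank]
  · have h3 : (2 * s + 1) / 2 = s := by omega
    rw [blockOf, if_neg (by omega), h1, h3, if_pos hs, h2]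

theorem head_le (H : Λ.Inv W st) {g : ℕ} (hg : g < Λ.grp) : st.head g ≤ Λ.cap := by
  obtain ⟨L, h, -⟩ := H.free g hg
  exact h.le

theorem next_le (H : Λ.Inv W st) {g : ℕ} (hg : g < Λ.grp) (h : st.head g < Λ.cap) :
    st.slot (g * Λ.cap + st.head g) ≤ Λ.cap := by
  obtain ⟨L, hL, -⟩ := H.free g hg
  cases L with
  | nil => exact absurd hL h.ne
  | cons s L =>
    obtain ⟨h1, -, h3⟩ := hL
    rw [h1]
    exact h3.le

theorem congr {W' : ℕ → ℕ} (H : Λ.Inv W st) (h : ∀ q < Λ.blocks, W' q = W q) :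
    Λ.Inv W' st where
  block := fun q hq => by rw [h q hq]; exact H.block q hq
  inj := fun q hq q' hq' => by rw [h q hq, h q' hq']; exact H.inj q hq q' hq'
  slot_lt := H.slot_lt
  free := fun g hg => by
    obtain ⟨L, h1, h2, h3, h4⟩ := H.free g hg
    refine ⟨L, h1, h2, fun q hq => by rw [h q hq]; exact h3 q hq, ?_⟩
    have : Λ.atyp W' g = Λ.atyp W g :=
      Finset.filter_congr fun q hq => by rw [h q (Finset.mem_range.1 hq)]
    rw [this, h4]

/-- With block q the group has one more expensive block than before, and still at most `cap`. The
count in `free` then makes the list of free slots nonempty. -/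
theorem head_lt (H : Λ.Inv W st) {q w : ℕ} (hq : q < Λ.blocks) (hW : Λ.Typ (W q))
    (hw : ¬ Λ.Typ w)
    (hcap : (Λ.atyp (Function.update W q w) (q / Λ.num)).card ≤ Λ.cap) :
    st.head (q / Λ.num) < Λ.cap := by
  obtain ⟨L, h1, -, -, h4⟩ := H.free _ (grp_lt hq)
  have h5 : Λ.atyp (Function.update W q w) (q / Λ.num) = insert q (Λ.atyp W (q / Λ.num)) := by
    ext t
    by_cases ht : t = q
    · subst ht; simp [atyp, hq, hw]
    · simp [atyp, ht]
  rw [h5, Finset.card_insert_of_notMem (by simp [atyp, hW])] at hcap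
  cases L with
  | nil => simp at h4; omega
  | cons s L => exact h1.1 ▸ h1.2.1

/-- In the expensive case the head of the free list is taken. Being on that list, its slot holds no
other block, and as the list has no repetition it does not recur in the rest. So overwriting it
harms neither the other blocks nor the remaining links. -/
theorem put (H : Λ.Inv W st) {q w : ℕ} (hq : q < Λ.blocks) (hW : Λ.Typ (W q))
    (hw2 : w < 2 ^ Λ.blk) (hw : Λ.Typ w ∨ st.head (q / Λ.num) < Λ.cap) :
    Λ.Inv (Function.update W q w) (Λ.put st q w) := by
  by_cases ht : Λ.Typ w
  · rw [Layout.put, if_pos ht]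
    have hne : ∀ t, ¬ Λ.Typ (Function.update W q w t) → t ≠ q := by
      rintro t h rfl; simp [ht] at h
    refine ⟨fun t htb => ?_, fun t htb t' htb' hg h1 h2 => ?_, H.slot_lt, fun g hg => ?_⟩
    · by_cases h : t = q
      · subst h; simp [ht, hw2]
      · simpa [h] using H.block t htb
    · have h3 := hne _ h1
      have h4 := hne _ h2
      simp only [Function.update_of_ne h3, Function.update_of_ne h4] at h1 h2 ⊢
      exact H.inj t htb t' htb' hg h1 h2
    · obtain ⟨L, h1, h2, h3, h4⟩ := H.free g hg
      refine ⟨L, h1, h2, fun t htb hg h => ?_, ?_⟩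
      · have h5 := hne _ h
        simp only [Function.update_of_ne h5] at h ⊢
        exact h3 t htb hg h
      · rw [← h4]; congr 2
        refine Finset.filter_congr fun t _ => ?_
        by_cases h : t = q
        · subst h; simp [ht, hW]
        · simp [h]
  · have hc := hw.resolve_left ht
    have hgq := grp_lt hq
    obtain ⟨L, h1, h2, h3, h4⟩ := H.free _ hgq
    cases L with
    | nil => exact absurd h1 hc.ne
    | cons s L =>
      rw [Layout.put, if_neg ht, if_pos hc]
      obtain ⟨rfl, hs, h1⟩ := h1
      set g₀ := q / Λ.num with hg₀
      set s := st.head g₀ with hs'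
      have hsL : s ∉ L := (List.nodup_cons.1 h2).1
      refine ⟨fun t htb => ?_, fun t htb t' htb' hg k1 k2 k3 => ?_, fun z hz => ?_, fun g hg => ?_⟩
      · by_cases h : t = q
        · subst h
          simp [ht, hw2, ← hg₀, hs]
        · simp only [Function.update_of_ne h]
          obtain ⟨k1, k2⟩ := H.block t htb
          refine ⟨k1, k2.imp_right ?_⟩
          rintro ⟨k3, r, hr, k4, k5⟩
          refine ⟨k3, r, hr, k4, ?_⟩
          rw [Function.update_of_ne, k5]
          intro he
          obtain ⟨he1, rfl⟩ := slotIdx_inj hr hs he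
          exact h3 t htb he1 k3 _ (by simp) k4
      · by_cases h : t = q
        · by_cases h' : t' = q
          · rw [h, h']
          · subst h
            simp only [Function.update_of_ne h', Function.update_self] at k1 k2 k3
            exact absurd k3.symm (h3 t' htb' hg.symm k2 _ (by simp))
        · by_cases h' : t' = q
          · subst h'
            simp only [Function.update_of_ne h, Function.update_self] at k1 k2 k3
            exact absurd k3 (h3 t htb hg k1 _ (by simp))
          · simp only [Function.update_of_ne h, Function.update_of_ne h'] at k1 k2 k3
            exact H.inj t htb t' htb' hg k1 k2 k3
      · by_cases h : z = g₀ * Λ.cap + s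
        · subst h; simpa using hw2
        · simpa [h] using H.slot_lt z hz
      · by_cases hgg : g = g₀
        · subst hgg
          refine ⟨L, ?_, (List.nodup_cons.1 h2).2, fun t htb hg k1 r hr => ?_, ?_⟩
          · simp only [Function.update_self]
            refine h1.congr fun r hr hrc => Function.update_of_ne ?_ _ _
            intro he
            obtain ⟨-, rfl⟩ := slotIdx_inj hrc hs he
            exact hsL hr
          · by_cases h : t = q
            · subst h
              simp only [Function.update_self]
              rintro h
              obtain rfl : s = r := by omega
              exact hsL hr
            · simp only [Function.update_of_ne h] at k1 ⊢
              exact h3 t htb hg k1 r (by simp [hr])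
          · have h5 : Λ.atyp (Function.update W q w) (q / Λ.num)
                = insert q (Λ.atyp W (q / Λ.num)) := by
              ext t
              by_cases ht : t = q
              · subst ht; simp [atyp, *]
              · simp [atyp, ht]
            rw [← h4, h5, Finset.card_insert_of_notMem (by simp [atyp, hW])]
            simp [hg₀]; ring
        · obtain ⟨L', k1, k2, k3, k4⟩ := H.free g hg
          refine ⟨L', ?_, k2, fun t htb hg' l1 r hr => ?_, ?_⟩
          · simp only [Function.update_of_ne hgg]
            refine k1.congr fun r hr hrc => Function.update_of_ne ?_ _ _
            intro he
            exact hgg (slotIdx_inj hrc hs he).1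
          · have h : t ≠ q := by rintro rfl; exact hgg hg'.symm
            simp only [Function.update_of_ne h] at l1 ⊢
            exact k3 t htb hg' l1 r hr
          · rw [← k4]; congr 2
            refine Finset.filter_congr fun t _ => ?_
            by_cases h : t = q
            · subst h; simp [Ne.symm hgg, ← hg₀]
            · simp [h]

/-- By `inj` the returned slot holds no other block, so its content may be replaced by a link to the
old head. The field becomes 0, hence the witness is the cheap block of rank 0. -/
theorem release (H : Λ.Inv W st) (hV : Λ.Valid) {q : ℕ} (hq : q < Λ.blocks) :
    ∃ w, Λ.Typ w ∧ Λ.Inv (Function.update W q w) (Λ.release st q) := by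
  obtain ⟨hb, ⟨ht, hf⟩ | ⟨ht, s, hs, hf, hsl⟩⟩ := H.block q hq
  · refine ⟨W q, ht, ?_⟩
    rw [Function.update_eq_self, Layout.release, if_neg (by omega)]
    exact H
  · obtain ⟨w, hw, hw0⟩ := exists_rank_zero hV.exists_typ
    refine ⟨w, hw, ?_⟩
    have hf1 : (2 * s + 1) % 2 = 1 := by omega
    have hf2 : (2 * s + 1) / 2 = s := by omega
    rw [Layout.release, hf, hf1, hf2, if_pos ⟨rfl, hs⟩]
    have hgq := grp_lt hq
    set g₀ := q / Λ.num with hg₀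
    have hne : ∀ t, ¬ Λ.Typ (Function.update W q w t) → t ≠ q := by
      rintro t h rfl; simp [hw] at h
    have hother : ∀ t < Λ.blocks, t / Λ.num = g₀ → ¬ Λ.Typ (W t) → t ≠ q →
        st.fld t ≠ 2 * s + 1 := by
      intro t htb hg k1 k2 k3
      exact k2 (H.inj t htb q hq hg k1 ht (k3.trans hf.symm))
    refine ⟨fun t htb => ?_, fun t htb t' htb' hg k1 k2 => ?_, fun z hz => ?_, fun g hg => ?_⟩
    · by_cases h : t = q
      · subst h; simp [hw, hw0, hw.1]
      · simp only [Function.update_of_ne h]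
        obtain ⟨k1, k2⟩ := H.block t htb
        refine ⟨k1, k2.imp_right ?_⟩
        rintro ⟨k3, r, hr, k4, k5⟩
        refine ⟨k3, r, hr, k4, ?_⟩
        rw [Function.update_of_ne, k5]
        intro he
        obtain ⟨he1, rfl⟩ := slotIdx_inj hr hs he
        exact hother t htb he1 k3 h k4
    · have h3 := hne _ k1
      have h4 := hne _ k2
      simp only [Function.update_of_ne h3, Function.update_of_ne h4] at k1 k2 ⊢
      exact H.inj t htb t' htb' hg k1 k2
    · by_cases h : z = g₀ * Λ.cap + s
      · subst h
        simp only [Function.update_self]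
        -- A link has to fit into a slot of `blk` bits, which is the purpose of `lam_le`.
        exact ((H.head_le hgq).trans_lt hV.cap_lt).trans_le
          (Nat.pow_le_pow_right two_pos hV.lam_le)
      · simpa [h] using H.slot_lt z hz
    · by_cases hgg : g = g₀
      · subst hgg
        obtain ⟨L, h1, h2, h3, h4⟩ := H.free _ hg
        have hsL : s ∉ L := fun h => h3 q hq rfl ht s h hf
        refine ⟨s :: L, ⟨by simp, hs, ?_⟩, List.nodup_cons.2 ⟨hsL, h2⟩, fun t htb hg k1 r hr => ?_, ?_⟩
        · simp only [Function.update_self]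
          refine h1.congr fun r hr hrc => Function.update_of_ne ?_ _ _
          intro he
          obtain ⟨-, rfl⟩ := slotIdx_inj hrc hs he
          exact hsL hr
        · have h5 := hne _ k1
          simp only [Function.update_of_ne h5] at k1 ⊢
          rcases List.mem_cons.1 hr with rfl | hr
          · exact hother t htb hg k1 h5
          · exact h3 t htb hg k1 r hr
        · have h5 : Λ.atyp W g₀ = insert q (Λ.atyp (Function.update W q w) g₀) := by
            ext t
            by_cases h : t = q
            · subst h; simp [atyp, hq, ht, ← hg₀]
            · simp [atyp, h]
          rw [← h4, h5, Finset.card_insert_of_notMem (by simp [atyp, hw])]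
          simp; ring
      · obtain ⟨L', k1, k2, k3, k4⟩ := H.free g hg
        refine ⟨L', ?_, k2, fun t htb hg' l1 r hr => ?_, ?_⟩
        · simp only [Function.update_of_ne hgg]
          refine k1.congr fun r hr hrc => Function.update_of_ne ?_ _ _
          intro he
          exact hgg (slotIdx_inj hrc hs he).1
        · have h5 := hne _ l1
          simp only [Function.update_of_ne h5] at l1 ⊢
          exact k3 t htb hg' l1 r hr
        · rw [← k4]; congr 2
          refine Finset.filter_congr fun t _ => ?_
          by_cases h : t = q
          · subst h; simp [Ne.symm hgg, ← hg₀]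
          · simp [h]

end Inv

theorem chain_empty {g : ℕ} (hg : g < Λ.grp) {k s : ℕ} (h : s + k = Λ.cap) :
    Λ.Chain Λ.empty.slot g s (List.range' s k) := by
  induction k generalizing s with
  | zero => simpa [Chain] using h
  | succ k ih =>
    have hs : s < Λ.cap := by omega
    have h1 : Λ.empty.slot (g * Λ.cap + s) = s + 1 := by
      simp only [empty]
      rw [if_pos (slotIdx_lt hg hs), mul_comm, Nat.mul_add_mod, Nat.mod_eq_of_lt hs]
    refine ⟨rfl, hs, ?_⟩
    rw [h1]
    exact ih (by omega)

theorem inv_empty (hV : Λ.Valid) : ∃ w, Λ.Typ w ∧ Λ.Inv (fun _ => w) Λ.empty := by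
  obtain ⟨w, hw, hw0⟩ := exists_rank_zero hV.exists_typ
  refine ⟨w, hw, fun q _ => ⟨hw.1, Or.inl ⟨hw, by simp [empty, hw0]⟩⟩,
    fun q _ q' _ _ h => absurd hw h, fun z hz => ?_, fun g hg => ?_⟩
  · simp only [empty, if_pos hz]
    have h0 : 0 < Λ.cap := Nat.pos_of_ne_zero (by rintro h; simp [h] at hz)
    have := Nat.mod_lt z h0
    have := hV.cap_lt
    have := Nat.pow_le_pow_right two_pos hV.lam_le
    omega
  · exact ⟨List.range' 0 Λ.cap, chain_empty hg (zero_add _), List.nodup_range',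
      fun q _ _ h => absurd hw h, by simp [atyp, hw]⟩

/-- The store after the first `k` of the blocks `B` have been put into the empty store. -/
def fill (Λ : Layout) (B : ℕ → ℕ) : ℕ → Store
  | 0 => Λ.empty
  | k + 1 => Λ.put (Λ.fill B k) k (B k)

/-- When no slot is left, `put` changes nothing, so the store stays well formed for some blocks `W`
even if the source word does not fit. Blocks from k on still equal the initial cheap block, as `put`
requires. If every group fits, the failing case cannot occur and `W` agrees with `B`. -/
theorem fill_inv (hV : Λ.Valid) {B : ℕ → ℕ} (hB : ∀ q, B q < 2 ^ Λ.blk) :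
    ∃ w, Λ.Typ w ∧ ∀ k ≤ Λ.blocks, ∃ W, Λ.Inv W (Λ.fill B k) ∧ (∀ q, k ≤ q → W q = w) ∧
      ((∀ g < Λ.grp, (Λ.atyp B g).card ≤ Λ.cap) → ∀ q < k, W q = B q) := by
  obtain ⟨w, hw, h0⟩ := inv_empty hV
  refine ⟨w, hw, fun k hk => ?_⟩
  induction k with
  | zero => exact ⟨fun _ => w, h0, fun _ _ => rfl, by simp⟩
  | succ k ih =>
    obtain ⟨W, h1, h2, h3⟩ := ih (by omega)
    have hWk : Λ.Typ (W k) := by rw [h2 k le_rfl]; exact hw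
    by_cases h : Λ.Typ (B k) ∨ (Λ.fill B k).head (k / Λ.num) < Λ.cap
    · refine ⟨Function.update W k (B k), h1.put (by omega) hWk (hB k) h, fun q hq => ?_,
        fun hc q hq => ?_⟩
      · rw [Function.update_of_ne (by omega), h2 q (by omega)]
      · by_cases hqk : q = k
        · subst hqk; simp
        · rw [Function.update_of_ne hqk, h3 hc q (by omega)]
    · push Not at h
      refine ⟨W, ?_, fun q hq => h2 q (by omega), fun hc => ?_⟩
      · rw [fill, Layout.put, if_neg h.1, if_neg (by omega)]
        exact h1
      -- Every expensive block of `W` with block k replaced is expensive in `B` too: below k the two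
      -- agree, and above k `W` is cheap.
      · refine absurd (h1.head_lt (by omega) hWk h.1 ?_) (by omega)
        refine le_trans (Finset.card_le_card ?_) (hc _ (grp_lt (q := k) (by omega)))
        intro q hq
        simp only [atyp, Finset.mem_filter] at hq ⊢
        refine ⟨hq.1, hq.2.1, ?_⟩
        rcases lt_trichotomy q k with hl | rfl | hl
        · rw [Function.update_of_ne hl.ne, h3 hc q hl] at hq
          exact hq.2.2
        · exact h.1
        · rw [Function.update_of_ne hl.ne', h2 q hl.le] at hq
          exact absurd hw hq.2.2

end Layout
end LocalCompression

namespace LocalCompression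

/-! ### Reading and writing numbers in the bit-probe model -/

namespace Decoder

variable {m : ℕ}

/-- Probe bit `j`; positions outside the word read as zero. -/
def readBit (j : ℕ) (k : Bool → Decoder m) : Decoder m :=
  if h : j < m then read ⟨j, h⟩ k else k false

/-- Probe `w` bits that form a number. -/
def readNat (pos : ℕ) : ℕ → (ℕ → Decoder m) → Decoder m
  | 0, k => k 0
  | w + 1, k => readNat pos w fun v => readBit (pos + w) fun b => k (v + b.toNat * 2 ^ w)

theorem eval_readBit (j : ℕ) (k : Bool → Decoder m) (c : Fin m → Bool) :
    (readBit j k).eval c = (k (ext c j)).eval c := by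
  unfold readBit ext
  split_ifs <;> rfl

theorem probes_readBit (j : ℕ) (k : Bool → Decoder m) (c : Fin m → Bool) :
    (readBit j k).probes c ≤ (k (ext c j)).probes c + 1 := by
  unfold readBit ext
  split_ifs
  · rfl
  · omega

theorem eval_readNat (pos w : ℕ) (k : ℕ → Decoder m) (c : Fin m → Bool) :
    (readNat pos w k).eval c = (k (val (ext c) pos w)).eval c := by
  induction w generalizing k with
  | zero => rfl
  | succ w ih => rw [readNat, ih, eval_readBit, val]

theorem probes_readNat (pos w : ℕ) (k : ℕ → Decoder m) (c : Fin m → Bool) :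
    (readNat pos w k).probes c ≤ (k (val (ext c) pos w)).probes c + w := by
  induction w generalizing k with
  | zero => rfl
  | succ w ih =>
    rw [readNat]
    refine (ih _).trans ?_
    have := probes_readBit (pos + w)
      (fun b => k (val (ext c) pos w + b.toNat * 2 ^ w)) c
    rw [val]
    omega

end Decoder

/-- The word `c` after the number `v` is written into the `w` bits from position `pos` on. -/
def writeWord {m : ℕ} (c : Fin m → Bool) (pos v w : ℕ) : Fin m → Bool :=
  fun j => if pos ≤ j ∧ (j : ℕ) < pos + w then v.testBit (j - pos) else c j

theorem ext_writeWord {m : ℕ} (c : Fin m → Bool) (pos v w : ℕ) {j : ℕ} (hj : j < m) :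
    ext (writeWord c pos v w) j
      = if pos ≤ j ∧ j < pos + w then v.testBit (j - pos) else ext c j := by
  simp [ext, hj, writeWord]

theorem ext_writeWord_of_disjoint {m : ℕ} (c : Fin m → Bool) (pos v w : ℕ) {j : ℕ}
    (h : j < pos ∨ pos + w ≤ j) : ext (writeWord c pos v w) j = ext c j := by
  by_cases hj : j < m
  · rw [ext_writeWord c pos v w hj, if_neg (by omega)]
  · simp [ext, hj]

theorem val_writeWord {m : ℕ} (c : Fin m → Bool) {pos v w : ℕ} (hv : v < 2 ^ w)
    (hm : pos + w ≤ m) : val (ext (writeWord c pos v w)) pos w = v :=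
  val_eq hv fun i hi => by
    rw [ext_writeWord _ _ _ _ (by omega), if_pos (by omega), Nat.add_sub_cancel_left]

theorem val_writeWord_of_disjoint {m : ℕ} (c : Fin m → Bool) (pos v w : ℕ) {pos' w' : ℕ}
    (h : pos' + w' ≤ pos ∨ pos + w ≤ pos') :
    val (ext (writeWord c pos v w)) pos' w' = val (ext c) pos' w' :=
  val_congr fun i hi => ext_writeWord_of_disjoint c pos v w (by omega)

namespace Updater

variable {m : ℕ}

/-- Read bit `j`; positions outside the word read as zero. -/
def readBit (j : ℕ) (k : Bool → Updater m) : Updater m :=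
  if h : j < m then read ⟨j, h⟩ k else k false

/-- Write bit `j`, unless the position is outside the word. -/
def writeBit (j : ℕ) (b : Bool) (next : Updater m) : Updater m :=
  if h : j < m then write ⟨j, h⟩ b next else next

/-- Read `w` bits that form a number. -/
def readNat (pos : ℕ) : ℕ → (ℕ → Updater m) → Updater m
  | 0, k => k 0
  | w + 1, k => readNat pos w fun v => readBit (pos + w) fun b => k (v + b.toNat * 2 ^ w)

/-- Write the number `v` into `w` bits. -/
def writeNat (pos v : ℕ) : ℕ → Updater m → Updater m
  | 0, next => next
  | w + 1, next => writeNat pos v w (writeBit (pos + w) (v.testBit w) next)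

theorem run_readBit (j : ℕ) (k : Bool → Updater m) (c : Fin m → Bool) :
    (readBit j k).run c = (k (ext c j)).run c := by
  unfold readBit ext
  split_ifs <;> rfl

theorem cost_readBit (j : ℕ) (k : Bool → Updater m) (c : Fin m → Bool) :
    (readBit j k).cost c ≤ (k (ext c j)).cost c + 1 := by
  unfold readBit ext
  split_ifs
  · rfl
  · omega

theorem run_readNat (pos w : ℕ) (k : ℕ → Updater m) (c : Fin m → Bool) :
    (readNat pos w k).run c = (k (val (ext c) pos w)).run c := by
  induction w generalizing k with
  | zero => rfl
  | succ w ih => rw [readNat, ih, run_readBit, val]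

theorem cost_readNat (pos w : ℕ) (k : ℕ → Updater m) (c : Fin m → Bool) :
    (readNat pos w k).cost c ≤ (k (val (ext c) pos w)).cost c + w := by
  induction w generalizing k with
  | zero => rfl
  | succ w ih =>
    rw [readNat]
    refine (ih _).trans ?_
    have := cost_readBit (pos + w) (fun b => k (val (ext c) pos w + b.toNat * 2 ^ w)) c
    rw [val]
    omega

theorem writeWord_succ (c : Fin m → Bool) (pos v w : ℕ) (h : pos + w < m) :
    writeWord c pos v (w + 1)
      = Function.update (writeWord c pos v w) ⟨pos + w, h⟩ (v.testBit w) := by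
  funext j
  by_cases hj : j = ⟨pos + w, h⟩
  · subst hj; simp [writeWord]
  · have : (j : ℕ) ≠ pos + w := fun h => hj (Fin.ext h)
    rw [Function.update_of_ne hj, writeWord, writeWord]
    refine if_congr ?_ rfl rfl
    omega

theorem writeWord_succ_of_le (c : Fin m → Bool) (pos v w : ℕ) (h : m ≤ pos + w) :
    writeWord c pos v (w + 1) = writeWord c pos v w := by
  funext j
  refine if_congr ?_ rfl rfl
  have := j.2
  omega

theorem run_writeNat (pos v w : ℕ) (next : Updater m) (c : Fin m → Bool) :
    (writeNat pos v w next).run c = next.run (writeWord c pos v w) := by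
  induction w generalizing next with
  | zero =>
    rw [writeNat]; congr 1
    funext j
    rw [writeWord, if_neg (by omega)]
  | succ w ih =>
    rw [writeNat, ih, writeBit]
    split_ifs with h
    · rw [writeWord_succ c pos v w h]; rfl
    · rw [writeWord_succ_of_le c pos v w (not_lt.1 h)]

theorem cost_writeNat (pos v w : ℕ) (next : Updater m) (c : Fin m → Bool) :
    (writeNat pos v w next).cost c ≤ next.cost (writeWord c pos v w) + w := by
  induction w generalizing next with
  | zero =>
    rw [writeNat, show writeWord c pos v 0 = c from
      funext fun j => by rw [writeWord, if_neg (by omega)]]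
    rfl
  | succ w ih =>
    rw [writeNat]
    refine (ih _).trans ?_
    rw [writeBit]
    split_ifs with h
    · rw [writeWord_succ c pos v w h, cost]; omega
    · rw [writeWord_succ_of_le c pos v w (not_lt.1 h)]; omega

end Updater

/-! ### The positions of the store in the codeword -/

namespace Layout

variable (Λ : Layout)

/-- Where the slots begin. -/
def slotPos : ℕ := Λ.blocks * (Λ.lam + 1)

/-- Where the heads of the lists of free slots begin. -/
def headPos : ℕ := Λ.slotPos + Λ.grp * Λ.cap * Λ.blk

/-- Where the uncompressed part begins. -/
def tailPos : ℕ := Λ.headPos + Λ.grp * Λ.lam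

/-- The number of source bits in the blocks. -/
def body : ℕ := Λ.blocks * Λ.blk

/-- The length of the codeword. -/
def len : ℕ := Λ.tailPos + (Λ.n - Λ.body)

/-- The bits `c` spell out the numbers in the store. -/
structure Rep (c : ℕ → Bool) (st : Store) : Prop where
  fld : ∀ q < Λ.blocks, val c (q * (Λ.lam + 1)) (Λ.lam + 1) = st.fld q
  slot : ∀ z < Λ.grp * Λ.cap, val c (Λ.slotPos + z * Λ.blk) Λ.blk = st.slot z
  head : ∀ g < Λ.grp, val c (Λ.headPos + g * Λ.lam) Λ.lam = st.head g

variable {Λ}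

theorem fld_le {q : ℕ} (hq : q < Λ.blocks) : q * (Λ.lam + 1) + (Λ.lam + 1) ≤ Λ.slotPos := by
  have := Nat.mul_le_mul_right (Λ.lam + 1) hq
  rw [Nat.succ_mul] at this
  exact this

theorem slot_le {z : ℕ} (hz : z < Λ.grp * Λ.cap) :
    Λ.slotPos + z * Λ.blk + Λ.blk ≤ Λ.headPos := by
  have := Nat.mul_le_mul_right Λ.blk hz
  rw [Nat.succ_mul] at this
  rw [headPos]
  omega

theorem head_le {g : ℕ} (hg : g < Λ.grp) : Λ.headPos + g * Λ.lam + Λ.lam ≤ Λ.tailPos := by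
  have := Nat.mul_le_mul_right Λ.lam hg
  rw [Nat.succ_mul] at this
  rw [tailPos]
  omega

theorem slotPos_le : Λ.slotPos ≤ Λ.headPos := Nat.le_add_right _ _

theorem headPos_le : Λ.headPos ≤ Λ.tailPos := Nat.le_add_right _ _

theorem tailPos_le : Λ.tailPos ≤ Λ.len := Nat.le_add_right _ _

theorem region_disjoint {i j w : ℕ} (h : i ≠ j) : i * w + w ≤ j * w ∨ j * w + w ≤ i * w := by
  rcases lt_or_gt_of_ne h with h | h
  · left; have := Nat.mul_le_mul_right w h; rwa [Nat.succ_mul] at this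
  · right; have := Nat.mul_le_mul_right w h; rwa [Nat.succ_mul] at this

variable {m : ℕ} {c : Fin m → Bool} {st : Store}

theorem Rep.writeFld (H : Λ.Rep (ext c) st) (hm : Λ.tailPos ≤ m) {q v : ℕ}
    (hq : q < Λ.blocks) (hv : v < 2 ^ (Λ.lam + 1)) :
    Λ.Rep (ext (writeWord c (q * (Λ.lam + 1)) v (Λ.lam + 1)))
      { st with fld := Function.update st.fld q v } := by
  have h1 := fld_le hq
  have h2 := Λ.slotPos_le
  have h3 := Λ.headPos_le
  refine ⟨fun t ht => ?_, fun z hz => ?_, fun g hg => ?_⟩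
  · by_cases h : t = q
    · subst h
      rw [val_writeWord c hv (by omega)]; simp
    · rw [val_writeWord_of_disjoint _ _ _ _ (region_disjoint h), H.fld t ht]
      simp [h]
  · rw [val_writeWord_of_disjoint _ _ _ _ (by omega), H.slot z hz]
  · rw [val_writeWord_of_disjoint _ _ _ _ (by omega), H.head g hg]

theorem Rep.writeSlot (H : Λ.Rep (ext c) st) (hm : Λ.tailPos ≤ m) {z v : ℕ}
    (hz : z < Λ.grp * Λ.cap) (hv : v < 2 ^ Λ.blk) :
    Λ.Rep (ext (writeWord c (Λ.slotPos + z * Λ.blk) v Λ.blk))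
      { st with slot := Function.update st.slot z v } := by
  have h1 := slot_le hz
  have h3 := Λ.headPos_le
  refine ⟨fun t ht => ?_, fun t ht => ?_, fun g hg => ?_⟩
  · have := fld_le ht
    rw [val_writeWord_of_disjoint _ _ _ _ (by omega), H.fld t ht]
  · by_cases h : t = z
    · subst h
      rw [val_writeWord c hv (by omega)]; simp
    · have := region_disjoint (w := Λ.blk) h
      rw [val_writeWord_of_disjoint _ _ _ _ (by omega), H.slot t ht]
      simp [h]
  · rw [val_writeWord_of_disjoint _ _ _ _ (by omega), H.head g hg]

theorem Rep.writeHead (H : Λ.Rep (ext c) st) (hm : Λ.tailPos ≤ m) {g v : ℕ}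
    (hg : g < Λ.grp) (hv : v < 2 ^ Λ.lam) :
    Λ.Rep (ext (writeWord c (Λ.headPos + g * Λ.lam) v Λ.lam))
      { st with head := Function.update st.head g v } := by
  have h1 := head_le hg
  have h3 := Λ.slotPos_le
  refine ⟨fun t ht => ?_, fun t ht => ?_, fun t ht => ?_⟩
  · have := fld_le ht
    rw [val_writeWord_of_disjoint _ _ _ _ (by omega), H.fld t ht]
  · have := slot_le ht
    rw [val_writeWord_of_disjoint _ _ _ _ (by omega), H.slot t ht]
  · by_cases h : t = g
    · subst h
      rw [val_writeWord c hv (by omega)]; simp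
    · have := region_disjoint (w := Λ.lam) h
      rw [val_writeWord_of_disjoint _ _ _ _ (by omega), H.head t ht]
      simp [h]

variable (Λ)

/-! ### The encoder and the local algorithms -/

/-- The value of block `q` of the source word `x`. -/
def srcBlock (x : ℕ → Bool) (q : ℕ) : ℕ := val x (q * Λ.blk) Λ.blk

/-- Bit `j` of the codeword that spells out the store and the uncompressed part of `x`. -/
def spell (st : Store) (x : ℕ → Bool) (j : ℕ) : Bool :=
  if j < Λ.slotPos then (st.fld (j / (Λ.lam + 1))).testBit (j % (Λ.lam + 1))
  else if j < Λ.headPos then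
    (st.slot ((j - Λ.slotPos) / Λ.blk)).testBit ((j - Λ.slotPos) % Λ.blk)
  else if j < Λ.tailPos then
    (st.head ((j - Λ.headPos) / Λ.lam)).testBit ((j - Λ.headPos) % Λ.lam)
  else x (Λ.body + (j - Λ.tailPos))

/-- The encoder. -/
def enc (m : ℕ) {n : ℕ} (x : Fin n → Bool) : Fin m → Bool :=
  fun j => Λ.spell (Λ.fill (Λ.srcBlock (ext x)) Λ.blocks) (ext x) j

/-- The local decoder for position `i`. -/
noncomputable def localDec (m i : ℕ) : Decoder m :=
  if i < Λ.body then
    Decoder.readNat (i / Λ.blk * (Λ.lam + 1)) (Λ.lam + 1) fun f =>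
      if f % 2 = 0 then Decoder.answer ((Λ.unrank (f / 2)).testBit (i % Λ.blk))
      else if f / 2 < Λ.cap then
        Decoder.readBit (Λ.slotPos + (i / Λ.blk / Λ.num * Λ.cap + f / 2) * Λ.blk + i % Λ.blk)
          Decoder.answer
      else Decoder.answer false
  else Decoder.readBit (Λ.tailPos + (i - Λ.body)) Decoder.answer

variable {Λ}

theorem spell_rep {st : Store} {x : ℕ → Bool} {d : Fin m → Bool} (hm : Λ.tailPos ≤ m)
    (hd : ∀ j, d j = Λ.spell st x j)
    (hf : ∀ q < Λ.blocks, st.fld q < 2 ^ (Λ.lam + 1))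
    (hs : ∀ z < Λ.grp * Λ.cap, st.slot z < 2 ^ Λ.blk)
    (hh : ∀ g < Λ.grp, st.head g < 2 ^ Λ.lam) : Λ.Rep (ext d) st := by
  have hd' : ∀ j < m, ext d j = Λ.spell st x j := fun j hj => by
    rw [ext_of_lt d hj, hd]
  have h2 := Λ.slotPos_le
  have h3 := Λ.headPos_le
  have key : ∀ {t w i : ℕ}, i < w → (t * w + i) / w = t ∧ (t * w + i) % w = i := by
    intro t w i hi
    rw [mul_comm t, Nat.mul_add_div (by omega), Nat.mul_add_mod, Nat.div_eq_of_lt hi,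
      Nat.mod_eq_of_lt hi]
    exact ⟨rfl, rfl⟩
  refine ⟨fun q hq => val_eq (hf q hq) fun i hi => ?_, fun z hz => val_eq (hs z hz) fun i hi => ?_,
    fun g hg => val_eq (hh g hg) fun i hi => ?_⟩
  · have := fld_le hq
    rw [hd' _ (by omega), spell, if_pos (by omega), (key hi).1, (key hi).2]
  · have := slot_le hz
    rw [hd' _ (by omega), spell, if_neg (by omega), if_pos (by omega), add_assoc,
      Nat.add_sub_cancel_left, (key hi).1, (key hi).2]
  · have := head_le hg
    rw [hd' _ (by omega), spell, if_neg (by omega), if_neg (by omega), if_pos (by omega),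
      add_assoc, Nat.add_sub_cancel_left, (key hi).1, (key hi).2]

/-- No invariant is needed, only a store that the word spells out. Such a store can be read off from
any word, so this also serves to compare the decoding program with the local decoder on arbitrary
codewords. -/
theorem eval_localDec {st : Store} (H : Λ.Rep (ext c) st) (i : ℕ) :
    (Λ.localDec m i).eval c = if i < Λ.body then (Λ.blockOf st (i / Λ.blk)).testBit (i % Λ.blk)
      else ext c (Λ.tailPos + (i - Λ.body)) := by
  rw [localDec]
  split_ifs with hi
  · have hq : i / Λ.blk < Λ.blocks := Nat.div_lt_of_lt_mul (by rwa [mul_comm])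
    have hb : 0 < Λ.blk := Nat.pos_of_ne_zero (by rintro h; simp [body, h] at hi)
    rw [Decoder.eval_readNat, H.fld _ hq, blockOf]
    split_ifs with h1 h2
    · rfl
    · rw [Decoder.eval_readBit, ← H.slot _ (slotIdx_lt (grp_lt hq) h2),
        testBit_val _ _ (Nat.mod_lt _ hb)]
      rfl
    · simp [Decoder.eval]
  · rw [Decoder.eval_readBit]; rfl

theorem probes_localDec (c : Fin m → Bool) (i : ℕ) : (Λ.localDec m i).probes c ≤ Λ.lam + 2 := by
  rw [localDec]
  split_ifs
  · refine (Decoder.probes_readNat _ _ _ _).trans ?_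
    split_ifs
    · simp [Decoder.probes]
    · have := Decoder.probes_readBit (Λ.slotPos + (i / Λ.blk / Λ.num * Λ.cap +
        val (ext c) (i / Λ.blk * (Λ.lam + 1)) (Λ.lam + 1) / 2) * Λ.blk + i % Λ.blk)
          Decoder.answer c
      rw [Decoder.probes] at this
      omega
    · simp [Decoder.probes]
  · refine (Decoder.probes_readBit _ _ _).trans ?_
    simp [Decoder.probes]

/-- The word of `b` bits that arises from `w` when bit `r` is set to `a`. -/
def setBit (w r : ℕ) (a : Bool) (b : ℕ) : ℕ := val (fun k => if k = r then a else w.testBit k) 0 b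

variable (Λ)

/-- The part of the updater that puts a block. -/
def putUpd (m q w : ℕ) : Updater m :=
  if Λ.Typ w then Updater.writeNat (q * (Λ.lam + 1)) (2 * Λ.rank w) (Λ.lam + 1) Updater.done
  else Updater.readNat (Λ.headPos + q / Λ.num * Λ.lam) Λ.lam fun h =>
    if h < Λ.cap then
      Updater.readNat (Λ.slotPos + (q / Λ.num * Λ.cap + h) * Λ.blk) Λ.blk fun s =>
        Updater.writeNat (q * (Λ.lam + 1)) (2 * h + 1) (Λ.lam + 1) <|
        Updater.writeNat (Λ.slotPos + (q / Λ.num * Λ.cap + h) * Λ.blk) w Λ.blk <|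
        Updater.writeNat (Λ.headPos + q / Λ.num * Λ.lam) s Λ.lam Updater.done
    else Updater.done

/-- The part of the updater that gives back a slot; `f` is the content of the field. -/
def releaseUpd {m : ℕ} (q f : ℕ) (next : Updater m) : Updater m :=
  if f % 2 = 1 ∧ f / 2 < Λ.cap then
    Updater.readNat (Λ.headPos + q / Λ.num * Λ.lam) Λ.lam fun h =>
      Updater.writeNat (q * (Λ.lam + 1)) 0 (Λ.lam + 1) <|
      Updater.writeNat (Λ.slotPos + (q / Λ.num * Λ.cap + f / 2) * Λ.blk) h Λ.blk <|
      Updater.writeNat (Λ.headPos + q / Λ.num * Λ.lam) (f / 2) Λ.lam next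
  else next

/-- The part of the updater that reads a block; `f` is the content of the field. -/
noncomputable def readUpd {m : ℕ} (q f : ℕ) (k : ℕ → Updater m) : Updater m :=
  if f % 2 = 0 then k (Λ.unrank (f / 2))
  else if f / 2 < Λ.cap then
    Updater.readNat (Λ.slotPos + (q / Λ.num * Λ.cap + f / 2) * Λ.blk) Λ.blk k
  else k 0

/-- The updater that sets source bit `i` to `a`. -/
noncomputable def localUpd (m i : ℕ) (a : Bool) : Updater m :=
  if i < Λ.body then
    Updater.readNat (i / Λ.blk * (Λ.lam + 1)) (Λ.lam + 1) fun f =>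
      Λ.readUpd (i / Λ.blk) f fun w =>
        Λ.releaseUpd (i / Λ.blk) f <|
          Λ.putUpd m (i / Λ.blk) (setBit w (i % Λ.blk) a Λ.blk)
  else Updater.writeBit (Λ.tailPos + (i - Λ.body)) a Updater.done

variable {Λ}

theorem cost_putUpd (q w : ℕ) (c : Fin m → Bool) :
    (Λ.putUpd m q w).cost c ≤ 3 * Λ.lam + 1 + 2 * Λ.blk := by
  rw [putUpd]
  split_ifs
  · refine (Updater.cost_writeNat _ _ _ _ _).trans ?_
    simp only [Updater.cost]; omega
  · refine (Updater.cost_readNat _ _ _ _).trans ?_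
    split_ifs
    · refine (Nat.add_le_add_right (Updater.cost_readNat _ _ _ _) _).trans ?_
      refine (Nat.add_le_add_right (Nat.add_le_add_right (Updater.cost_writeNat _ _ _ _ _) _)
        _).trans ?_
      refine (Nat.add_le_add_right (Nat.add_le_add_right (Nat.add_le_add_right
        (Updater.cost_writeNat _ _ _ _ _) _) _) _).trans ?_
      refine (Nat.add_le_add_right (Nat.add_le_add_right (Nat.add_le_add_right
        (Nat.add_le_add_right (Updater.cost_writeNat _ _ _ _ _) _) _) _) _).trans ?_
      simp only [Updater.cost]; omega
    · simp only [Updater.cost]; omega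

theorem cost_releaseUpd (q f : ℕ) (next : Updater m) {B : ℕ} (hB : ∀ c, next.cost c ≤ B)
    (c : Fin m → Bool) :
    (Λ.releaseUpd q f next).cost c ≤ B + (3 * Λ.lam + 1 + Λ.blk) := by
  rw [releaseUpd]
  split_ifs
  · refine (Updater.cost_readNat _ _ _ _).trans ?_
    refine (Nat.add_le_add_right (Updater.cost_writeNat _ _ _ _ _) _).trans ?_
    refine (Nat.add_le_add_right (Nat.add_le_add_right (Updater.cost_writeNat _ _ _ _ _) _)
      _).trans ?_
    refine (Nat.add_le_add_right (Nat.add_le_add_right (Nat.add_le_add_right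
      (Updater.cost_writeNat _ _ _ _ _) _) _) _).trans ?_
    have := hB (writeWord (writeWord (writeWord c (q * (Λ.lam + 1)) 0 (Λ.lam + 1))
      (Λ.slotPos + (q / Λ.num * Λ.cap + f / 2) * Λ.blk)
      (val (ext c) (Λ.headPos + q / Λ.num * Λ.lam) Λ.lam) Λ.blk)
      (Λ.headPos + q / Λ.num * Λ.lam) (f / 2) Λ.lam)
    omega
  · have := hB c
    omega

theorem cost_readUpd (q f : ℕ) (k : ℕ → Updater m) {B : ℕ} (hB : ∀ w c, (k w).cost c ≤ B)
    (c : Fin m → Bool) : (Λ.readUpd q f k).cost c ≤ B + Λ.blk := by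
  rw [readUpd]
  split_ifs
  · exact (hB _ _).trans (Nat.le_add_right _ _)
  · exact (Updater.cost_readNat _ _ _ _).trans (Nat.add_le_add_right (hB _ _) _)
  · exact (hB _ _).trans (Nat.le_add_right _ _)

/-- Reading the field costs `lam + 1`, reading the block `blk`, releasing `3 * lam + 1 + blk`, and
putting `3 * lam + 1 + 2 * blk`. Each bound holds whatever the memory contains. -/
theorem cost_localUpd (i : ℕ) (a : Bool) (c : Fin m → Bool) :
    (Λ.localUpd m i a).cost c ≤ 7 * Λ.lam + 4 * Λ.blk + 3 := by
  rw [localUpd]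
  split_ifs
  · refine (Updater.cost_readNat _ _ _ _).trans ?_
    refine (Nat.add_le_add_right (cost_readUpd _ _ _ (fun w c =>
      cost_releaseUpd _ _ _ (fun c => cost_putUpd _ _ c) c) _) _).trans ?_
    omega
  · rw [Updater.writeBit]
    split_ifs
    · simp only [Updater.cost]; omega
    · simp only [Updater.cost]; omega

theorem cost_localUpd_of_body_le {i : ℕ} (hi : Λ.body ≤ i) (a : Bool) (c : Fin m → Bool) :
    (Λ.localUpd m i a).cost c ≤ 1 := by
  rw [localUpd, if_neg (by omega), Updater.writeBit]
  split_ifs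
  · simp [Updater.cost]
  · simp [Updater.cost]

theorem probes_localDec_of_body_le {i : ℕ} (hi : Λ.body ≤ i) (c : Fin m → Bool) :
    (Λ.localDec m i).probes c ≤ 1 := by
  rw [localDec, if_neg (by omega)]
  refine (Decoder.probes_readBit _ _ _).trans ?_
  simp [Decoder.probes]

/-! ### The updater simulates the operations on the store -/

variable {W : ℕ → ℕ}

/-- Besides the flag a field has `lam` bits. Ranks fit because there are at most `2 ^ lam` cheap
blocks, slot numbers because `cap < 2 ^ lam`. -/
theorem Inv.fld_lt (H : Λ.Inv W st) (hV : Λ.Valid) {q : ℕ} (hq : q < Λ.blocks) :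
    st.fld q < 2 ^ (Λ.lam + 1) := by
  have h1 := hV.count_le
  have h2 := hV.cap_lt
  obtain ⟨-, ⟨h3, h4⟩ | ⟨-, s, hs, h4, -⟩⟩ := H.block q hq
  · have := h3.rank_lt
    rw [pow_succ]; omega
  · rw [pow_succ]; omega

/-- The new head is read from a slot of `blk` bits but written into `lam` bits. The invariant is
used to see that nothing is cut off: a link in the free list is at most `cap`. -/
theorem run_putUpd (H : Λ.Inv W st) (hV : Λ.Valid) (hm : Λ.tailPos ≤ m) (R : Λ.Rep (ext c) st)
    {q w : ℕ} (hq : q < Λ.blocks) (hw : w < 2 ^ Λ.blk) :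
    Λ.Rep (ext ((Λ.putUpd m q w).run c)) (Λ.put st q w) ∧
      ∀ j, Λ.tailPos ≤ j → ext ((Λ.putUpd m q w).run c) j = ext c j := by
  have hg := grp_lt hq
  have h1 := fld_le hq
  have h2 := Λ.slotPos_le
  have h3 := Λ.headPos_le
  have h4 := head_le hg
  have h5 := hV.count_le
  have h6 := hV.cap_lt
  rw [putUpd, put]
  by_cases ht : Λ.Typ w
  · rw [if_pos ht, if_pos ht, Updater.run_writeNat]
    have := ht.rank_lt
    exact ⟨R.writeFld hm hq (by rw [pow_succ]; omega),
      fun j hj => ext_writeWord_of_disjoint _ _ _ _ (by omega)⟩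
  · rw [if_neg ht, if_neg ht, Updater.run_readNat, R.head _ hg]
    split_ifs with hc
    · have hz := slotIdx_lt hg hc
      have hn := H.next_le hg hc
      have h7 := slot_le hz
      rw [Updater.run_readNat, R.slot _ hz, Updater.run_writeNat, Updater.run_writeNat,
        Updater.run_writeNat]
      refine ⟨((R.writeFld hm hq (by rw [pow_succ]; omega)).writeSlot hm hz hw).writeHead hm hg
        (by omega), fun j hj => ?_⟩
      change ext (writeWord _ _ _ _) j = _
      rw [ext_writeWord_of_disjoint _ _ _ _ (by omega),
        ext_writeWord_of_disjoint _ _ _ _ (by omega), ext_writeWord_of_disjoint _ _ _ _ (by omega)]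
    · exact ⟨R, fun _ _ => rfl⟩

theorem run_releaseUpd (H : Λ.Inv W st) (hV : Λ.Valid) (hm : Λ.tailPos ≤ m)
    (R : Λ.Rep (ext c) st) {q : ℕ} (hq : q < Λ.blocks) (next : Updater m) :
    ∃ d : Fin m → Bool, (Λ.releaseUpd q (st.fld q) next).run c = next.run d ∧
      Λ.Rep (ext d) (Λ.release st q) ∧ ∀ j, Λ.tailPos ≤ j → ext d j = ext c j := by
  have hg := grp_lt hq
  have h1 := fld_le hq
  have h2 := Λ.slotPos_le
  have h3 := Λ.headPos_le
  have h4 := head_le hg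
  rw [releaseUpd, release]
  split_ifs with hc
  · have hz := slotIdx_lt hg hc.2
    have h7 := slot_le hz
    have h5 := H.head_le hg
    have h6 := hV.cap_lt
    have h8 := Nat.pow_le_pow_right two_pos hV.lam_le
    rw [Updater.run_readNat, R.head _ hg, Updater.run_writeNat, Updater.run_writeNat,
      Updater.run_writeNat]
    refine ⟨_, rfl, ((R.writeFld hm hq (by positivity)).writeSlot hm hz (by omega)).writeHead hm hg
      (by omega), fun j hj => ?_⟩
    rw [ext_writeWord_of_disjoint _ _ _ _ (by omega),
      ext_writeWord_of_disjoint _ _ _ _ (by omega), ext_writeWord_of_disjoint _ _ _ _ (by omega)]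
  · exact ⟨c, rfl, R, fun _ _ => rfl⟩

theorem run_readUpd (R : Λ.Rep (ext c) st) {q : ℕ} (hq : q < Λ.blocks) (k : ℕ → Updater m) :
    (Λ.readUpd q (st.fld q) k).run c = (k (Λ.blockOf st q)).run c := by
  rw [readUpd, blockOf]
  split_ifs with h1 h2
  · rfl
  · rw [Updater.run_readNat, R.slot _ (slotIdx_lt (grp_lt hq) h2)]
  · rfl

/-! ### Maintaining the codeword -/

variable (Λ)

/-- The codeword `c` is a correct description of the source word `x`. -/
def Good {n m : ℕ} (x : Fin n → Bool) (c : Fin m → Bool) : Prop :=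
  (∃ st, Λ.Inv (Λ.srcBlock (ext x)) st ∧ Λ.Rep (ext c) st) ∧
    ∀ i, Λ.body ≤ i → i < Λ.n → ext c (Λ.tailPos + (i - Λ.body)) = ext x i

/-- No group of the source word needs more slots than there are. -/
def Fits {n : ℕ} (x : Fin n → Bool) : Prop :=
  ∀ g < Λ.grp, (Λ.atyp (Λ.srcBlock (ext x)) g).card ≤ Λ.cap

variable {Λ}

/-- Free slots and expensive blocks of a group add up to `cap`. -/
theorem Inv.fits {n : ℕ} {x : Fin n → Bool} (H : Λ.Inv (Λ.srcBlock (ext x)) st) : Λ.Fits x := by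
  intro g hg
  obtain ⟨L, -, -, -, h⟩ := H.free g hg
  omega

theorem div_mul_blk_add {i b : ℕ} : i / b * b + i % b = i := by
  rw [mul_comm]; exact Nat.div_add_mod i b

theorem Good.eval {x : Fin Λ.n → Bool} {c : Fin m → Bool} (H : Λ.Good x c) (i : Fin Λ.n) :
    (Λ.localDec m i).eval c = x i := by
  obtain ⟨⟨st, h1, h2⟩, h3⟩ := H
  rw [eval_localDec h2]
  split_ifs with hi
  · have hq : (i : ℕ) / Λ.blk < Λ.blocks := Nat.div_lt_of_lt_mul (by rwa [mul_comm])
    have hb : 0 < Λ.blk := Nat.pos_of_ne_zero (by rintro h; simp [body, h] at hi)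
    rw [h1.blockOf_eq hq, srcBlock, testBit_val _ _ (Nat.mod_lt _ hb), div_mul_blk_add, ext_fin]
  · rw [h3 _ (not_lt.1 hi) i.2, ext_fin]

theorem enc_rep (hV : Λ.grp ≠ 0 → Λ.Valid) (hm : Λ.tailPos ≤ m) {n : ℕ} (x : Fin n → Bool) :
    ∃ W st, Λ.Inv W st ∧ Λ.Rep (ext (Λ.enc m x)) st ∧
      (Λ.Fits x → ∀ q < Λ.blocks, W q = Λ.srcBlock (ext x) q) := by
  -- Without groups the store is vacuous and `Valid` is not available; this is the uncompressed
  -- scheme.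
  rcases eq_or_ne Λ.grp 0 with h0 | h0
  · refine ⟨fun _ => 0, Λ.empty, ⟨?_, ?_, ?_, ?_⟩, ⟨?_, ?_, ?_⟩, ?_⟩ <;> simp [blocks, h0]
  · obtain ⟨w, hw, h⟩ := fill_inv (hV h0) (B := Λ.srcBlock (ext x)) fun q => val_lt _ _ _
    obtain ⟨W, h1, -, h2⟩ := h _ le_rfl
    refine ⟨W, _, h1, spell_rep hm (fun j => rfl) (fun q hq => h1.fld_lt (hV h0) hq) h1.slot_lt
      fun g hg => (h1.head_le hg).trans_lt (hV h0).cap_lt, h2⟩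

theorem enc_tail (hm : m = Λ.len) (x : Fin Λ.n → Bool) (i : ℕ) (hi : Λ.body ≤ i) (hn : i < Λ.n) :
    ext (Λ.enc m x) (Λ.tailPos + (i - Λ.body)) = ext x i := by
  have h1 := Λ.slotPos_le
  have h2 := Λ.headPos_le
  rw [ext_of_lt _ (by rw [hm, len]; omega), enc, spell, if_neg (by dsimp; omega),
    if_neg (by dsimp; omega), if_neg (by dsimp; omega)]
  congr 1
  dsimp; omega

theorem good_enc_of_fits (hV : Λ.grp ≠ 0 → Λ.Valid) (hm : m = Λ.len) {x : Fin Λ.n → Bool}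
    (hx : Λ.Fits x) : Λ.Good x (Λ.enc m x) := by
  obtain ⟨W, st, h1, h2, h3⟩ := enc_rep (m := m) hV (by rw [hm]; exact Λ.tailPos_le) x
  exact ⟨⟨st, h1.congr fun q hq => (h3 hx q hq).symm, h2⟩, enc_tail hm x⟩

/-- The encoder's store holds some blocks `W` in any case. The local decoder reads `W` off the
codeword, so if it returns the source word, then `W` consists of the source blocks. Thus correct
decoding, and not only `Fits`, gives the invariant. -/
theorem good_enc_of_eval (hV : Λ.grp ≠ 0 → Λ.Valid) (hm : m = Λ.len) (hb : Λ.body ≤ Λ.n)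
    {x : Fin Λ.n → Bool}
    (hx : ∀ i : Fin Λ.n, (Λ.localDec m i).eval (Λ.enc m x) = x i) : Λ.Good x (Λ.enc m x) := by
  obtain ⟨W, st, h1, h2, -⟩ := enc_rep (m := m) hV (by rw [hm]; exact Λ.tailPos_le) x
  refine ⟨⟨st, h1.congr fun q hq => ?_, h2⟩, enc_tail hm x⟩
  rw [srcBlock]
  refine val_eq (h1.block q hq).1 fun r hr => ?_
  have hbody : q * Λ.blk + r < Λ.body := by
    have := Nat.mul_le_mul_right Λ.blk hq
    rw [Nat.succ_mul] at this
    rw [body]; omega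
  have h3 := hx ⟨q * Λ.blk + r, by omega⟩
  have h4 : (q * Λ.blk + r) / Λ.blk = q := by
    rw [mul_comm, Nat.mul_add_div (by omega), Nat.div_eq_of_lt hr, add_zero]
  have h5 : (q * Λ.blk + r) % Λ.blk = r := by
    rw [mul_comm, Nat.mul_add_mod, Nat.mod_eq_of_lt hr]
  rw [eval_localDec h2, if_pos hbody, h4, h5, h1.blockOf_eq hq] at h3
  rw [ext_of_lt x (by omega), ← h3]

theorem srcBlock_update {n : ℕ} (x : Fin n → Bool) (i : Fin n) (a : Bool) (hb : 0 < Λ.blk) :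
    Λ.srcBlock (ext (Function.update x i a)) = Function.update (Λ.srcBlock (ext x)) (i / Λ.blk)
      (setBit (Λ.srcBlock (ext x) (i / Λ.blk)) (i % Λ.blk) a Λ.blk) := by
  have hext : ∀ j, ext (Function.update x i a) j = if j = i then a else ext x j := by
    intro j
    by_cases hj : j < n
    · rw [ext_of_lt _ hj, ext_of_lt _ hj, Function.update_apply]
      exact if_congr (Fin.ext_iff) rfl rfl
    · have := i.2
      rw [if_neg (by omega)]
      simp [ext, hj]
  funext q
  by_cases hq : q = i / Λ.blk
  · subst hq
    rw [Function.update_self]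
    refine val_congr fun r hr => ?_
    rw [hext, srcBlock, zero_add, testBit_val _ _ hr]
    refine if_congr ?_ rfl rfl
    have := div_mul_blk_add (i := (i : ℕ)) (b := Λ.blk)
    omega
  · rw [Function.update_of_ne hq]
    refine val_congr fun r hr => ?_
    rw [hext, if_neg]
    rintro h
    apply hq
    rw [← h, mul_comm, Nat.mul_add_div hb, Nat.div_eq_of_lt hr, add_zero]

/-- Releasing makes block q cheap and returns its slot, if it had one. Overwriting q in the result
gives the blocks of the updated word; as that word fits, `head_lt` provides a free slot if the new
block is expensive. Outside the blocks a single bit is written, beyond the part that spells out the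
store. -/
theorem Good.update (hV : Λ.grp ≠ 0 → Λ.Valid) (hm : m = Λ.len)
    {x : Fin Λ.n → Bool} {c : Fin m → Bool} (H : Λ.Good x c) (i : Fin Λ.n) (a : Bool)
    (hx : Λ.Fits (Function.update x i a)) :
    Λ.Good (Function.update x i a) ((Λ.localUpd m i a).run c) := by
  have hext : ∀ j, ext (Function.update x i a) j = if j = i then a else ext x j := by
    intro j
    by_cases hj : j < Λ.n
    · rw [ext_of_lt _ hj, ext_of_lt _ hj, Function.update_apply]
      exact if_congr (Fin.ext_iff) rfl rfl
    · have := i.2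
      rw [if_neg (by omega)]
      simp [ext, hj]
  have htm : Λ.tailPos ≤ m := by rw [hm]; exact Λ.tailPos_le
  obtain ⟨⟨st, h1, h2⟩, h3⟩ := H
  rw [localUpd]
  split_ifs with hi
  · have hq : (i : ℕ) / Λ.blk < Λ.blocks := Nat.div_lt_of_lt_mul (by rwa [mul_comm])
    have hb : 0 < Λ.blk := Nat.pos_of_ne_zero (by rintro h; simp [body, h] at hi)
    have hg : Λ.grp ≠ 0 := by rintro h; simp [blocks, h] at hq
    have hV := hV hg
    rw [Updater.run_readNat, h2.fld _ hq, run_readUpd h2 hq, h1.blockOf_eq hq]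
    set w := setBit (Λ.srcBlock (ext x) (i / Λ.blk)) (i % Λ.blk) a Λ.blk with hw
    have hwlt : w < 2 ^ Λ.blk := val_lt _ _ _
    have hup := Λ.srcBlock_update x i a hb
    rw [← hw] at hup
    obtain ⟨d, h4, h5, h6⟩ := run_releaseUpd h1 hV htm h2 hq (Λ.putUpd m (i / Λ.blk) w)
    obtain ⟨w', hw', h7⟩ := h1.release hV hq
    rw [h4]
    obtain ⟨h8, h9⟩ := run_putUpd h7 hV htm h5 hq hwlt
    have ht : Λ.Typ w ∨ (Λ.release st (i / Λ.blk)).head (i / Λ.blk / Λ.num) < Λ.cap := by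
      by_cases ht : Λ.Typ w
      · exact Or.inl ht
      · refine Or.inr (h7.head_lt hq (w := w) (by simpa using hw') ht ?_)
        rw [Function.update_idem, ← hup]
        exact hx _ (grp_lt hq)
    refine ⟨⟨_, ?_, h8⟩, fun j hj hjn => ?_⟩
    · rw [hup]
      have := h7.put hq (by simpa using hw') hwlt ht
      rwa [Function.update_idem] at this
    · rw [h9 _ (by omega), h6 _ (by omega), h3 j hj hjn, hext, if_neg (by omega)]
  · have hlt : Λ.tailPos + (i - Λ.body) < m := by
      have := i.2
      rw [hm, len]; omega
    have hrun : ∀ j, ext ((Updater.writeBit (Λ.tailPos + (i - Λ.body)) a Updater.done).run c) j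
        = if j = Λ.tailPos + (i - Λ.body) then a else ext c j := by
      intro j
      rw [Updater.writeBit, dif_pos hlt, Updater.run, Updater.run]
      by_cases hj : j < m
      · rw [ext_of_lt _ hj, ext_of_lt _ hj, Function.update_apply]
        exact if_congr (Fin.ext_iff) rfl rfl
      · rw [if_neg (by omega)]
        simp [ext, hj]
    have hlow : ∀ j < Λ.tailPos,
        ext ((Updater.writeBit (Λ.tailPos + (i - Λ.body)) a Updater.done).run c) j = ext c j :=
      fun j hj => by rw [hrun, if_neg (by omega)]
    have h4 := Λ.slotPos_le
    have h5 := Λ.headPos_le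
    refine ⟨⟨st, h1.congr fun q hq => ?_, ⟨fun q hq => ?_, fun z hz => ?_, fun g hg => ?_⟩⟩,
      fun j hj hjn => ?_⟩
    · refine val_congr fun r hr => ?_
      rw [hext, if_neg]
      rintro h
      apply hi
      have := Nat.mul_le_mul_right Λ.blk hq
      rw [Nat.succ_mul] at this
      rw [body]; omega
    · have := fld_le hq
      rw [← h2.fld q hq]
      exact val_congr fun r hr => hlow _ (by omega)
    · have := slot_le hz
      rw [← h2.slot z hz]
      exact val_congr fun r hr => hlow _ (by omega)
    · have := head_le hg
      rw [← h2.head g hg]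
      exact val_congr fun r hr => hlow _ (by omega)
    · rw [hrun, hext, h3 j hj hjn]
      refine if_congr ?_ rfl rfl
      omega

end Layout
end LocalCompression

namespace LocalCompression

/-! ### Running times on the random access machine -/

/-- All numbers in the memory have at most `L` bits. -/
def Memory.Bdd (L : ℕ) (s : Memory) : Prop :=
  (∀ x, s.reg x < 2 ^ L) ∧ ∀ a i, s.arr a i < 2 ^ L

theorem Memory.Bdd.mono {L L' : ℕ} (h : L ≤ L') {s : Memory} (H : s.Bdd L) : s.Bdd L' :=
  ⟨fun x => (H.1 x).trans_le (Nat.pow_le_pow_right two_pos h),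
    fun a i => (H.2 a i).trans_le (Nat.pow_le_pow_right two_pos h)⟩

theorem Memory.Bdd.setReg {L : ℕ} {s : Memory} (H : s.Bdd L) {x k : ℕ} (hk : k < 2 ^ L) :
    (s.setReg x k).Bdd L := by
  refine ⟨fun y => ?_, H.2⟩
  by_cases h : y = x
  · subst h; simpa [Memory.setReg] using hk
  · simpa [Memory.setReg, h] using H.1 y

theorem Memory.Bdd.setArr {L : ℕ} {s : Memory} (H : s.Bdd L) {a i k : ℕ} (hk : k < 2 ^ L) :
    (s.setArr a i k).Bdd L := by
  refine ⟨H.1, fun b j => ?_⟩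
  by_cases h : b = a
  · subst h
    by_cases h : j = i
    · subst h; simpa [Memory.setArr] using hk
    · simpa [Memory.setArr, h] using H.2 b j
  · simpa [Memory.setArr, h] using H.2 b j

/-! ### Bit lengths and costs of loop-free code -/

namespace Expr

/-- If the memory holds numbers of `L` bits, then the value has at most `deg * L` bits. -/
def deg : Expr → ℕ
  | const k => Nat.size k + 1
  | reg _ => 1
  | get _ _ => 1
  | add e f => e.deg + f.deg
  | sub e f => e.deg + f.deg
  | mul e f => e.deg + f.deg
  | div e f => e.deg + f.deg
  | mod e f => e.deg + f.deg

/-- If the memory holds numbers of `L` bits, then the cost is at most `wt * L`. -/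
def wt : Expr → ℕ
  | const k => 1 + Nat.size k
  | reg _ => 2
  | get _ i => i.wt + 2
  | add e f => e.wt + f.wt + (1 + (e.deg + f.deg))
  | sub e f => e.wt + f.wt + (1 + (e.deg + f.deg))
  | mul e f => e.wt + f.wt + (1 + (e.deg + f.deg))
  | div e f => e.wt + f.wt + (1 + (e.deg + f.deg))
  | mod e f => e.wt + f.wt + (1 + (e.deg + f.deg))

theorem one_le_deg (e : Expr) : 1 ≤ e.deg := by
  induction e <;> simp only [deg] <;> omega

theorem add_lt_two_pow {a b x y : ℕ} (hx : 1 ≤ x) (hy : 1 ≤ y) (ha : a < 2 ^ x) (hb : b < 2 ^ y) :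
    a + b < 2 ^ (x + y) := by
  have h1 : 2 ^ 1 ≤ 2 ^ x := Nat.pow_le_pow_right two_pos hx
  have h2 : 2 ^ 1 ≤ 2 ^ y := Nat.pow_le_pow_right two_pos hy
  rw [pow_add]
  nlinarith

variable {L : ℕ} {s : Memory}

theorem eval_lt (hL : 1 ≤ L) (H : s.Bdd L) (e : Expr) : e.eval s < 2 ^ (e.deg * L) := by
  have hmono : ∀ {a x y : ℕ}, a < 2 ^ (x * L) → a < 2 ^ ((x + y) * L) := fun h =>
    h.trans_le (Nat.pow_le_pow_right two_pos (Nat.mul_le_mul_right _ (Nat.le_add_right _ _)))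
  have hpos : ∀ e : Expr, 1 ≤ e.deg * L := fun e => Nat.mul_pos e.one_le_deg hL
  induction e with
  | const k =>
    refine (Nat.lt_size_self k).trans_le (Nat.pow_le_pow_right two_pos ?_)
    rw [deg]; nlinarith
  | reg x => simpa [deg, eval] using H.1 x
  | get a i => simpa [deg, eval] using H.2 a _
  | add e f he hf =>
    rw [deg, eval, add_mul]
    exact add_lt_two_pow (hpos e) (hpos f) he hf
  | sub e f he hf => exact (Nat.sub_le _ _).trans_lt (hmono he)
  | mul e f he hf =>
    rw [deg, eval, add_mul, pow_add]
    exact Nat.mul_lt_mul'' he hf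
  | div e f he hf => exact (Nat.div_le_self _ _).trans_lt (hmono he)
  | mod e f he hf => exact (Nat.mod_le _ _).trans_lt (hmono he)

theorem cost_le (hL : 1 ≤ L) (H : s.Bdd L) (e : Expr) : e.cost s ≤ e.wt * L := by
  have key : ∀ {x d : ℕ}, x < 2 ^ (d * L) → 1 + Nat.size x ≤ (1 + d) * L := fun {x d} h => by
    have := Nat.size_le.2 h
    nlinarith
  induction e with
  | const k => rw [cost, wt]; exact Nat.le_mul_of_pos_right _ hL
  | reg x => exact key (d := 1) (by simpa using H.1 x)
  | get a i hi =>
    have := key (d := 1) (by simpa using H.2 a (i.eval s))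
    rw [cost, wt]; linarith
  | add e f he hf => have := key (eval_lt hL H (e.add f)); rw [cost, wt]; simp only [deg, eval] at this; linarith
  | sub e f he hf => have := key (eval_lt hL H (e.sub f)); rw [cost, wt]; simp only [deg, eval] at this; linarith
  | mul e f he hf => have := key (eval_lt hL H (e.mul f)); rw [cost, wt]; simp only [deg, eval] at this; linarith
  | div e f he hf => have := key (eval_lt hL H (e.div f)); rw [cost, wt]; simp only [deg, eval] at this; linarith
  | mod e f he hf => have := key (eval_lt hL H (e.mod f)); rw [cost, wt]; simp only [deg, eval] at this; linarith

end Expr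

namespace Program

/-- There are no loops in the program. -/
def Straight : Program → Prop
  | skip => True
  | assign _ _ => True
  | store _ _ _ => True
  | seq P Q => P.Straight ∧ Q.Straight
  | ite _ P Q => P.Straight ∧ Q.Straight
  | loop _ _ => False

/-- The effect of a program without loops. -/
def sem : Program → Memory → Memory
  | skip, s => s
  | assign x e, s => s.setReg x (e.eval s)
  | store a i e, s => s.setArr a (i.eval s) (e.eval s)
  | seq P Q, s => Q.sem (P.sem s)
  | ite e P Q, s => if e.eval s = 0 then Q.sem s else P.sem s
  | loop _ _, s => s

/-- The factor by which a program without loops can increase the bit length of the numbers in the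
memory. -/
def deg : Program → ℕ
  | skip => 1
  | assign _ e => e.deg
  | store _ _ e => e.deg
  | seq P Q => P.deg * Q.deg
  | ite _ P Q => P.deg + Q.deg
  | loop _ _ => 1

/-- The factor in the bound on the running time. -/
def wt : Program → ℕ
  | skip => 1
  | assign _ e => e.wt + 1
  | store _ i e => i.wt + e.wt + 1
  | seq P Q => P.wt + P.deg * Q.wt
  | ite e P Q => e.wt + 1 + P.wt + Q.wt
  | loop e P => e.wt + 1 + P.wt

theorem one_le_deg (P : Program) : 1 ≤ P.deg := by
  induction P with
  | skip => exact le_rfl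
  | assign x e => exact e.one_le_deg
  | store a i e => exact e.one_le_deg
  | seq P Q hP hQ => exact Nat.mul_pos hP hQ
  | ite e P Q hP hQ => rw [deg]; omega
  | loop e P _ => exact le_rfl

/-- `P` takes the memory `s` to `s'` in time at most `P.wt * L * J`. -/
def Runs (P : Program) (L J : ℕ) (s s' : Memory) : Prop :=
  ∃ t, Exec P s s' t ∧ t ≤ P.wt * L * J

theorem Runs.mono {P : Program} {L J J' : ℕ} {s s' : Memory} (H : P.Runs L J s s') (h : J ≤ J') :
    P.Runs L J' s s' := by
  obtain ⟨t, h1, h2⟩ := H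
  exact ⟨t, h1, h2.trans (Nat.mul_le_mul_left _ h)⟩

theorem Runs.seq {P Q : Program} {L J : ℕ} {s s' s'' : Memory} (H : P.Runs L J s s')
    (H' : Q.Runs L J s' s'') : (P.seq Q).Runs L J s s'' := by
  obtain ⟨t, h1, h2⟩ := H
  obtain ⟨t', h3, h4⟩ := H'
  refine ⟨t + t', h1.seq h3, (Nat.add_le_add h2 h4).trans ?_⟩
  rw [← add_mul, ← add_mul, wt]
  refine Nat.mul_le_mul_right _ (Nat.mul_le_mul_right _ (Nat.add_le_add_left ?_ _))
  -- In `wt` the factor `P.deg` allows for numbers that `P` has made longer. Here both runs refer to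
  -- the same `L`, and the factor is slack.
  exact Nat.le_mul_of_pos_left _ P.one_le_deg

/-- A fixed program without loops lengthens numbers by a constant factor only. The second part of a
sequence starts with numbers of `P.deg * L` bits, whence the form of `wt`. -/
theorem Straight.exec {L : ℕ} (hL : 1 ≤ L) {P : Program} (hP : P.Straight) {s : Memory}
    (H : s.Bdd L) : (P.sem s).Bdd (P.deg * L) ∧ ∃ t, Exec P s (P.sem s) t ∧ t ≤ P.wt * L := by
  induction P generalizing L s with
  | skip => exact ⟨by simpa [deg, sem] using H, 1, Exec.skip s, by simpa [wt] using hL⟩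
  | assign x e =>
    refine ⟨(H.mono ?_).setReg (e.eval_lt hL H), _, Exec.assign x e s, ?_⟩
    · exact Nat.le_mul_of_pos_left _ e.one_le_deg
    · have := e.cost_le hL H
      rw [wt, add_mul, one_mul]; omega
  | store a i e =>
    refine ⟨(H.mono ?_).setArr (e.eval_lt hL H), _, Exec.store a i e s, ?_⟩
    · exact Nat.le_mul_of_pos_left _ e.one_le_deg
    · have := e.cost_le hL H
      have := i.cost_le hL H
      rw [wt, add_mul, add_mul, one_mul]; omega
  | seq P Q ihP ihQ =>
    obtain ⟨h1, t, h2, h3⟩ := ihP hL hP.1 H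
    obtain ⟨h4, t', h5, h6⟩ := ihQ (Nat.mul_pos P.one_le_deg hL) hP.2 h1
    refine ⟨h4.mono (by rw [deg]; linarith), t + t', h2.seq h5, ?_⟩
    rw [wt]; linarith
  | ite e P Q ihP ihQ =>
    have hc := e.cost_le hL H
    rw [sem]
    split_ifs with h
    · obtain ⟨h1, t, h2, h3⟩ := ihQ hL hP.2 H
      refine ⟨h1.mono (by rw [deg]; nlinarith), _, Exec.ite_false h h2, ?_⟩
      rw [wt]; nlinarith
    · obtain ⟨h1, t, h2, h3⟩ := ihP hL hP.1 H
      refine ⟨h1.mono (by rw [deg]; nlinarith), _, Exec.ite_true h h2, ?_⟩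
      rw [wt]; nlinarith
  | loop e P _ => exact hP.elim

theorem Straight.runs {L J : ℕ} (hL : 1 ≤ L) (hJ : 1 ≤ J) {P : Program} (hP : P.Straight)
    {s s' : Memory} (H : s.Bdd L) (hs : P.sem s = s') : P.Runs L J s s' := by
  obtain ⟨-, t, h1, h2⟩ := hP.exec hL H
  exact ⟨t, hs ▸ h1, h2.trans (Nat.le_mul_of_pos_right _ hJ)⟩

/-- The bound `L` is required of every memory of an explicit sequence, since the factor `deg` would
compound over the passes. The condition is tested once more than the body is run. -/
theorem Straight.runs_loop {L N : ℕ} (hL : 1 ≤ L) {e : Expr} {P : Program} (hP : P.Straight)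
    (s : ℕ → Memory) (H : ∀ k ≤ N, (s k).Bdd L) (he : ∀ k < N, e.eval (s k) ≠ 0)
    (he' : e.eval (s N) = 0) (hs : ∀ k < N, P.sem (s k) = s (k + 1)) :
    (loop e P).Runs L (N + 1) (s 0) (s N) := by
  induction N generalizing s with
  | zero =>
    refine ⟨_, Exec.loop_false he', ?_⟩
    have := e.cost_le hL (H 0 le_rfl)
    rw [wt]; nlinarith
  | succ N ih =>
    obtain ⟨-, t, h1, h2⟩ := hP.exec hL (H 0 (Nat.zero_le _))
    rw [hs 0 (by omega)] at h1
    obtain ⟨t', h3, h4⟩ := ih (fun k => s (k + 1)) (fun k hk => H _ (by omega))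
      (fun k hk => he _ (by omega)) he' (fun k hk => hs _ (by omega))
    refine ⟨_, Exec.loop_true (he 0 (by omega)) h1 h3, ?_⟩
    have := e.cost_le hL (H 0 (Nat.zero_le _))
    rw [wt] at h4 ⊢
    nlinarith

end Program

/-! ### Memories given by lists -/

/-- The memory with the given registers and arrays, and zero elsewhere. -/
def listMem (r : List ℕ) (a : List (ℕ → ℕ)) : Memory where
  reg := fun i => r.getD i 0
  arr := fun i => a.getD i fun _ => 0

theorem listMem_reg (r : List ℕ) (a : List (ℕ → ℕ)) (x : ℕ) : (listMem r a).reg x = r.getD x 0 := rfl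

theorem listMem_arr (r : List ℕ) (a : List (ℕ → ℕ)) (x : ℕ) :
    (listMem r a).arr x = a.getD x fun _ => 0 := rfl

theorem getD_set {α : Type*} (l : List α) {x : ℕ} (hx : x < l.length) (v d : α) (y : ℕ) :
    (l.set x v).getD y d = if y = x then v else l.getD y d := by
  simp only [List.getD_eq_getElem?_getD, List.getElem?_set]
  by_cases h : x = y
  · subst h; simp [hx]
  · simp [h, Ne.symm h]

theorem listMem_setReg {r : List ℕ} {a : List (ℕ → ℕ)} {x : ℕ} (hx : x < r.length) (k : ℕ) :
    (listMem r a).setReg x k = listMem (r.set x k) a := by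
  simp only [Memory.setReg, listMem, Memory.mk.injEq, and_true]
  funext y
  rw [getD_set r hx, Function.update_apply]

theorem listMem_setArr {r : List ℕ} {a : List (ℕ → ℕ)} {x : ℕ} (hx : x < a.length) (i k : ℕ) :
    (listMem r a).setArr x i k = listMem r (a.set x (Function.update (a.getD x fun _ => 0) i k)) := by
  simp only [Memory.setArr, listMem, Memory.mk.injEq, true_and]
  funext y
  rw [getD_set a hx, Function.update_apply]

theorem listMem_bdd {L : ℕ} {r : List ℕ} {a : List (ℕ → ℕ)} (hr : ∀ v ∈ r, v < 2 ^ L)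
    (ha : ∀ f ∈ a, ∀ i, f i < 2 ^ L) : (listMem r a).Bdd L := by
  refine ⟨fun x => ?_, fun x i => ?_⟩
  · rw [listMem_reg, List.getD_eq_getElem?_getD]
    rcases h : r[x]? with _ | v
    · simp
    · exact hr v (List.mem_of_getElem? h)
  · rw [listMem_arr, List.getD_eq_getElem?_getD]
    rcases h : a[x]? with _ | v
    · simp
    · exact ha v (List.mem_of_getElem? h) i

/-! ### Loops with a counter -/

namespace Layout

/-- The memory in the main part of the programs. -/
def mem (Λ : Layout) (m z k : ℕ) (a : List (ℕ → ℕ)) : Memory :=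
  listMem [Λ.n, m, Λ.lam, Λ.num, Λ.blk, Λ.cap, Λ.grp, z, k] a

/-- Numbers of `L` bits suffice for the quantities that the layout involves. -/
structure Small (Λ : Layout) (m L : ℕ) : Prop where
  n : Λ.n < 2 ^ L
  m : m < 2 ^ L
  lam : Λ.lam < 2 ^ L
  num : Λ.num < 2 ^ L
  blk : Λ.blk < 2 ^ L
  cap : Λ.cap < 2 ^ L
  grp : Λ.grp < 2 ^ L

variable {Λ : Layout} {m L : ℕ}

theorem Small.one_le (H : Λ.Small m L) : 1 ≤ L := by
  have := H.num
  have := Λ.num_pos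
  rcases Nat.eq_zero_or_pos L with rfl | h
  · omega
  · exact h

theorem Small.mem_bdd (H : Λ.Small m L) {z k : ℕ} {a : List (ℕ → ℕ)} (hz : z < 2 ^ L)
    (hk : k < 2 ^ L) (ha : ∀ f ∈ a, ∀ i, f i < 2 ^ L) : (Λ.mem m z k a).Bdd L := by
  refine listMem_bdd ?_ ha
  simp [H.n, H.m, H.lam, H.num, H.blk, H.cap, H.grp, hz, hk]

theorem mem_setReg7 (z k v : ℕ) (a : List (ℕ → ℕ)) :
    (Λ.mem m z k a).setReg 7 v = Λ.mem m v k a := listMem_setReg (by simp) v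

theorem mem_setReg8 (z k v : ℕ) (a : List (ℕ → ℕ)) :
    (Λ.mem m z k a).setReg 8 v = Λ.mem m z v a := listMem_setReg (by simp) v

theorem mem_setReg1 (z k v : ℕ) (a : List (ℕ → ℕ)) :
    (Λ.mem m z k a).setReg 1 v = Λ.mem v z k a := listMem_setReg (by simp) v

theorem mem_setArr {x : ℕ} {a : List (ℕ → ℕ)} (hx : x < a.length) (z k i v : ℕ) :
    (Λ.mem m z k a).setArr x i v
      = Λ.mem m z k (a.set x (Function.update (a.getD x fun _ => 0) i v)) := listMem_setArr hx i v

theorem mem_arr (z k x : ℕ) (a : List (ℕ → ℕ)) :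
    (Λ.mem m z k a).arr x = a.getD x fun _ => 0 := rfl

end Layout

namespace Program

open Layout

/-- Run the body for each value of register 7 below the limit. -/
def forLoop (lim : Expr) (P : Program) : Program :=
  seq (assign 7 (Expr.const 0))
    (loop (Expr.sub lim (Expr.reg 7)) (seq P (assign 7 (Expr.add (Expr.reg 7) (Expr.const 1)))))

variable {Λ : Layout} {m L : ℕ}

/-- The memories at the start of the passes are given explicitly by `k` and `a`, and the body must
leave the counter alone. Truncated subtraction makes the loop condition vanish exactly when the
counter reaches the limit. -/
theorem runs_forLoop (HS : Λ.Small m L) {lim : Expr} {P : Program} (hP : P.Straight) {N z₀ : ℕ}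
    (hN : N < 2 ^ L) (hz₀ : z₀ < 2 ^ L) (k : ℕ → ℕ) (a : ℕ → List (ℕ → ℕ))
    (hk : ∀ z ≤ N, k z < 2 ^ L)
    (ha : ∀ z ≤ N, ∀ f ∈ a z, ∀ i, f i < 2 ^ L)
    (hlim : ∀ z ≤ N, lim.eval (Λ.mem m z (k z) (a z)) = N)
    (hs : ∀ z < N, P.sem (Λ.mem m z (k z) (a z)) = Λ.mem m z (k (z + 1)) (a (z + 1))) :
    (forLoop lim P).Runs L (N + 1) (Λ.mem m z₀ (k 0) (a 0)) (Λ.mem m N (k N) (a N)) := by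
  refine Runs.seq (s' := Λ.mem m 0 (k 0) (a 0)) ?_ ?_
  · refine Straight.runs (P := assign 7 (Expr.const 0)) HS.one_le (by omega) trivial
      (HS.mem_bdd hz₀ (hk 0 (Nat.zero_le _)) (ha 0 (Nat.zero_le _))) ?_
    rw [sem, mem_setReg7]; rfl
  · refine Straight.runs_loop (P := seq P (assign 7 (Expr.add (Expr.reg 7) (Expr.const 1))))
      HS.one_le ⟨hP, trivial⟩ (fun z => Λ.mem m z (k z) (a z))
      (fun z hz => HS.mem_bdd (by omega) (hk z hz) (ha z hz)) (fun z hz => ?_) ?_ fun z hz => ?_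
    · rw [Expr.eval, hlim z hz.le]
      change N - z ≠ 0
      omega
    · rw [Expr.eval, hlim N le_rfl]
      exact Nat.sub_self N
    · rw [sem, hs z hz, sem, mem_setReg7]; rfl

/-- Fill consecutive entries of the array `x`. -/
def fillLoop (x : ℕ) (lim off e : Expr) : Program :=
  forLoop lim (store x (Expr.add off (Expr.reg 7)) e)

theorem mem_set_cases {α : Type*} {l : List α} {x : ℕ} {v w : α} (h : w ∈ l.set x v) :
    w ∈ l ∨ w = v := List.mem_or_eq_of_mem_set h

/-- Only the counter and the array `x` change during the loop. So the values of `lim`, `off` and `e`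
are required for arbitrary contents `g` of that array. -/
theorem runs_fillLoop (HS : Λ.Small m L) {x : ℕ} {lim off e : Expr} {a : List (ℕ → ℕ)}
    (hx : x < a.length) {N z₀ k O : ℕ} {f : ℕ → ℕ} (hN : N < 2 ^ L) (hz₀ : z₀ < 2 ^ L)
    (hk : k < 2 ^ L) (ha : ∀ g ∈ a, ∀ i, g i < 2 ^ L) (hf : ∀ z < N, f z < 2 ^ L)
    (hlim : ∀ z g, lim.eval (Λ.mem m z k (a.set x g)) = N)
    (hoff : ∀ z g, off.eval (Λ.mem m z k (a.set x g)) = O)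
    (he : ∀ z < N, ∀ g, e.eval (Λ.mem m z k (a.set x g)) = f z) :
    (fillLoop x lim off e).Runs L (N + 1) (Λ.mem m z₀ k a) (Λ.mem m N k (a.set x fun j =>
      if O ≤ j ∧ j < O + N then f (j - O) else a.getD x (fun _ => 0) j)) := by
  have h0 : a = a.set x fun j =>
      if O ≤ j ∧ j < O + 0 then f (j - O) else a.getD x (fun _ => 0) j := by
    have : (fun j => if O ≤ j ∧ j < O + 0 then f (j - O) else a.getD x (fun _ => 0) j) = a[x] := by
      funext j
      rw [if_neg (by omega), List.getD_eq_getElem _ _ hx]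
    rw [this, List.set_getElem_self]
  have key := runs_forLoop (lim := lim) (P := store x (Expr.add off (Expr.reg 7)) e) HS trivial hN
    hz₀ (fun _ => k) (fun z => a.set x fun j =>
      if O ≤ j ∧ j < O + z then f (j - O) else a.getD x (fun _ => 0) j) (fun _ _ => hk) ?_ ?_ ?_
  · rwa [← h0] at key
  · intro z hz g hg i
    rcases mem_set_cases hg with hg | rfl
    · exact ha g hg i
    · dsimp only
      split_ifs with h
      · exact hf _ (by omega)
      · rw [List.getD_eq_getElem _ _ hx]
        exact ha _ (List.getElem_mem hx) i
  · intro z hz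
    exact hlim _ _
  · intro z hz
    rw [sem, mem_setArr (by simpa using hx), he z hz, Expr.eval, hoff, getD_set _ hx, if_pos rfl,
      List.set_set]
    congr 2
    funext j
    rw [Function.update_apply]
    change (if j = O + z then _ else _) = _
    by_cases h : j = O + z
    · rw [if_pos h, if_pos (by omega), h, Nat.add_sub_cancel_left]
    · rw [if_neg h]
      exact if_congr (by omega) rfl rfl

/-- Collect the bits in array 0 from position `off` on into numbers of `w` bits in the array `x`;
array 2 holds the powers of two. -/
def collectLoop (x : ℕ) (lim off w : Expr) : Program :=
  forLoop lim (store x (Expr.div (Expr.reg 7) w) (Expr.add (Expr.get x (Expr.div (Expr.reg 7) w))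
    (Expr.mul (Expr.get 0 (Expr.add off (Expr.reg 7))) (Expr.get 2 (Expr.mod (Expr.reg 7) w)))))

/-- After `z` passes the entry `q` consists of the lowest `min ω (z - q * ω)` bits of its number;
truncated subtraction gives 0 for the entries not yet reached. -/
theorem runs_collectLoop (HS : Λ.Small m L) {x : ℕ} {lim off w : Expr} {a : List (ℕ → ℕ)}
    (hx : x < a.length) (hx0 : x ≠ 0) (hx2 : x ≠ 2) {T ω z₀ k O : ℕ} {c : ℕ → Bool}
    (hN : T * ω < 2 ^ L) (hz₀ : z₀ < 2 ^ L) (hω : ω ≤ L)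
    (hk : k < 2 ^ L) (ha : ∀ g ∈ a, ∀ i, g i < 2 ^ L)
    (ha0 : a.getD 0 (fun _ => 0) = fun j => (c j).toNat)
    (ha2 : ∀ i < ω, a.getD 2 (fun _ => 0) i = 2 ^ i)
    (hax : a.getD x (fun _ => 0) = fun _ => 0)
    (hlim : ∀ z g, lim.eval (Λ.mem m z k (a.set x g)) = T * ω)
    (hoff : ∀ z g, off.eval (Λ.mem m z k (a.set x g)) = O)
    (hw : ∀ z g, w.eval (Λ.mem m z k (a.set x g)) = ω) :
    (collectLoop x lim off w).Runs L (T * ω + 1) (Λ.mem m z₀ k a) (Λ.mem m (T * ω) k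
      (a.set x fun q => if q < T then val c (O + q * ω) ω else 0)) := by
  have h0 : a.set x (fun q => val c (O + q * ω) (min ω (0 - q * ω))) = a := by
    have : (fun q => val c (O + q * ω) (min ω (0 - q * ω))) = a[x] := by
      rw [← List.getD_eq_getElem _ (fun _ => 0) hx, hax]
      funext q
      simp [val]
    rw [this, List.set_getElem_self]
  have hT : (fun q => val c (O + q * ω) (min ω (T * ω - q * ω)))
      = fun q => if q < T then val c (O + q * ω) ω else 0 := by
    funext q
    rw [← Nat.sub_mul]
    split_ifs with h
    · rw [min_eq_left (Nat.le_mul_of_pos_left _ (by omega))]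
    · rw [Nat.sub_eq_zero_of_le (by omega)]
      simp [val]
  have key := runs_forLoop (lim := lim) (P := store x (Expr.div (Expr.reg 7) w)
    (Expr.add (Expr.get x (Expr.div (Expr.reg 7) w)) (Expr.mul (Expr.get 0 (Expr.add off
      (Expr.reg 7))) (Expr.get 2 (Expr.mod (Expr.reg 7) w))))) HS trivial hN
    hz₀ (fun _ => k) (fun z => a.set x fun q => val c (O + q * ω) (min ω (z - q * ω)))
      (fun _ _ => hk) ?_ ?_ ?_
  · rwa [h0, hT] at key
  · intro z hz g hg i
    rcases mem_set_cases hg with hg | rfl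
    · exact ha g hg i
    · exact (val_lt _ _ _).trans_le (Nat.pow_le_pow_right two_pos ((min_le_left _ _).trans hω))
  · intro z hz
    exact hlim _ _
  · intro z hz
    have hω0 : 0 < ω := Nat.pos_of_ne_zero (by rintro rfl; simp at hz)
    have h7 : ∀ g, (Λ.mem m z k (a.set x g)).reg 7 = z := fun _ => rfl
    have hm := Nat.mod_lt z hω0
    have hd := div_mul_blk_add (i := z) (b := ω)
    rw [sem, mem_setArr (by simpa using hx), getD_set _ hx, if_pos rfl, List.set_set]
    simp only [Expr.eval, hoff, hw, h7, mem_arr]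
    rw [getD_set _ hx, getD_set _ hx, getD_set _ hx, if_pos rfl, if_neg hx0.symm, if_neg hx2.symm,
      ha0, ha2 _ hm]
    congr 2
    funext q
    rw [Function.update_apply]
    split_ifs with h
    · subst h
      have h1 : min ω (z - z / ω * ω) = z % ω := by omega
      have h2 : min ω (z + 1 - z / ω * ω) = z % ω + 1 := by omega
      rw [h1, h2, val, show O + z / ω * ω + z % ω = O + z by omega]
    · congr 1
      rcases lt_or_gt_of_ne h with h | h
      · have h1 := Nat.mul_le_mul_right ω h
        rw [Nat.succ_mul] at h1
        omega
      · have h1 := Nat.mul_le_mul_right ω h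
        rw [Nat.succ_mul] at h1
        omega

end Program
end LocalCompression

namespace LocalCompression

/-! ### The programs -/

/-- The constants of a scheme: the blocks have about `v / u` times as many bits as their codes, a one
costs `α₁` and a zero `α₀`, and a fraction `2 ^ (-d)` of the blocks may use overflow slots. Words of
length less than `n₀` are not stored. -/
structure Params where
  u : ℕ
  v : ℕ
  α₀ : ℕ
  α₁ : ℕ
  d : ℕ
  n₀ : ℕ

/-- The layout for block length `n`. -/
def Params.layout (P : Params) (n : ℕ) : Layout where
  n := n
  -- A group has `2 ^ lam` blocks, more than log n, so that the bound on its overflow beats the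
  -- number of groups; pointers within it take about log log n bits.
  lam := Nat.size (Nat.size n)
  blk := Nat.size (Nat.size n) * P.v / P.u
  cap := 2 ^ Nat.size (Nat.size n) / 2 ^ P.d
  grp := n / (2 ^ Nat.size (Nat.size n) * (Nat.size (Nat.size n) * P.v / P.u))
  α₀ := P.α₀
  α₁ := P.α₁
  τ := P.v * Nat.size (Nat.size n)

namespace Program

open LocalCompression.Expr

/-- Compute the layout in the registers 2 to 6. -/
def setup (P : Params) : Program :=
  seq (assign 7 (reg 0)) <|
  seq (loop (reg 7) (seq (assign 7 (div (reg 7) (const 2))) (assign 8 (add (reg 8) (const 1))))) <|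
  seq (assign 3 (const 1)) <|
  seq (loop (reg 8) (seq (assign 8 (div (reg 8) (const 2)))
    (seq (assign 2 (add (reg 2) (const 1))) (assign 3 (mul (reg 3) (const 2)))))) <|
  seq (assign 4 (div (mul (reg 2) (const P.v)) (const P.u))) <|
  seq (assign 5 (div (reg 3) (const (2 ^ P.d)))) <|
  assign 6 (div (reg 0) (mul (reg 3) (reg 4)))

/-- Tabulate the powers of two in array 2. -/
def powers : Program :=
  seq (assign 8 (const 1)) <|
  forLoop (add (add (reg 4) (reg 2)) (const 1))
    (seq (store 2 (reg 7) (reg 8)) (assign 8 (mul (reg 8) (const 2))))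

/-- Positive if the block `e` is cheap; array 3 holds the numbers of ones. -/
def cheap (P : Params) (e : Expr) : Expr :=
  sub (add (mul (const P.v) (reg 2)) (const 1))
    (add (mul (const P.α₁) (get 3 e)) (mul (const P.α₀) (sub (reg 4) (get 3 e))))

/-- Tabulate the numbers of ones, the ranks, and the cheap blocks in the arrays 3 to 5. -/
def tables (P : Params) : Program :=
  seq (assign 8 (const 0)) <|
  forLoop (get 2 (reg 4)) <|
    seq (store 3 (reg 7) (add (get 3 (div (reg 7) (const 2))) (mod (reg 7) (const 2)))) <|
    seq (store 4 (reg 7) (reg 8)) <|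
    ite (cheap P (reg 7)) (seq (store 5 (reg 8) (reg 7)) (assign 8 (add (reg 8) (const 1)))) skip

/-- Put the blocks from array 6 into the store in the arrays 8, 7, 9. -/
def putLoop (P : Params) : Program :=
  forLoop (mul (reg 6) (reg 3)) <|
    ite (cheap P (get 6 (reg 7))) (store 8 (reg 7) (mul (const 2) (get 4 (get 6 (reg 7))))) <|
    ite (sub (reg 5) (get 9 (div (reg 7) (reg 3))))
      (seq (store 8 (reg 7) (add (mul (const 2) (get 9 (div (reg 7) (reg 3)))) (const 1))) <|
      seq (store 9 (div (reg 7) (reg 3)) (get 7 (add (mul (div (reg 7) (reg 3)) (reg 5))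
        (get 9 (div (reg 7) (reg 3)))))) <|
      store 7 (add (mul (div (reg 7) (reg 3)) (reg 5)) (div (get 8 (reg 7)) (const 2)))
        (get 6 (reg 7)))
      skip

/-- The bit with index register 7 of the numbers of `w` bits in the array `x`. -/
def bitOf (x : ℕ) (w : Expr) : Expr :=
  mod (div (get x (div (reg 7) w)) (get 2 (mod (reg 7) w))) (const 2)

/-- The number of bits of a field. -/
def fldBits : Expr := add (reg 2) (const 1)

/-- The position of the slots. -/
def slotPos : Expr := mul (mul (reg 6) (reg 3)) fldBits

/-- The position of the heads of the lists of free slots. -/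
def headPos : Expr := add slotPos (mul (mul (reg 6) (reg 5)) (reg 4))

/-- The position of the uncompressed part. -/
def tailPos : Expr := add headPos (mul (reg 6) (reg 2))

/-- The number of source bits in the blocks. -/
def body : Expr := mul (mul (reg 6) (reg 3)) (reg 4)

/-- The encoding program for long words. -/
def encMain (P : Params) : Program :=
  seq (setup P) <| seq powers <| seq (tables P) <|
  seq (collectLoop 6 body (const 0) (reg 4)) <|
  seq (fillLoop 7 (mul (reg 6) (reg 5)) (const 0) (add (mod (reg 7) (reg 5)) (const 1))) <|
  seq (putLoop P) <|
  seq (fillLoop 1 slotPos (const 0) (bitOf 8 fldBits)) <|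
  seq (fillLoop 1 (mul (mul (reg 6) (reg 5)) (reg 4)) slotPos (bitOf 7 (reg 4))) <|
  seq (fillLoop 1 (mul (reg 6) (reg 2)) headPos (bitOf 9 (reg 2))) <|
  seq (fillLoop 1 (sub (reg 0) body) tailPos (get 0 (add body (reg 7)))) <|
  assign 1 (add tailPos (sub (reg 0) body))

/-- The block with index register 7, from the fields in array 8 and the slots in array 7. -/
def blockOf : Expr :=
  add (mul (sub (const 1) (mod (get 8 (reg 7)) (const 2))) (get 5 (div (get 8 (reg 7)) (const 2))))
    (mul (mul (mod (get 8 (reg 7)) (const 2))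
      (sub (const 1) (sub (add (div (get 8 (reg 7)) (const 2)) (const 1)) (reg 5))))
      (get 7 (add (mul (div (reg 7) (reg 3)) (reg 5)) (div (get 8 (reg 7)) (const 2)))))

/-- The decoding program for long words. -/
def decMain (P : Params) : Program :=
  seq (setup P) <| seq powers <| seq (tables P) <|
  seq (collectLoop 8 slotPos (const 0) fldBits) <|
  seq (collectLoop 7 (mul (mul (reg 6) (reg 5)) (reg 4)) slotPos (reg 4)) <|
  seq (fillLoop 6 (mul (reg 6) (reg 3)) (const 0) blockOf) <|
  seq (fillLoop 1 body (const 0) (bitOf 6 (reg 4))) <|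
  seq (fillLoop 1 (sub (reg 0) body) body (get 0 (add tailPos (reg 7)))) <|
  assign 1 (reg 0)

/-- The encoding program. -/
def encProgram (P : Params) : Program :=
  ite (sub (const P.n₀) (reg 0)) (assign 1 (const 0)) (encMain P)

/-- The decoding program. -/
def decProgram (P : Params) : Program :=
  ite (sub (const P.n₀) (reg 0)) (assign 1 (reg 0)) (decMain P)

end Program

/-! ### Correctness and time of the preparatory programs -/

open Layout Program

/-- The numbers `L` and `J` bound the bit lengths and the numbers of iterations. -/
structure Layout.Bounds (Λ : Layout) (m L J : ℕ) : Prop where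
  small : Λ.Small m L
  bits : Λ.blk + Λ.lam + 2 ≤ L
  len : Λ.len < 2 ^ L
  cap_le : Λ.cap ≤ Λ.num
  body_le : Λ.body ≤ Λ.n
  iter : Λ.n + Λ.len + 2 ^ Λ.blk + Λ.lam + 2 ≤ J

/-- An array of zeros. -/
def zeros : ℕ → ℕ := fun _ => 0

theorem size_le_self (n : ℕ) : Nat.size n ≤ n := Nat.size_le.2 Nat.lt_two_pow_self

theorem div_two_pow_succ (n k : ℕ) : n / 2 ^ k / 2 = n / 2 ^ (k + 1) := by
  rw [Nat.div_div_eq_div_mul, pow_succ]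

theorem div_two_pow_ne_zero {n k : ℕ} (h : k < Nat.size n) : n / 2 ^ k ≠ 0 := by
  rw [Nat.lt_size] at h
  exact (Nat.div_pos h (by positivity)).ne'

theorem div_two_pow_size (n : ℕ) : n / 2 ^ Nat.size n = 0 :=
  Nat.div_eq_of_lt (Nat.lt_size_self n)

section

variable {P : Params} {n m L J : ℕ}

/-- The number of halvings that lead to zero is the bit length. The first loop so leaves `Nat.size
n` in register 8, and the second one, run on that, finds `lam` together with the power `num`. -/
theorem runs_setup (H : (P.layout n).Bounds m L J) {a : List (ℕ → ℕ)}
    (ha : ∀ f ∈ a, ∀ i, f i < 2 ^ L) :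
    (setup P).Runs L J (listMem [n, m, 0, 0, 0, 0, 0, 0, 0] a) ((P.layout n).mem m 0 0 a) := by
  have hL := H.small.one_le
  have h1 : n < 2 ^ L := H.small.n
  have h2 := H.small.m
  have h3 := H.small.lam
  have h4 := H.small.num
  have h5 := H.small.blk
  have h6 := H.small.cap
  have hJ := H.iter
  have h0 : 0 < 2 ^ L := by positivity
  have h01 : 1 < 2 ^ L := Nat.one_lt_two_pow (by omega)
  have h2b : 0 < 2 ^ (P.layout n).blk := by positivity
  have hs := size_le_self n
  have hss := size_le_self (Nat.size n)
  have hn : (P.layout n).n = n := rfl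
  have hbdd : ∀ r : List ℕ, (∀ v ∈ r, v < 2 ^ L) → (listMem r a).Bdd L := fun r hr =>
    listMem_bdd hr ha
  rw [hn] at hJ
  have hsem : ∀ (r : List ℕ) (x : ℕ) (e : Expr), x < r.length →
      (assign x e).sem (listMem r a) = listMem (r.set x (e.eval (listMem r a))) a :=
    fun r x e hx => listMem_setReg hx _
  refine Runs.seq (s' := listMem [n, m, 0, 0, 0, 0, 0, n, 0] a)
    (Straight.runs (P := assign 7 _) hL (by omega) trivial (hbdd _ (by simp [*])) (hsem _ _ _ (by simp))) ?_
  refine Runs.seq (s' := listMem [n, m, 0, 0, 0, 0, 0, 0, Nat.size n] a) ?_ ?_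
  · have key := Straight.runs_loop (N := Nat.size n) (e := Expr.reg 7)
      (P := seq (assign 7 (Expr.div (Expr.reg 7) (Expr.const 2)))
        (assign 8 (Expr.add (Expr.reg 8) (Expr.const 1)))) hL ⟨trivial, trivial⟩
      (fun k => listMem [n, m, 0, 0, 0, 0, 0, n / 2 ^ k, k] a) (fun k hk => hbdd _ ?_)
      (fun k hk => div_two_pow_ne_zero hk) (div_two_pow_size n) (fun k hk => ?_)
    · simp only [div_two_pow_size, pow_zero, Nat.div_one] at key
      exact key.mono (by omega)
    · have := Nat.div_le_self n (2 ^ k)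
      simp [h1, h2]
      exact ⟨by omega, by omega⟩
    · rw [sem, hsem _ _ _ (by simp)]
      refine (hsem _ _ _ (by simp)).trans ?_
      rw [← div_two_pow_succ]
      rfl
  refine Runs.seq (s' := listMem [n, m, 0, 1, 0, 0, 0, 0, Nat.size n] a)
    (Straight.runs (P := assign 3 _) hL (by omega) trivial (hbdd _ ?_) (hsem _ _ _ (by simp))) ?_
  · simp [h1, h2]; omega
  refine Runs.seq (s' := listMem [n, m, (P.layout n).lam, (P.layout n).num, 0, 0, 0, 0, 0] a) ?_ ?_
  · have key := Straight.runs_loop (N := (P.layout n).lam) (e := Expr.reg 8)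
      (P := seq (assign 8 (Expr.div (Expr.reg 8) (Expr.const 2)))
        (seq (assign 2 (Expr.add (Expr.reg 2) (Expr.const 1)))
          (assign 3 (Expr.mul (Expr.reg 3) (Expr.const 2))))) hL ⟨trivial, trivial, trivial⟩
      (fun k => listMem [n, m, k, 2 ^ k, 0, 0, 0, 0, Nat.size n / 2 ^ k] a) (fun k hk => hbdd _ ?_)
      (fun k hk => div_two_pow_ne_zero hk) (div_two_pow_size _) (fun k hk => ?_)
    · have h7 : Nat.size n / 2 ^ (P.layout n).lam = 0 := div_two_pow_size _
      simp only [h7, pow_zero, Nat.div_one] at key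
      exact key.mono (by omega)
    · have h7 := Nat.div_le_self (Nat.size n) (2 ^ k)
      have h8 : 2 ^ k ≤ (P.layout n).num := Nat.pow_le_pow_right two_pos hk
      simp [h1, h2]
      exact ⟨by omega, by omega, by omega⟩
    · rw [sem, hsem _ _ _ (by simp), sem, hsem _ _ _ (by simp)]
      refine (hsem _ _ _ (by simp)).trans ?_
      rw [← div_two_pow_succ, pow_succ]
      rfl
  refine Runs.seq
    (s' := listMem [n, m, (P.layout n).lam, (P.layout n).num, (P.layout n).blk, 0, 0, 0, 0] a)
    (Straight.runs (P := assign 4 _) hL (by omega) trivial (hbdd _ (by simp [*]))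
      (hsem _ _ _ (by simp))) ?_
  refine Runs.seq (s' := listMem [n, m, (P.layout n).lam, (P.layout n).num, (P.layout n).blk,
      (P.layout n).cap, 0, 0, 0] a)
    (Straight.runs (P := assign 5 _) hL (by omega) trivial (hbdd _ (by simp [*]))
      (hsem _ _ _ (by simp))) ?_
  exact Straight.runs (P := assign 6 _) hL (by omega) trivial (hbdd _ (by simp [*]))
    (hsem _ _ _ (by simp))

end

section

variable {Λ : Layout} {m L J : ℕ}

/-- The table of the powers of two. -/
def powTab (z i : ℕ) : ℕ := if i < z then 2 ^ i else 0

theorem powTab_lt {z : ℕ} (hz : z ≤ L) (i : ℕ) : powTab z i < 2 ^ L := by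
  rw [powTab]
  split_ifs with h
  · exact Nat.pow_lt_pow_right (by norm_num) (by omega)
  · positivity

theorem forall_mem_ten {p : (ℕ → ℕ) → Prop} {a b c d e f g h i j : ℕ → ℕ} (ha : p a) (hb : p b)
    (hc : p c) (hd : p d) (he : p e) (hf : p f) (hg : p g) (hh : p h) (hi : p i) (hj : p j) :
    ∀ t ∈ [a, b, c, d, e, f, g, h, i, j], p t := by
  simp [*]

theorem zeros_lt (i : ℕ) : zeros i < 2 ^ L := by rw [zeros]; positivity

theorem runs_powers (H : Λ.Bounds m L J) {c : ℕ → ℕ} (hc : ∀ i, c i < 2 ^ L) :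
    powers.Runs L J (Λ.mem m 0 0 [c, zeros, zeros, zeros, zeros, zeros, zeros, zeros, zeros, zeros])
      (Λ.mem m (Λ.blk + Λ.lam + 1) (2 ^ (Λ.blk + Λ.lam + 1)) [c, zeros,
        powTab (Λ.blk + Λ.lam + 1), zeros, zeros, zeros, zeros, zeros, zeros, zeros]) := by
  have hL := H.small.one_le
  have hJ := H.iter
  have hb := H.bits
  have h0 : 0 < 2 ^ L := by positivity
  have h1 : Λ.blk < 2 ^ Λ.blk := Nat.lt_two_pow_self
  have h2 : Λ.blk + Λ.lam + 1 < 2 ^ L := by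
    have : L < 2 ^ L := Nat.lt_two_pow_self
    omega
  refine Runs.seq (s' := Λ.mem m 0 1 [c, zeros, zeros, zeros, zeros, zeros, zeros, zeros, zeros, zeros])
    (Straight.runs (P := assign 8 _) hL (by omega) trivial
      (H.small.mem_bdd h0 h0 ?_) (mem_setReg8 _ _ _ _)) ?_
  · exact forall_mem_ten hc zeros_lt zeros_lt zeros_lt zeros_lt zeros_lt zeros_lt zeros_lt zeros_lt zeros_lt
  have key := runs_forLoop H.small (lim := Expr.add (Expr.add (Expr.reg 4) (Expr.reg 2))
    (Expr.const 1)) (P := seq (store 2 (Expr.reg 7) (Expr.reg 8)) (assign 8 (Expr.mul (Expr.reg 8)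
    (Expr.const 2)))) ⟨trivial, trivial⟩ h2 h0 (fun z => 2 ^ z) (fun z => [c, zeros,
        powTab z, zeros, zeros, zeros, zeros, zeros, zeros, zeros])
        (fun z hz => Nat.pow_lt_pow_right (by norm_num) (by omega))
        (fun z hz => forall_mem_ten hc zeros_lt (powTab_lt (by omega)) zeros_lt zeros_lt zeros_lt
          zeros_lt zeros_lt zeros_lt zeros_lt) (fun z hz => rfl) (fun z hz => ?_)
  · have h3 : powTab 0 = zeros := by funext i; simp [powTab, zeros]
    simp only [h3, pow_zero] at key
    exact key.mono (by omega)
  · rw [sem, sem, sem, mem_setArr (by simp), mem_setReg8]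
    have h3 : Function.update (powTab z) z (2 ^ z) = powTab (z + 1) := by
      funext i
      rw [Function.update_apply, powTab, powTab]
      split_ifs <;> first | rfl | omega | simp [*]
    rw [← h3, pow_succ]
    rfl

/-- The layout uses the constants `P`. -/
structure Layout.Uses (Λ : Layout) (P : Params) : Prop where
  α₀ : Λ.α₀ = P.α₀
  α₁ : Λ.α₁ = P.α₁
  τ : Λ.τ = P.v * Λ.lam

/-- The summand 1 turns the comparison `≤` into positivity of a truncated difference. -/
theorem eval_cheap {P : Params} (hP : Λ.Uses P) {z k w : ℕ} {a : List (ℕ → ℕ)} {e : Expr}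
    (hw : w < 2 ^ Λ.blk) (he : e.eval (Λ.mem m z k a) = w)
    (h3 : a.getD 3 (fun _ => 0) w = pop w) :
    (cheap P e).eval (Λ.mem m z k a) = 0 ↔ ¬ Λ.Typ w := by
  have h : (cheap P e).eval (Λ.mem m z k a)
      = P.v * Λ.lam + 1 - (P.α₁ * pop w + P.α₀ * (Λ.blk - pop w)) := by
    simp only [cheap, Expr.eval, he, mem_arr, h3]
    rfl
  rw [h, Typ, hP.α₀, hP.α₁, hP.τ]
  simp only [hw, true_and]
  omega

/-- The table of the numbers of ones. -/
def popTab (z w : ℕ) : ℕ := if w < z then pop w else 0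

/-- The table of the ranks. -/
def Layout.rankTab (Λ : Layout) (z w : ℕ) : ℕ := if w < z then Λ.rank w else 0

/-- The table of the cheap blocks. -/
noncomputable def Layout.unrankTab (Λ : Layout) (z k : ℕ) : ℕ :=
  if k < Nat.count Λ.Typ z then Nat.nth Λ.Typ k else 0

theorem Layout.count_le_self (z : ℕ) : Nat.count Λ.Typ z ≤ z := by
  rw [Nat.count_eq_card_filter_range]
  exact (Finset.card_filter_le _ _).trans (by simp)

theorem popTab_lt (h : Λ.blk < 2 ^ L) {z : ℕ} (hz : z ≤ 2 ^ Λ.blk) (w : ℕ) :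
    popTab z w < 2 ^ L := by
  rw [popTab]
  split_ifs with hw
  · exact (pop_le (hw.trans_le hz)).trans_lt h
  · positivity

theorem Layout.rankTab_lt {z : ℕ} (hz : z < 2 ^ L) (w : ℕ) : Λ.rankTab z w < 2 ^ L := by
  rw [rankTab]
  split_ifs with hw
  · exact (count_le_self w).trans_lt (hw.trans hz)
  · positivity

theorem Layout.unrankTab_lt {z : ℕ} (hz : z < 2 ^ L) (w : ℕ) : Λ.unrankTab z w < 2 ^ L := by
  rw [unrankTab]
  split_ifs with hw
  · exact (Nat.nth_lt_of_lt_count hw).trans hz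
  · positivity

/-- Register 8 counts the cheap blocks found so far. This count is the rank of the present word and
also the place in array 5 where it is listed if it is cheap. The numbers of ones come from `pop_eq`.
-/
theorem runs_tables {P : Params} (hP : Λ.Uses P) (H : Λ.Bounds m L J) {c : ℕ → ℕ}
    (hc : ∀ i, c i < 2 ^ L) :
    (tables P).Runs L J (Λ.mem m (Λ.blk + Λ.lam + 1) (2 ^ (Λ.blk + Λ.lam + 1)) [c, zeros,
        powTab (Λ.blk + Λ.lam + 1), zeros, zeros, zeros, zeros, zeros, zeros, zeros])
      (Λ.mem m (2 ^ Λ.blk) (Nat.count Λ.Typ (2 ^ Λ.blk)) [c, zeros,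
        powTab (Λ.blk + Λ.lam + 1), popTab (2 ^ Λ.blk), Λ.rankTab (2 ^ Λ.blk), Λ.unrank,
        zeros, zeros, zeros, zeros]) := by
  have hL := H.small.one_le
  have hJ := H.iter
  have hb := H.bits
  have h0 : 0 < 2 ^ L := by positivity
  have h2 : Λ.blk + Λ.lam + 1 < 2 ^ L := by
    have : L < 2 ^ L := Nat.lt_two_pow_self
    omega
  have h2b : 0 < 2 ^ Λ.blk := by positivity
  have h3 : 2 ^ Λ.blk < 2 ^ L := Nat.pow_lt_pow_right (by norm_num) (by omega)
  have hpow := powTab_lt (z := Λ.blk + Λ.lam + 1) (L := L) (by omega)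
  refine Runs.seq (s' := Λ.mem m (Λ.blk + Λ.lam + 1) 0 [c, zeros,
        powTab (Λ.blk + Λ.lam + 1), zeros, zeros, zeros, zeros, zeros, zeros, zeros])
    (Straight.runs (P := assign 8 _) hL (by omega) trivial
      (H.small.mem_bdd h2 (Nat.pow_lt_pow_right (by norm_num) (by omega)) ?_)
        (mem_setReg8 _ _ _ _)) ?_
  · exact forall_mem_ten hc zeros_lt hpow zeros_lt zeros_lt zeros_lt zeros_lt zeros_lt
      zeros_lt zeros_lt
  have key := runs_forLoop H.small (lim := Expr.get 2 (Expr.reg 4)) (P :=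
    seq (store 3 (Expr.reg 7) (Expr.add (Expr.get 3 (Expr.div (Expr.reg 7) (Expr.const 2)))
      (Expr.mod (Expr.reg 7) (Expr.const 2)))) <|
    seq (store 4 (Expr.reg 7) (Expr.reg 8)) <|
    ite (cheap P (Expr.reg 7)) (seq (store 5 (Expr.reg 8) (Expr.reg 7))
      (assign 8 (Expr.add (Expr.reg 8) (Expr.const 1)))) skip)
    ⟨trivial, trivial, ⟨trivial, trivial⟩, trivial⟩ h3 h2 (Nat.count Λ.Typ) (fun z => [c, zeros,
        powTab (Λ.blk + Λ.lam + 1), popTab z, Λ.rankTab z, Λ.unrankTab z,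
        zeros, zeros, zeros, zeros])
        (fun z hz => (count_le_self z).trans_lt (by omega))
        (fun z hz => forall_mem_ten hc zeros_lt hpow (popTab_lt H.small.blk hz)
          (Λ.rankTab_lt (by omega)) (Λ.unrankTab_lt (by omega))
          zeros_lt zeros_lt zeros_lt zeros_lt) (fun z hz => ?_) (fun z hz => ?_)
  · have h4 : popTab 0 = zeros := by funext i; simp [popTab, zeros]
    have h5 : Λ.rankTab 0 = zeros := by funext i; simp [rankTab, zeros]
    have h6 : Λ.unrankTab 0 = zeros := by funext i; simp [unrankTab, zeros]
    have h7 : Λ.unrankTab (2 ^ Λ.blk) = Λ.unrank := rfl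
    rw [h4, h5, h6, h7, Nat.count_zero] at key
    exact key.mono (by omega)
  · change powTab (Λ.blk + Λ.lam + 1) Λ.blk = _
    rw [powTab, if_pos (by omega)]
  · have h4 : Function.update (popTab z) z (popTab z (z / 2) + z % 2) = popTab (z + 1) := by
      funext i
      rw [Function.update_apply, popTab, popTab, popTab]
      by_cases hi : i = z
      · subst hi
        rw [if_pos rfl, if_pos (Nat.lt_succ_self _), pop_eq i]
        rcases Nat.eq_zero_or_pos i with rfl | h
        · simp [pop_zero]
        · rw [if_pos (by omega)]
      · rw [if_neg hi]
        exact if_congr (by omega) rfl rfl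
    have h5 : Function.update (Λ.rankTab z) z (Nat.count Λ.Typ z) = Λ.rankTab (z + 1) := by
      funext i
      rw [Function.update_apply, rankTab, rankTab]
      by_cases hi : i = z
      · subst hi
        rw [if_pos rfl, if_pos (Nat.lt_succ_self _)]; rfl
      · rw [if_neg hi]
        exact if_congr (by omega) rfl rfl
    rw [sem, sem, mem_setArr (by simp), sem, sem, mem_setArr (by simp)]
    change (ite (cheap P (Expr.reg 7)) (seq (store 5 (Expr.reg 8) (Expr.reg 7))
      (assign 8 (Expr.add (Expr.reg 8) (Expr.const 1)))) skip).sem (Λ.mem m z (Nat.count Λ.Typ z)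
      [c, zeros, powTab (Λ.blk + Λ.lam + 1),
        Function.update (popTab z) z (popTab z (z / 2) + z % 2),
        Function.update (Λ.rankTab z) z (Nat.count Λ.Typ z), Λ.unrankTab z,
        zeros, zeros, zeros, zeros]) = _
    rw [h4, h5]
    have hcheap := eval_cheap (m := m) hP (z := z) (k := Nat.count Λ.Typ z)
      (e := Expr.reg 7) (a := [c, zeros, powTab (Λ.blk + Λ.lam + 1),
        popTab (z + 1), Λ.rankTab (z + 1), Λ.unrankTab z, zeros, zeros, zeros, zeros]) hz rfl
        (show popTab (z + 1) z = pop z by simp [popTab])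
    rw [sem]
    by_cases ht : Λ.Typ z
    · rw [if_neg (by rw [hcheap]; simpa using ht), sem, sem, sem, mem_setArr (by simp), mem_setReg8]
      have h6 : Function.update (Λ.unrankTab z) (Nat.count Λ.Typ z) z = Λ.unrankTab (z + 1) := by
        funext i
        rw [Function.update_apply, unrankTab, unrankTab, Nat.count_succ, if_pos ht]
        by_cases hi : i = Nat.count Λ.Typ z
        · subst hi
          rw [if_pos rfl, if_pos (by omega), Nat.nth_count ht]
        · rw [if_neg hi]
          exact if_congr (by omega) rfl rfl
      rw [← h6, Nat.count_succ, if_pos ht]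
      rfl
    · rw [if_pos (by rw [hcheap]; exact ht), sem]
      have h6 : Λ.unrankTab (z + 1) = Λ.unrankTab z := by
        funext i
        rw [unrankTab, unrankTab, Nat.count_succ, if_neg ht, add_zero]
      rw [h6, Nat.count_succ, if_neg ht, add_zero]

end

end LocalCompression

namespace LocalCompression
open Layout Program

variable {Λ : Layout} {m L J : ℕ}

/-! ### Correctness and time of the encoding and decoding programs -/

namespace Layout

theorem Bounds.slotPos_le (_ : Λ.Bounds m L J) : Λ.slotPos ≤ Λ.len :=
  (Λ.slotPos_le.trans Λ.headPos_le).trans Λ.tailPos_le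

theorem Bounds.blocks_le (H : Λ.Bounds m L J) : Λ.blocks ≤ Λ.len :=
  (Nat.le_mul_of_pos_right _ (Nat.succ_pos _)).trans H.slotPos_le

theorem Bounds.slots_le (H : Λ.Bounds m L J) : Λ.grp * Λ.cap ≤ Λ.len :=
  (Nat.mul_le_mul_left _ H.cap_le).trans H.blocks_le

theorem Bounds.slotBits_le (_ : Λ.Bounds m L J) : Λ.grp * Λ.cap * Λ.blk ≤ Λ.len := by
  have := Λ.headPos_le
  have := Λ.tailPos_le
  rw [headPos] at *
  omega

theorem Bounds.headBits_le (_ : Λ.Bounds m L J) : Λ.grp * Λ.lam ≤ Λ.len := by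
  have := Λ.tailPos_le
  rw [tailPos] at *
  omega

theorem Bounds.two_pow_blk_lt (H : Λ.Bounds m L J) : 2 ^ Λ.blk * 2 < 2 ^ L := by
  have := H.bits
  rw [← pow_succ]
  exact Nat.pow_lt_pow_right (by norm_num) (by omega)

theorem Bounds.num_lt (H : Λ.Bounds m L J) : Λ.num * 2 < 2 ^ L := by
  have := H.bits
  rw [num, ← pow_succ]
  exact Nat.pow_lt_pow_right (by norm_num) (by omega)

/-- The numbers in the store have at most `L` bits. -/
structure StoreBdd (L : ℕ) (st : Store) : Prop where
  fld : ∀ q, st.fld q < 2 ^ L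
  slot : ∀ z, st.slot z < 2 ^ L
  head : ∀ g, st.head g < 2 ^ L

theorem update_lt {f : ℕ → ℕ} {N : ℕ} (hf : ∀ i, f i < N) {x v : ℕ} (hv : v < N) (i : ℕ) :
    Function.update f x v i < N := by
  rw [Function.update_apply]
  split_ifs
  · exact hv
  · exact hf i

theorem StoreBdd.put (H : Λ.Bounds m L J) {st : Store} (hst : StoreBdd L st) {q w : ℕ}
    (hw : w < 2 ^ Λ.blk) : StoreBdd L (Λ.put st q w) := by
  have h1 := H.two_pow_blk_lt
  have h2 := H.num_lt
  have h3 := H.cap_le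
  rw [Layout.put]
  split_ifs with ht hc
  · have : Λ.rank w ≤ w := count_le_self w
    exact ⟨update_lt hst.fld (by omega), hst.slot, hst.head⟩
  · exact ⟨update_lt hst.fld (by omega), update_lt hst.slot (by omega),
      update_lt hst.head (hst.slot _)⟩
  · exact hst

/-- The bound covers all indices and does not use `Valid`, since the programs are analysed for
arbitrary constants. -/
theorem storeBdd_fill (H : Λ.Bounds m L J) {B : ℕ → ℕ} (hB : ∀ q, B q < 2 ^ Λ.blk) (k : ℕ) :
    StoreBdd L (Λ.fill B k) := by
  induction k with
  | zero =>
    refine ⟨fun _ => by positivity, fun z => ?_, fun _ => by positivity⟩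
    simp only [fill, empty]
    split_ifs with h
    · have h0 : 0 < Λ.cap := Nat.pos_of_ne_zero (by rintro h'; simp [h'] at h)
      have := Nat.mod_lt z h0
      have := H.small.cap
      omega
    · positivity
  | succ k ih => exact ih.put H (hB k)

end Layout

/-- The blocks of the source word. -/
def Layout.blockTab (Λ : Layout) (x : ℕ → Bool) (q : ℕ) : ℕ :=
  if q < Λ.blocks then Λ.srcBlock x q else 0

/-- The arrays that hold the tables. -/
noncomputable def Layout.withTables (Λ : Layout) (c o b s f h : ℕ → ℕ) : List (ℕ → ℕ) :=
  [c, o, powTab (Λ.blk + Λ.lam + 1), popTab (2 ^ Λ.blk), Λ.rankTab (2 ^ Λ.blk), Λ.unrank, b, s, f, h]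

theorem Layout.Bounds.withTables (H : Λ.Bounds m L J) {c o b s f h : ℕ → ℕ}
    (hc : ∀ i, c i < 2 ^ L) (ho : ∀ i, o i < 2 ^ L) (hb : ∀ i, b i < 2 ^ L)
    (hs : ∀ i, s i < 2 ^ L) (hf : ∀ i, f i < 2 ^ L) (hh : ∀ i, h i < 2 ^ L) :
    ∀ t ∈ Λ.withTables c o b s f h, ∀ i, t i < 2 ^ L := by
  have h1 := H.two_pow_blk_lt
  have h2 := H.bits
  exact forall_mem_ten hc ho (powTab_lt (by omega)) (popTab_lt H.small.blk le_rfl)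
    (Λ.rankTab_lt (by omega)) (fun k => (unrank_lt k).trans (by omega)) hb hs hf hh

theorem runs_putLoop {P : Params} (hP : Λ.Uses P) (H : Λ.Bounds m L J) {c : ℕ → ℕ}
    (hc : ∀ i, c i < 2 ^ L) (x : ℕ → Bool) {z₀ k : ℕ} (hz₀ : z₀ < 2 ^ L) (hk : k < 2 ^ L) :
    (putLoop P).Runs L J
      (Λ.mem m z₀ k (Λ.withTables c zeros (Λ.blockTab x) Λ.empty.slot zeros zeros))
      (Λ.mem m Λ.blocks k (Λ.withTables c zeros (Λ.blockTab x)
        (Λ.fill (Λ.srcBlock x) Λ.blocks).slot (Λ.fill (Λ.srcBlock x) Λ.blocks).fld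
        (Λ.fill (Λ.srcBlock x) Λ.blocks).head)) := by
  have hJ := H.iter
  have h1 := H.two_pow_blk_lt
  have hbl := H.blocks_le
  have hlen := H.len
  have hB : ∀ q, Λ.srcBlock x q < 2 ^ Λ.blk := fun q => val_lt _ _ _
  have hB' : ∀ q, Λ.blockTab x q < 2 ^ L := fun q => by
    rw [blockTab]; split_ifs
    · have := hB q; omega
    · positivity
  have hfill := storeBdd_fill H hB
  have key := runs_forLoop H.small (lim := Expr.mul (Expr.reg 6) (Expr.reg 3)) (P :=
    ite (cheap P (.get 6 (.reg 7))) (store 8 (.reg 7) (.mul (.const 2) (.get 4 (.get 6 (.reg 7))))) <|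
    ite (.sub (.reg 5) (.get 9 (.div (.reg 7) (.reg 3))))
      (seq (store 8 (.reg 7) (.add (.mul (.const 2) (.get 9 (.div (.reg 7) (.reg 3)))) (.const 1))) <|
      seq (store 9 (.div (.reg 7) (.reg 3)) (.get 7 (.add (.mul (.div (.reg 7) (.reg 3)) (.reg 5))
        (.get 9 (.div (.reg 7) (.reg 3)))))) <|
      store 7 (.add (.mul (.div (.reg 7) (.reg 3)) (.reg 5)) (.div (.get 8 (.reg 7)) (.const 2)))
        (.get 6 (.reg 7)))
      skip) ⟨trivial, ⟨trivial, trivial, trivial⟩, trivial⟩ (N := Λ.blocks) (by omega) hz₀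
      (fun _ => k)
      (fun z => Λ.withTables c zeros (Λ.blockTab x) (Λ.fill (Λ.srcBlock x) z).slot
        (Λ.fill (Λ.srcBlock x) z).fld (Λ.fill (Λ.srcBlock x) z).head) (fun _ _ => hk)
      (fun z _ => H.withTables hc zeros_lt hB' (hfill z).slot (hfill z).fld (hfill z).head)
      (fun _ _ => rfl) (fun z hz => ?_)
  · exact key.mono (by omega)
  · have hw := hB z
    have hbt : Λ.blockTab x z = Λ.srcBlock x z := if_pos hz
    set st := Λ.fill (Λ.srcBlock x) z with hst
    have hcheap := eval_cheap (m := m) hP (z := z) (k := k) (w := Λ.srcBlock x z)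
      (e := .get 6 (.reg 7)) (a := Λ.withTables c zeros (Λ.blockTab x) st.slot st.fld st.head) hw
      hbt (if_pos hw)
    rw [fill, ← hst, put, sem]
    by_cases ht : Λ.Typ (Λ.srcBlock x z)
    · rw [if_neg (by rw [hcheap]; simpa using ht), if_pos ht, sem,
        mem_setArr (by simp [withTables])]
      have h2 : Λ.rankTab (2 ^ Λ.blk) (Λ.blockTab x z) = Λ.rank (Λ.srcBlock x z) := by
        rw [hbt]; exact if_pos hw
      change Λ.mem m z k (Λ.withTables c zeros (Λ.blockTab x) st.slot (Function.update st.fld z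
        (2 * Λ.rankTab (2 ^ Λ.blk) (Λ.blockTab x z))) st.head) = _
      rw [h2]
    · rw [if_pos (by rw [hcheap]; exact ht), if_neg ht, sem]
      change (if Λ.cap - st.head (z / Λ.num) = 0 then _ else _) = _
      by_cases h2 : st.head (z / Λ.num) < Λ.cap
      · rw [if_neg (by omega), if_pos h2, sem, sem, sem, sem, sem, mem_setArr (by simp [withTables]),
          mem_setArr (by simp [withTables]), mem_setArr (by simp [withTables])]
        -- When the slot is written, the head in array 9 has already been replaced; the program
        -- recovers the slot number from the new field.
        have h3 : (2 * st.head (z / Λ.num) + 1) / 2 = st.head (z / Λ.num) := by omega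
        change Λ.mem m z k (Λ.withTables c zeros (Λ.blockTab x) (Function.update st.slot
          (z / Λ.num * Λ.cap +
            Function.update st.fld z (2 * st.head (z / Λ.num) + 1) z / 2) (Λ.blockTab x z))
          (Function.update st.fld z (2 * st.head (z / Λ.num) + 1))
          (Function.update st.head (z / Λ.num)
            (st.slot (z / Λ.num * Λ.cap + st.head (z / Λ.num))))) = _
        rw [Function.update_self, h3, hbt]
      · rw [if_pos (by omega), if_neg h2, sem]

theorem eval_bitOf {x k z ω : ℕ} {w : Expr} {a : List (ℕ → ℕ)} (hω : 0 < ω)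
    (hω' : ω ≤ Λ.blk + Λ.lam + 1) (hw : w.eval (Λ.mem m z k a) = ω)
    (h2 : a.getD 2 (fun _ => 0) = powTab (Λ.blk + Λ.lam + 1)) :
    (bitOf x w).eval (Λ.mem m z k a)
      = ((a.getD x (fun _ => 0) (z / ω)).testBit (z % ω)).toNat := by
  have h := Nat.mod_lt z hω
  simp only [bitOf, Expr.eval, hw, mem_arr, h2]
  rw [Nat.toNat_testBit]
  change _ / powTab (Λ.blk + Λ.lam + 1) (z % ω) % 2 = _
  rw [powTab, if_pos (by omega)]
  rfl

theorem toNat_lt (hL : 1 ≤ L) (b : Bool) : b.toNat < 2 ^ L := by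
  have h1 : 1 < 2 ^ L := Nat.one_lt_two_pow (by omega)
  have := Bool.toNat_le b
  omega

theorem ite_lt {p : ℕ → Prop} [DecidablePred p] {f g : ℕ → ℕ} {N : ℕ} (hf : ∀ i, f i < N)
    (hg : ∀ i, g i < N) (i : ℕ) : (if p i then f i else g i) < N := by
  split_ifs
  · exact hf i
  · exact hg i

theorem runs_encMain {P : Params} {n : ℕ} {m L J : ℕ} (H : (P.layout n).Bounds m L J)
    (x : ℕ → Bool) :
    ∃ s, (encMain P).Runs L J (listMem [n, m, 0, 0, 0, 0, 0, 0, 0]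
        [fun j => (x j).toNat, zeros, zeros, zeros, zeros, zeros, zeros, zeros, zeros, zeros]) s ∧
      s.reg 1 = (P.layout n).len ∧ ∀ j < (P.layout n).len, s.arr 1 j = ((P.layout n).spell
        ((P.layout n).fill ((P.layout n).srcBlock x) (P.layout n).blocks) x j).toNat := by
  have hP : (P.layout n).Uses P := ⟨rfl, rfl, rfl⟩
  set Λ := P.layout n with hΛ
  have hL := H.small.one_le
  have hJ := H.iter
  have hlen := H.len
  have hc : ∀ i, (x i).toNat < 2 ^ L := fun i => toNat_lt hL _
  have hbl := H.blocks_le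
  have hsl := H.slots_le
  have hsb := H.slotBits_le
  have hhb := H.headBits_le
  have hsp := H.slotPos_le
  have hbits := H.bits
  have hbody := H.body_le
  have hn := H.small.n
  have hp := H.two_pow_blk_lt
  have h2b : 0 < 2 ^ Λ.blk := by positivity
  have hcnt := Λ.count_le_self (2 ^ Λ.blk)
  have hB : ∀ q, Λ.srcBlock x q < 2 ^ Λ.blk := fun q => val_lt _ _ _
  have hB' : ∀ q, Λ.blockTab x q < 2 ^ L := fun q => by
    rw [blockTab]; split_ifs
    · have := hB q; omega
    · positivity
  have hfill := storeBdd_fill H hB Λ.blocks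
  set k := Nat.count Λ.Typ (2 ^ Λ.blk) with hk
  have hkL : k < 2 ^ L := by omega
  set st := Λ.fill (Λ.srcBlock x) Λ.blocks with hst
  have r4 : (collectLoop 6 Program.body (.const 0) (.reg 4)).Runs L J
      (Λ.mem m (2 ^ Λ.blk) k (Λ.withTables (fun j => (x j).toNat) zeros zeros zeros zeros zeros))
      (Λ.mem m Λ.body k
        (Λ.withTables (fun j => (x j).toNat) zeros (Λ.blockTab x) zeros zeros zeros)) := by
    have key := runs_collectLoop H.small (x := 6) (lim := Program.body) (off := .const 0)
      (w := .reg 4) (a := Λ.withTables (fun j => (x j).toNat) zeros zeros zeros zeros zeros)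
      (by simp [withTables]) (by norm_num) (by norm_num) (T := Λ.blocks) (ω := Λ.blk)
      (z₀ := 2 ^ Λ.blk) (k := k) (O := 0) (c := x) (hbody.trans_lt hn) (by omega) (by omega) hkL
      (H.withTables hc zeros_lt zeros_lt zeros_lt zeros_lt zeros_lt) rfl
      (fun i hi => if_pos (by omega)) rfl (fun _ _ => rfl) (fun _ _ => rfl) (fun _ _ => rfl)
    have h5 : (fun q => if q < Λ.blocks then val x (0 + q * Λ.blk) Λ.blk else 0)
        = Λ.blockTab x := by
      funext q; rw [zero_add]; rfl
    rw [h5] at key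
    exact key.mono (by rw [Layout.body] at hbody; omega)
  have r5 : (fillLoop 7 (.mul (.reg 6) (.reg 5)) (.const 0) (.add (.mod (.reg 7) (.reg 5))
      (.const 1))).Runs L J (Λ.mem m Λ.body k
        (Λ.withTables (fun j => (x j).toNat) zeros (Λ.blockTab x) zeros zeros zeros))
      (Λ.mem m (Λ.grp * Λ.cap) k (Λ.withTables (fun j => (x j).toNat) zeros (Λ.blockTab x)
        Λ.empty.slot zeros zeros)) := by
    have key := runs_fillLoop H.small (x := 7) (lim := .mul (.reg 6) (.reg 5)) (off := .const 0)
      (e := .add (.mod (.reg 7) (.reg 5)) (.const 1)) (a := Λ.withTables (fun j => (x j).toNat)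
        zeros (Λ.blockTab x) zeros zeros zeros) (by simp [withTables]) (N := Λ.grp * Λ.cap)
      (z₀ := Λ.body) (k := k) (O := 0) (f := fun z => z % Λ.cap + 1) (by omega) (by omega) hkL
      (H.withTables hc zeros_lt hB' zeros_lt zeros_lt zeros_lt) (fun z hz => ?_)
      (fun _ _ => rfl) (fun _ _ => rfl) (fun _ _ _ => rfl)
    · have h5 : (fun j => if 0 ≤ j ∧ j < 0 + Λ.grp * Λ.cap then (fun z => z % Λ.cap + 1) (j - 0)
          else (Λ.withTables (fun j => (x j).toNat) zeros (Λ.blockTab x) zeros zeros zeros).getD 7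
            (fun _ => 0) j) = Λ.empty.slot := by
        funext j; simp [Layout.empty, withTables, zeros]
      rw [h5] at key
      exact key.mono (by omega)
    · have h0 : 0 < Λ.cap := Nat.pos_of_ne_zero (by rintro h'; simp [h'] at hz)
      have := Nat.mod_lt z h0
      have := H.small.cap
      omega
  have r6 := runs_putLoop hP H hc x (z₀ := Λ.grp * Λ.cap) (by omega) hkL
  -- The output is written in four stretches, each loop taking the earlier stretches as the old
  -- content `o` of array 1.
  have out : ∀ {lim off e : Expr} {N z₀ O : ℕ} {o f : ℕ → ℕ}, N ≤ Λ.len + Λ.n → N < 2 ^ L →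
      z₀ < 2 ^ L → (∀ i, o i < 2 ^ L) → (∀ z, f z < 2 ^ L) →
      (∀ z g, lim.eval (Λ.mem m z k (Λ.withTables (fun j => (x j).toNat) g (Λ.blockTab x)
        st.slot st.fld st.head)) = N) →
      (∀ z g, off.eval (Λ.mem m z k (Λ.withTables (fun j => (x j).toNat) g (Λ.blockTab x)
        st.slot st.fld st.head)) = O) →
      (∀ z < N, ∀ g, e.eval (Λ.mem m z k (Λ.withTables (fun j => (x j).toNat) g (Λ.blockTab x)
        st.slot st.fld st.head)) = f z) →
      (fillLoop 1 lim off e).Runs L J (Λ.mem m z₀ k (Λ.withTables (fun j => (x j).toNat) o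
        (Λ.blockTab x) st.slot st.fld st.head)) (Λ.mem m N k (Λ.withTables (fun j => (x j).toNat)
        (fun j => if O ≤ j ∧ j < O + N then f (j - O) else o j) (Λ.blockTab x)
        st.slot st.fld st.head)) := by
    intro lim off e N z₀ O o f hNJ hN hz₀ ho hf h1 h2 h3
    exact (runs_fillLoop H.small (x := 1) (a := Λ.withTables (fun j => (x j).toNat) o
        (Λ.blockTab x) st.slot st.fld st.head) (by simp [withTables]) hN hz₀ hkL
        (H.withTables hc ho hB' hfill.slot hfill.fld hfill.head) (fun z _ => hf z) h1 h2 h3).mono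
          (by omega)
  have hbit : ∀ (f : ℕ → ℕ) (ω z : ℕ), ((f (z / ω)).testBit (z % ω)).toNat < 2 ^ L :=
    fun f ω z => toNat_lt hL _
  have r7 := out (lim := Program.slotPos) (off := .const 0) (e := bitOf 8 fldBits)
    (N := Λ.slotPos) (z₀ := Λ.blocks) (O := 0) (o := zeros) (f := fun z =>
      ((st.fld (z / (Λ.lam + 1))).testBit (z % (Λ.lam + 1))).toNat) (by omega) (by omega) (by omega)
      zeros_lt (hbit st.fld _) (fun _ _ => rfl) (fun _ _ => rfl) (fun z hz g =>
        eval_bitOf (by omega) (by omega) rfl rfl)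
  have b7 := ite_lt (p := fun j => 0 ≤ j ∧ j < 0 + Λ.slotPos)
    (fun j => hbit st.fld (Λ.lam + 1) (j - 0)) (zeros_lt (L := L))
  have r8 := out (lim := .mul (.mul (.reg 6) (.reg 5)) (.reg 4)) (off := Program.slotPos)
    (e := bitOf 7 (.reg 4))
    (N := Λ.grp * Λ.cap * Λ.blk) (z₀ := Λ.slotPos) (O := Λ.slotPos) (f := fun z =>
      ((st.slot (z / Λ.blk)).testBit (z % Λ.blk)).toNat) (by omega) (by omega) (by omega)
      b7 (hbit st.slot _) (fun _ _ => rfl) (fun _ _ => rfl) (fun z hz g =>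
        eval_bitOf (Nat.pos_of_ne_zero (by rintro h; simp [h] at hz)) (by omega) rfl rfl)
  have b8 := ite_lt (p := fun j => Λ.slotPos ≤ j ∧ j < Λ.slotPos + Λ.grp * Λ.cap * Λ.blk)
    (fun j => hbit st.slot Λ.blk (j - Λ.slotPos)) b7
  have r9 := out (lim := .mul (.reg 6) (.reg 2)) (off := Program.headPos)
    (e := bitOf 9 (.reg 2))
    (N := Λ.grp * Λ.lam) (z₀ := Λ.grp * Λ.cap * Λ.blk) (O := Λ.headPos) (f := fun z =>
      ((st.head (z / Λ.lam)).testBit (z % Λ.lam)).toNat) (by omega) (by omega) (by omega)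
      b8 (hbit st.head _) (fun _ _ => rfl) (fun _ _ => rfl) (fun z hz g =>
        eval_bitOf (Nat.pos_of_ne_zero (by rintro h; simp [h] at hz)) (by omega) rfl rfl)
  have b9 := ite_lt (p := fun j => Λ.headPos ≤ j ∧ j < Λ.headPos + Λ.grp * Λ.lam)
    (fun j => hbit st.head Λ.lam (j - Λ.headPos)) b8
  have r10 := out (lim := .sub (.reg 0) Program.body) (off := Program.tailPos)
    (e := .get 0 (.add Program.body (.reg 7)))
    (N := Λ.n - Λ.body) (z₀ := Λ.grp * Λ.lam) (O := Λ.tailPos) (f := fun z =>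
      (x (Λ.body + z)).toNat) (by omega) (by omega) (by omega)
      b9 (fun z => toNat_lt hL _) (fun _ _ => rfl) (fun _ _ => rfl) (fun z hz g => rfl)
  have b10 := ite_lt (p := fun j => Λ.tailPos ≤ j ∧ j < Λ.tailPos + (Λ.n - Λ.body))
    (fun j => toNat_lt hL (x (Λ.body + (j - Λ.tailPos)))) b9
  refine ⟨_, (runs_setup H (forall_mem_ten hc zeros_lt zeros_lt zeros_lt zeros_lt zeros_lt zeros_lt
    zeros_lt zeros_lt zeros_lt)).seq <| (runs_powers H hc).seq <| (runs_tables hP H hc).seq <|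
    r4.seq <| r5.seq <| r6.seq <| r7.seq <| r8.seq <| r9.seq <| r10.seq <|
    Straight.runs (P := assign 1 (.add Program.tailPos (.sub (.reg 0) Program.body))) hL (by omega)
      trivial (H.small.mem_bdd (by omega) hkL
        (H.withTables hc b10 hB' hfill.slot hfill.fld hfill.head)) (mem_setReg1 _ _ _ _), rfl,
    fun j hj => ?_⟩
  -- The stretch written last is the outermost test, whereas `spell` tests from the left.
  change (if _ then _ else if _ then _ else if _ then _ else if _ then _ else _) = _
  have e1 := Λ.slotPos_le
  have e2 := Λ.headPos_le
  have e3 : Λ.headPos = Λ.slotPos + Λ.grp * Λ.cap * Λ.blk := rfl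
  have e4 : Λ.tailPos = Λ.headPos + Λ.grp * Λ.lam := rfl
  have e5 : Λ.len = Λ.tailPos + (Λ.n - Λ.body) := rfl
  rw [spell]
  by_cases j1 : j < Λ.slotPos
  · rw [if_neg (by omega), if_neg (by omega), if_neg (by omega), if_pos (by omega), if_pos j1]; rfl
  rw [if_neg j1]
  by_cases j2 : j < Λ.headPos
  · rw [if_neg (by omega), if_neg (by omega), if_pos (by omega), if_pos j2]
  rw [if_neg j2]
  by_cases j3 : j < Λ.tailPos
  · rw [if_neg (by omega), if_pos (by omega), if_pos j3]
  rw [if_neg j3, if_pos (by omega)]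

theorem runs_decMain {P : Params} {n : ℕ} {m L J : ℕ} (H : (P.layout n).Bounds m L J)
    (c : Fin m → Bool) :
    ∃ s, (decMain P).Runs L J (listMem [n, m, 0, 0, 0, 0, 0, 0, 0]
        [fun j => (ext c j).toNat, zeros, zeros, zeros, zeros, zeros, zeros, zeros, zeros, zeros])
        s ∧ s.reg 1 = n ∧
      ∀ j < n, s.arr 1 j = (((P.layout n).localDec m j).eval c).toNat := by
  have hP : (P.layout n).Uses P := ⟨rfl, rfl, rfl⟩
  have hΛn : (P.layout n).n = n := rfl
  set Λ := P.layout n with hΛ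
  have hL := H.small.one_le
  have hJ := H.iter
  have hlen := H.len
  have hc : ∀ i, (ext c i).toNat < 2 ^ L := fun i => toNat_lt hL _
  have hbl := H.blocks_le
  have hsl := H.slots_le
  have hsb := H.slotBits_le
  have hhb := H.headBits_le
  have hsp := H.slotPos_le
  have hbits := H.bits
  have hbody := H.body_le
  have hn := H.small.n
  have hp := H.two_pow_blk_lt
  have h2b : 0 < 2 ^ Λ.blk := by positivity
  have hcnt := Λ.count_le_self (2 ^ Λ.blk)
  set k := Nat.count Λ.Typ (2 ^ Λ.blk) with hk
  have hkL : k < 2 ^ L := by omega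
  let F : ℕ → ℕ := fun q =>
    if q < Λ.blocks then val (ext c) (0 + q * (Λ.lam + 1)) (Λ.lam + 1) else 0
  let S : ℕ → ℕ := fun z =>
    if z < Λ.grp * Λ.cap then val (ext c) (Λ.slotPos + z * Λ.blk) Λ.blk else 0
  have hF : ∀ q, F q < 2 ^ L := ite_lt (fun q => (val_lt _ _ _).trans_le
    (Nat.pow_le_pow_right two_pos (by omega))) zeros_lt
  have hS : ∀ q, S q < 2 ^ L := ite_lt (fun q => (val_lt _ _ _).trans_le
    (Nat.pow_le_pow_right two_pos (by omega))) zeros_lt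
  -- Decoding ignores the heads of the free lists; they are filled in only to have a store that the
  -- word spells out.
  let st : Store := ⟨F, S, fun g => val (ext c) (Λ.headPos + g * Λ.lam) Λ.lam⟩
  have hrep : Λ.Rep (ext c) st := by
    refine ⟨fun q hq => ?_, fun z hz => ?_, fun _ _ => rfl⟩
    · have h : st.fld q = val (ext c) (0 + q * (Λ.lam + 1)) (Λ.lam + 1) := if_pos hq
      rw [h, zero_add]
    · exact (if_pos hz).symm
  have hblk : ∀ q, Λ.blockOf st q < 2 ^ L := by
    intro q
    rw [Layout.blockOf]
    split_ifs
    · have := Λ.unrank_lt (st.fld q / 2); omega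
    · exact hS _
    · positivity
  let B : ℕ → ℕ := fun q => if 0 ≤ q ∧ q < 0 + Λ.blocks then Λ.blockOf st (q - 0) else 0
  have hB : ∀ q, B q < 2 ^ L := ite_lt (fun q => hblk _) zeros_lt
  have r4 : (collectLoop 8 Program.slotPos (.const 0) fldBits).Runs L J
      (Λ.mem m (2 ^ Λ.blk) k (Λ.withTables (fun j => (ext c j).toNat) zeros zeros zeros zeros zeros))
      (Λ.mem m Λ.slotPos k
        (Λ.withTables (fun j => (ext c j).toNat) zeros zeros zeros F zeros)) := by
    have key := runs_collectLoop H.small (x := 8) (lim := Program.slotPos) (off := .const 0)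
      (w := fldBits) (a := Λ.withTables (fun j => (ext c j).toNat) zeros zeros zeros zeros zeros)
      (by simp [withTables]) (by norm_num) (by norm_num) (T := Λ.blocks) (ω := Λ.lam + 1)
      (z₀ := 2 ^ Λ.blk) (k := k) (O := 0) (c := ext c) (hsp.trans_lt hlen) (by omega) (by omega)
      hkL (H.withTables hc zeros_lt zeros_lt zeros_lt zeros_lt zeros_lt) rfl
      (fun i hi => if_pos (by omega)) rfl (fun _ _ => rfl) (fun _ _ => rfl) (fun _ _ => rfl)
    exact key.mono (by rw [Layout.slotPos] at hsp; omega)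
  have r5 : (collectLoop 7 (.mul (.mul (.reg 6) (.reg 5)) (.reg 4)) Program.slotPos (.reg 4)).Runs L J
      (Λ.mem m Λ.slotPos k (Λ.withTables (fun j => (ext c j).toNat) zeros zeros zeros F zeros))
      (Λ.mem m (Λ.grp * Λ.cap * Λ.blk) k
        (Λ.withTables (fun j => (ext c j).toNat) zeros zeros S F zeros)) := by
    have key := runs_collectLoop H.small (x := 7) (lim := .mul (.mul (.reg 6) (.reg 5)) (.reg 4))
      (off := Program.slotPos)
      (w := .reg 4) (a := Λ.withTables (fun j => (ext c j).toNat) zeros zeros zeros F zeros)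
      (by simp [withTables]) (by norm_num) (by norm_num) (T := Λ.grp * Λ.cap) (ω := Λ.blk)
      (z₀ := Λ.slotPos) (k := k) (O := Λ.slotPos) (c := ext c) (by omega) (by omega) (by omega)
      hkL (H.withTables hc zeros_lt zeros_lt zeros_lt hF zeros_lt) rfl
      (fun i hi => if_pos (by omega)) rfl (fun _ _ => rfl) (fun _ _ => rfl) (fun _ _ => rfl)
    exact key.mono (by omega)
  have r6 : (fillLoop 6 (.mul (.reg 6) (.reg 3)) (.const 0) Program.blockOf).Runs L J
      (Λ.mem m (Λ.grp * Λ.cap * Λ.blk) k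
        (Λ.withTables (fun j => (ext c j).toNat) zeros zeros S F zeros))
      (Λ.mem m Λ.blocks k (Λ.withTables (fun j => (ext c j).toNat) zeros B S F zeros)) := by
    refine (runs_fillLoop H.small (x := 6) (a := Λ.withTables (fun j => (ext c j).toNat) zeros zeros
      S F zeros) (by simp [withTables]) (N := Λ.blocks) (z₀ := Λ.grp * Λ.cap * Λ.blk) (k := k)
      (O := 0) (f := Λ.blockOf st) (by omega) (by omega) hkL
      (H.withTables hc zeros_lt zeros_lt hS hF zeros_lt) (fun z _ => hblk z)
      (fun _ _ => rfl) (fun _ _ => rfl) (fun z hz g => ?_)).mono (by omega)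
    -- The case distinction is done arithmetically: `1 - F z % 2` and `F z % 2 * (1 - (F z / 2 + 1 -
    -- cap))` are 1 in the first and the second case respectively, and 0 otherwise.
    change (1 - F z % 2) * Λ.unrank (F z / 2) + F z % 2 * (1 - (F z / 2 + 1 - Λ.cap)) *
      S (z / Λ.num * Λ.cap + F z / 2) = if F z % 2 = 0 then Λ.unrank (F z / 2) else
        if F z / 2 < Λ.cap then S (z / Λ.num * Λ.cap + F z / 2) else 0
    split_ifs with h1 h2
    · simp [h1]
    · have h3 : F z % 2 = 1 := by omega
      have h4 : F z / 2 + 1 - Λ.cap = 0 := by omega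
      simp [h3, h4]
    · have h3 : F z % 2 = 1 := by omega
      have h4 : 1 - (F z / 2 + 1 - Λ.cap) = 0 := by omega
      simp [h3, h4]
  have out : ∀ {lim off e : Expr} {N z₀ O : ℕ} {o f : ℕ → ℕ}, N ≤ Λ.len + Λ.n → N < 2 ^ L →
      z₀ < 2 ^ L → (∀ i, o i < 2 ^ L) → (∀ z, f z < 2 ^ L) →
      (∀ z g, lim.eval (Λ.mem m z k (Λ.withTables (fun j => (ext c j).toNat) g B S F zeros)) = N) →
      (∀ z g, off.eval (Λ.mem m z k (Λ.withTables (fun j => (ext c j).toNat) g B S F zeros)) = O) →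
      (∀ z < N, ∀ g, e.eval (Λ.mem m z k (Λ.withTables (fun j => (ext c j).toNat) g B S F zeros))
        = f z) →
      (fillLoop 1 lim off e).Runs L J
        (Λ.mem m z₀ k (Λ.withTables (fun j => (ext c j).toNat) o B S F zeros))
        (Λ.mem m N k (Λ.withTables (fun j => (ext c j).toNat)
        (fun j => if O ≤ j ∧ j < O + N then f (j - O) else o j) B S F zeros)) := by
    intro lim off e N z₀ O o f hNJ hN hz₀ ho hf h1 h2 h3
    exact (runs_fillLoop H.small (x := 1) (a := Λ.withTables (fun j => (ext c j).toNat) o B S F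
        zeros) (by simp [withTables]) hN hz₀ hkL
        (H.withTables hc ho hB hS hF zeros_lt) (fun z _ => hf z) h1 h2 h3).mono (by omega)
  have r7 := out (lim := Program.body) (off := .const 0) (e := bitOf 6 (.reg 4))
    (N := Λ.body) (z₀ := Λ.blocks) (O := 0) (o := zeros) (f := fun z =>
      ((B (z / Λ.blk)).testBit (z % Λ.blk)).toNat) (by omega) (by omega) (by omega)
      zeros_lt (fun z => toNat_lt hL _) (fun _ _ => rfl) (fun _ _ => rfl) (fun z hz g =>
        eval_bitOf (Nat.pos_of_ne_zero (by rintro h; simp [Layout.body, h] at hz)) (by omega)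
          rfl rfl)
  have b7 := ite_lt (p := fun j => 0 ≤ j ∧ j < 0 + Λ.body)
    (fun j => toNat_lt hL ((B ((j - 0) / Λ.blk)).testBit ((j - 0) % Λ.blk))) (zeros_lt (L := L))
  have r8 := out (lim := .sub (.reg 0) Program.body) (off := Program.body)
    (e := .get 0 (.add Program.tailPos (.reg 7)))
    (N := Λ.n - Λ.body) (z₀ := Λ.body) (O := Λ.body) (f := fun z =>
      (ext c (Λ.tailPos + z)).toNat) (by omega) (by omega) (by omega)
      b7 (fun z => toNat_lt hL _) (fun _ _ => rfl) (fun _ _ => rfl) (fun z hz g => rfl)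
  have b8 := ite_lt (p := fun j => Λ.body ≤ j ∧ j < Λ.body + (Λ.n - Λ.body))
    (fun j => toNat_lt hL (ext c (Λ.tailPos + (j - Λ.body)))) b7
  refine ⟨_, (runs_setup H (forall_mem_ten hc zeros_lt zeros_lt zeros_lt zeros_lt zeros_lt zeros_lt
    zeros_lt zeros_lt zeros_lt)).seq <| (runs_powers H hc).seq <| (runs_tables hP H hc).seq <|
    r4.seq <| r5.seq <| r6.seq <| r7.seq <| r8.seq <|
    Straight.runs (P := assign 1 (.reg 0)) hL (by omega)
      trivial (H.small.mem_bdd (by omega) hkL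
        (H.withTables hc b8 hB hS hF zeros_lt)) (mem_setReg1 _ _ _ _), rfl,
    fun j hj => ?_⟩
  change (if _ then _ else if _ then _ else _) = _
  rw [eval_localDec hrep]
  by_cases h1 : j < Λ.body
  · have hq : j / Λ.blk < Λ.blocks := Nat.div_lt_of_lt_mul (by rwa [mul_comm])
    have h3 : B (j / Λ.blk) = Λ.blockOf st (j / Λ.blk) :=
      if_pos ⟨Nat.zero_le _, by rwa [zero_add]⟩
    rw [if_neg (by omega), if_pos (by omega), if_pos h1, Nat.sub_zero, h3]
  · rw [if_pos (by omega), if_neg h1]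

end LocalCompression

namespace LocalCompression
open Layout Program

/-! ### The scheme: updates and running times -/

namespace Params

variable (P : Params)

/-- The compression scheme with the given constants. -/
noncomputable def scheme : Scheme where
  len n := if n < P.n₀ then 0 else (P.layout n).len
  enc n x := (P.layout n).enc _ x
  dec n c i := (if n < P.n₀ then Decoder.answer false else (P.layout n).localDec _ i).eval c
  localDec n i := if n < P.n₀ then Decoder.answer false else (P.layout n).localDec _ i
  localUpd n i b := if n < P.n₀ then Updater.done else (P.layout n).localUpd _ i b

variable {P}

theorem len_of_le {n : ℕ} (hn : P.n₀ ≤ n) : P.scheme.len n = (P.layout n).len :=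
  if_neg (not_lt.2 hn)

theorem len_of_lt {n : ℕ} (hn : n < P.n₀) : P.scheme.len n = 0 := if_pos hn

theorem localDec_of_le {n : ℕ} (hn : P.n₀ ≤ n) (i : Fin n) :
    P.scheme.localDec n i = (P.layout n).localDec _ i := if_neg (not_lt.2 hn)

theorem localDec_of_lt {n : ℕ} (hn : n < P.n₀) (i : Fin n) :
    P.scheme.localDec n i = Decoder.answer false := if_pos hn

theorem localUpd_of_le {n : ℕ} (hn : P.n₀ ≤ n) (i : Fin n) (b : Bool) :
    P.scheme.localUpd n i b = (P.layout n).localUpd _ i b := if_neg (not_lt.2 hn)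

theorem localDecoderCorrect : P.scheme.LocalDecoderCorrect := fun _ _ _ => rfl

theorem body_le (n : ℕ) : (P.layout n).body ≤ n := by
  rw [Layout.body, blocks, mul_assoc]
  exact Nat.div_mul_le_self _ _

/-- `Maintains` speaks of correct decoding, `Good.update` of fitting. The encoding of the updated
word bridges the two: as it decodes correctly, the invariant holds for it, and the word fits. -/
theorem good_of_maintains (hV : ∀ n, P.n₀ ≤ n → (P.layout n).grp ≠ 0 → (P.layout n).Valid) {n : ℕ}
    (hn : P.n₀ ≤ n) {x : Fin n → Bool} {c : Fin (P.scheme.len n) → Bool}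
    (H : P.scheme.Maintains n x c) : (P.layout n).Good x c := by
  have hgood : ∀ y : Fin n → Bool, P.scheme.dec n (P.scheme.enc n y) = y →
      (P.layout n).Good y (P.scheme.enc n y) := by
    intro y hy
    have key : ∀ i : Fin n, ((P.layout n).localDec (P.scheme.len n) i).eval (P.scheme.enc n y)
        = y i := fun i => by
      have := congrFun hy i
      rwa [← localDecoderCorrect n i, localDec_of_le hn] at this
    exact good_enc_of_eval (Λ := P.layout n) (hV n hn) (len_of_le hn) (body_le n) key
  induction H with
  | encode x hx => exact hgood x hx
  | update x c i b _ hx ih =>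
    rw [localUpd_of_le hn]
    obtain ⟨⟨st, hst, -⟩, -⟩ := hgood _ hx
    exact ih.update (Λ := P.layout n) (hV n hn) (len_of_le hn) i b hst.fits

theorem updaterCorrect (hV : ∀ n, P.n₀ ≤ n → (P.layout n).grp ≠ 0 → (P.layout n).Valid) :
    P.scheme.UpdaterCorrect := by
  intro n x c H
  rcases le_or_gt P.n₀ n with hn | hn
  · funext i
    rw [← localDecoderCorrect, localDec_of_le hn]
    exact (good_of_maintains hV hn H).eval (Λ := P.layout n) i
  -- Below `n₀` the empty codeword is the only one.
  · have : ∀ c d : Fin (P.scheme.len n) → Bool, c = d := by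
      intro c d
      funext j
      exact absurd (j.2.trans_eq (len_of_lt hn)) (Nat.not_lt_zero _)
    cases H with
    | encode _ hx => exact hx
    | update x c i b _ hx => rw [this ((P.scheme.localUpd n i b).run c) (P.scheme.enc n _)]; exact hx

theorem not_fits_of_dec_ne (hV : ∀ n, P.n₀ ≤ n → (P.layout n).grp ≠ 0 → (P.layout n).Valid)
    {n : ℕ} (hn : P.n₀ ≤ n) {x : Fin n → Bool} (hx : P.scheme.dec n (P.scheme.enc n x) ≠ x) :
    ¬ (P.layout n).Fits x := by
  intro h
  apply hx
  funext i
  rw [← localDecoderCorrect, localDec_of_le hn]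
  exact (good_enc_of_fits (Λ := P.layout n) (hV n hn) (len_of_le hn) h).eval (Λ := P.layout n) i

/-- The bit length of the numbers in the computations. -/
def bitLength (P : Params) (n : ℕ) : ℕ :=
  (P.layout n).blk + (P.layout n).lam + 2 + Nat.size n + Nat.size (P.layout n).len

/-- The number of iterations of the loops. -/
def iterations (P : Params) (n : ℕ) : ℕ :=
  n + (P.layout n).len + 2 ^ (P.layout n).blk + (P.layout n).lam + 2

theorem lt_two_pow_bitLength {n k : ℕ} (h : k ≤ n ∨ k ≤ (P.layout n).len) :
    k < 2 ^ P.bitLength n := by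
  rw [bitLength]
  rcases h with h | h
  · exact (h.trans_lt (Nat.lt_size_self n)).trans_le (Nat.pow_le_pow_right two_pos (by omega))
  · exact (h.trans_lt (Nat.lt_size_self _)).trans_le (Nat.pow_le_pow_right two_pos (by omega))

theorem bounds {n m : ℕ} (hm : m ≤ n ∨ m ≤ (P.layout n).len) :
    (P.layout n).Bounds m (P.bitLength n) (P.iterations n) := by
  have hnum : (P.layout n).num < 2 ^ P.bitLength n :=
    Nat.pow_lt_pow_right (by norm_num) (by rw [bitLength]; omega)
  have hcap : (P.layout n).cap ≤ (P.layout n).num := Nat.div_le_self _ _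
  refine ⟨⟨lt_two_pow_bitLength (Or.inl le_rfl), lt_two_pow_bitLength hm, ?_, hnum, ?_,
    hcap.trans_lt hnum, lt_two_pow_bitLength (Or.inl (Nat.div_le_self _ _))⟩, ?_,
    lt_two_pow_bitLength (Or.inr le_rfl), hcap, body_le n, le_rfl⟩
  · exact Nat.lt_two_pow_self.trans_le (Nat.pow_le_pow_right two_pos (by rw [bitLength]; omega))
  · exact Nat.lt_two_pow_self.trans_le (Nat.pow_le_pow_right two_pos (by rw [bitLength]; omega))
  · rw [bitLength]; omega

theorem inputMemory_eq (n : ℕ) {m : ℕ} (w : Fin m → Bool) :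
    inputMemory n w = listMem [n, m, 0, 0, 0, 0, 0, 0, 0] [fun j => (ext w j).toNat, zeros, zeros,
      zeros, zeros, zeros, zeros, zeros, zeros, zeros] := by
  have h1 : (inputMemory n w).reg = (listMem [n, m, 0, 0, 0, 0, 0, 0, 0] [fun j => (ext w j).toNat,
      zeros, zeros, zeros, zeros, zeros, zeros, zeros, zeros, zeros]).reg := by
    funext x
    rcases x with _ | _ | x
    · rfl
    · rfl
    · rw [listMem_reg]
      simp only [inputMemory]
      rw [if_neg (by omega), if_neg (by omega)]
      rcases x with _ | _ | _ | _ | _ | _ | _ | x <;> simp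
  have h2 : (inputMemory n w).arr = (listMem [n, m, 0, 0, 0, 0, 0, 0, 0] [fun j => (ext w j).toNat,
      zeros, zeros, zeros, zeros, zeros, zeros, zeros, zeros, zeros]).arr := by
    funext a j
    rcases a with _ | a
    · by_cases h : j < m <;> simp [inputMemory, listMem, ext, h]
    · rw [listMem_arr]
      simp only [inputMemory]
      rw [dif_neg (by omega)]
      rcases a with _ | _ | _ | _ | _ | _ | _ | _ | _ | a <;> simp [zeros]
  cases h : inputMemory n w
  rw [h] at h1 h2
  exact congrArg₂ Memory.mk h1 h2

theorem inputMemory_bdd {n m L : ℕ} (hL : 1 ≤ L) (hn : n < 2 ^ L) (hm : m < 2 ^ L)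
    (w : Fin m → Bool) : (inputMemory n w).Bdd L := by
  have h0 : 0 < 2 ^ L := by positivity
  rw [inputMemory_eq]
  exact listMem_bdd (by simp [hn, hm]) (forall_mem_ten (fun i => toNat_lt hL _) zeros_lt
    zeros_lt zeros_lt zeros_lt zeros_lt zeros_lt zeros_lt zeros_lt zeros_lt)

theorem runs_ite {e : Expr} {A B : Program} {L J : ℕ} {s s' : Memory} (hL : 1 ≤ L) (hJ : 1 ≤ J)
    (hs : s.Bdd L) (h : (e.eval s ≠ 0 ∧ A.Runs L J s s') ∨ (e.eval s = 0 ∧ B.Runs L J s s')) :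
    (ite e A B).Runs L J s s' := by
  have he := e.cost_le hL hs
  have h1 : e.wt * L + 1 ≤ (e.wt + 1) * L * J := by nlinarith [Nat.zero_le (e.wt * L)]
  rcases h with ⟨h0, t, h2, h3⟩ | ⟨h0, t, h2, h3⟩
  · refine ⟨_, Exec.ite_true h0 h2, ?_⟩
    rw [wt]; nlinarith [Nat.zero_le (B.wt * L * J)]
  · refine ⟨_, Exec.ite_false h0 h2, ?_⟩
    rw [wt]; nlinarith [Nat.zero_le (A.wt * L * J)]

/-- The time bound for both programs. -/
def time (P : Params) (n : ℕ) : ℕ :=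
  ((encProgram P).wt + (decProgram P).wt) * P.bitLength n * P.iterations n

theorem one_le_bitLength (n : ℕ) : 1 ≤ P.bitLength n := by rw [bitLength]; omega

theorem one_le_iterations (n : ℕ) : 1 ≤ P.iterations n :=
  (Nat.le_add_left 1 _).trans (le_of_eq rfl)

theorem computes_enc (n : ℕ) (x : Fin n → Bool) :
    ComputesWithin (encProgram P) n x (P.scheme.enc n x) (P.time n) := by
  have hL := P.one_le_bitLength n
  have hJ := P.one_le_iterations n
  have hn := lt_two_pow_bitLength (P := P) (n := n) (Or.inl le_rfl)
  have hbdd := inputMemory_bdd hL hn hn x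
  suffices h : ∃ s, (encProgram P).Runs (P.bitLength n) (P.iterations n) (inputMemory n x) s ∧
      HasOutput s (P.scheme.enc n x) by
    obtain ⟨s, ⟨t, h1, h2⟩, h3⟩ := h
    exact ⟨s, t, h1, h3, h2.trans (Nat.mul_le_mul_right _ (Nat.mul_le_mul_right _
      (Nat.le_add_right _ _)))⟩
  rcases le_or_gt P.n₀ n with h | h
  · obtain ⟨s, h1, h2, h3⟩ := runs_encMain (P.bounds (n := n) (Or.inl le_rfl)) (ext x)
    rw [← inputMemory_eq] at h1
    refine ⟨s, runs_ite hL hJ hbdd (Or.inr ⟨Nat.sub_eq_zero_of_le h, h1⟩),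
      h2.trans (len_of_le h).symm, fun j => ?_⟩
    rw [h3 j (j.2.trans_eq (len_of_le h))]
    rfl
  · refine ⟨_, runs_ite hL hJ hbdd (Or.inl ⟨(Nat.sub_pos_of_lt h).ne',
      Straight.runs (P := assign 1 (.const 0)) hL hJ trivial hbdd rfl⟩), ?_, fun j => ?_⟩
    · rw [len_of_lt h]; rfl
    · exact absurd (j.2.trans_eq (len_of_lt h)) (Nat.not_lt_zero _)

theorem computes_dec (n : ℕ) (c : Fin (P.scheme.len n) → Bool) :
    ComputesWithin (decProgram P) n c (P.scheme.dec n c) (P.time n) := by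
  have hL := P.one_le_bitLength n
  have hJ := P.one_le_iterations n
  have hn := lt_two_pow_bitLength (P := P) (n := n) (Or.inl le_rfl)
  have hm : P.scheme.len n ≤ (P.layout n).len := by
    rcases le_or_gt P.n₀ n with h | h
    · rw [len_of_le h]
    · rw [len_of_lt h]; omega
  have hbdd := inputMemory_bdd hL hn (lt_two_pow_bitLength (Or.inr hm)) c
  suffices h : ∃ s, (decProgram P).Runs (P.bitLength n) (P.iterations n) (inputMemory n c) s ∧
      HasOutput s (P.scheme.dec n c) by
    obtain ⟨s, ⟨t, h1, h2⟩, h3⟩ := h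
    exact ⟨s, t, h1, h3, h2.trans (Nat.mul_le_mul_right _ (Nat.mul_le_mul_right _
      (Nat.le_add_left _ _)))⟩
  rcases le_or_gt P.n₀ n with h | h
  · obtain ⟨s, h1, h2, h3⟩ := runs_decMain (P.bounds (n := n) (Or.inr hm)) c
    rw [← inputMemory_eq] at h1
    refine ⟨s, runs_ite hL hJ hbdd (Or.inr ⟨Nat.sub_eq_zero_of_le h, h1⟩), h2, fun j => ?_⟩
    rw [h3 j j.2, ← localDecoderCorrect, localDec_of_le h]
  · refine ⟨_, runs_ite hL hJ hbdd (Or.inl ⟨(Nat.sub_pos_of_lt h).ne',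
      Straight.runs (P := assign 1 (.reg 0)) hL hJ trivial hbdd rfl⟩), rfl, fun j => ?_⟩
    have : P.scheme.dec n c j = false := by
      rw [← localDecoderCorrect, localDec_of_lt h]; rfl
    rw [this]
    rfl

theorem quasilinearTime (h : Quasilinear P.time) : P.scheme.QuasilinearTime :=
  ⟨encProgram P, decProgram P, P.time, h, fun n => ⟨computes_enc n, computes_dec n⟩⟩

end Params

/-! ### Few blocks are expensive -/

theorem prod_blocks {b : ℕ} (hb : 0 < b) {n B : ℕ} (hn : B * b ≤ n) {Q : Finset ℕ}
    (hQ : ∀ q ∈ Q, q < B) (φ : ℕ → ℝ) :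
    ∏ i ∈ Finset.range n, (if i / b ∈ Q then φ i else 1)
      = ∏ q ∈ Q, ∏ r ∈ Finset.range b, φ (q * b + r) := by
  rw [← Finset.prod_filter, ← Finset.prod_product']
  symm
  refine Finset.prod_nbij' (fun t => t.1 * b + t.2) (fun i => (i / b, i % b)) ?_ ?_ ?_ ?_ ?_
  · rintro ⟨q, r⟩ h
    simp only [Finset.mem_product, Finset.mem_range, Finset.mem_filter] at h ⊢
    have h1 := Nat.mul_le_mul_right b (hQ q h.1)
    rw [Nat.succ_mul] at h1
    refine ⟨by omega, ?_⟩
    rw [mul_comm, Nat.mul_add_div hb, Nat.div_eq_of_lt h.2, add_zero]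
    exact h.1
  · intro i h
    simp only [Finset.mem_product, Finset.mem_range, Finset.mem_filter] at h ⊢
    exact ⟨h.2, Nat.mod_lt _ hb⟩
  · rintro ⟨q, r⟩ h
    simp only [Finset.mem_product, Finset.mem_range] at h
    dsimp only
    rw [mul_comm, Nat.mul_add_div hb, Nat.div_eq_of_lt h.2, add_zero, Nat.mul_add_mod,
      Nat.mod_eq_of_lt h.2]
  · intro i _
    exact div_mul_blk_add
  · intro t _
    rfl

/-- Independence: the mean of a product over the positions is the product of the means. -/
theorem sum_bernoulliProb_mul (p : ℝ) {n : ℕ} (f : Fin n → Bool → ℝ) :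
    ∑ x : Fin n → Bool, bernoulliProb p x * ∏ i, f i (x i)
      = ∏ i, (p * f i true + (1 - p) * f i false) := by
  have h := Finset.prod_univ_sum (fun _ : Fin n => (Finset.univ : Finset Bool))
    fun i b => (if b then p else 1 - p) * f i b
  simp only [Fintype.piFinset_univ, Fintype.sum_bool, if_true, Bool.false_eq_true, if_false] at h
  simp only [bernoulliProb, ← Finset.prod_mul_distrib]
  exact h.symm

theorem bernoulliProb_nonneg {p : ℝ} (hp0 : 0 ≤ p) (hp1 : p ≤ 1) {n : ℕ} (x : Fin n → Bool) :
    0 ≤ bernoulliProb p x :=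
  Finset.prod_nonneg fun i _ => by split_ifs <;> linarith

namespace Layout

variable {Λ : Layout}

/-- The exponential weight of a bit. -/
noncomputable def expWeight (Λ : Layout) (θ u : ℝ) (b : Bool) : ℝ :=
  Real.exp (θ * ((if b then (Λ.α₁ : ℝ) else Λ.α₀) - u))

theorem prod_expWeight (θ u : ℝ) (c : ℕ → Bool) (b : ℕ) :
    ∏ r ∈ Finset.range b, Λ.expWeight θ u (c r) = Real.exp (θ * ((Λ.α₁ : ℝ) *
      (∑ r ∈ Finset.range b, ((c r).toNat : ℝ)) +
        Λ.α₀ * (b - ∑ r ∈ Finset.range b, ((c r).toNat : ℝ)) - u * b)) := by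
  simp only [expWeight, ← Real.exp_sum, ← Finset.mul_sum]
  congr 2
  induction b with
  | zero => simp
  | succ b ih =>
    rw [Finset.sum_range_succ, Finset.sum_range_succ, ih]
    cases c b <;> push_cast <;> simp <;> ring

/-- The product is exp of θ times the excess of the block's cost over `u * blk`. An expensive block
costs more than `τ`, which is at least `u * blk`. This is Markov's inequality for the exponential,
before means are taken. -/
theorem one_le_prod_expWeight {θ u : ℝ} (hθ : 0 ≤ θ) (hu : u * Λ.blk ≤ Λ.τ) {x : ℕ → Bool} {q : ℕ}
    (hq : ¬ Λ.Typ (Λ.srcBlock x q)) :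
    1 ≤ ∏ r ∈ Finset.range Λ.blk, Λ.expWeight θ u (x (q * Λ.blk + r)) := by
  rw [prod_expWeight θ u (fun r => x (q * Λ.blk + r)), Real.one_le_exp_iff]
  refine mul_nonneg hθ ?_
  have hlt : Λ.srcBlock x q < 2 ^ Λ.blk := val_lt _ _ _
  have h1 := pop_le hlt
  have h2 : Λ.τ < Λ.α₁ * pop (Λ.srcBlock x q) + Λ.α₀ * (Λ.blk - pop (Λ.srcBlock x q)) := by
    by_contra h
    exact hq ⟨hlt, not_lt.1 h⟩
  have h3 : (pop (Λ.srcBlock x q) : ℝ)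
      = ∑ r ∈ Finset.range Λ.blk, ((x (q * Λ.blk + r)).toNat : ℝ) := by
    rw [srcBlock, pop_val]; push_cast; rfl
  rw [← h3]
  have h4 : (Λ.τ : ℝ) < Λ.α₁ * pop (Λ.srcBlock x q) + Λ.α₀ * (Λ.blk - pop (Λ.srcBlock x q)) := by
    rw [← Nat.cast_sub h1]; exact_mod_cast h2
  linarith

theorem card_group_le (g : ℕ) :
    ({q ∈ Finset.range Λ.blocks | q / Λ.num = g}).card ≤ Λ.num := by
  refine (Finset.card_le_card_of_injOn (t := Finset.range Λ.num) (fun q => q % Λ.num)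
    (fun q _ => Finset.mem_coe.2 (Finset.mem_range.2 (Nat.mod_lt _ num_pos))) ?_).trans_eq
      (Finset.card_range _)
  intro q hq q' hq' h
  simp only [Finset.coe_filter, Finset.mem_range, Set.mem_ofPred_eq] at hq hq'
  have h1 := Nat.div_add_mod q Λ.num
  have h2 := Nat.div_add_mod q' Λ.num
  dsimp only at h
  rw [hq.2, h] at h1
  rw [hq'.2] at h2
  omega

/-- If a word does not fit, some group contains a set Q of exactly `cap` expensive blocks, and the
exponential weight `F Q` of these is at least 1. By independence it has mean γ ^ (blk * cap), where
γ is the mean weight of one bit. The union bound runs over the groups and over at most `2 ^ num`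
sets Q in each. -/
theorem sum_not_fits_le (hb : 0 < Λ.blk) (hbody : Λ.body ≤ Λ.n) {p : ℝ} (hp0 : 0 ≤ p) (hp1 : p ≤ 1)
    {θ u : ℝ} (hθ : 0 ≤ θ) (hu : u * Λ.blk ≤ Λ.τ)
    (S : Finset (Fin Λ.n → Bool)) (hS : ∀ x ∈ S, ¬ Λ.Fits x) :
    ∑ x ∈ S, bernoulliProb p x ≤ Λ.grp * (2 ^ Λ.num *
      (p * Λ.expWeight θ u true + (1 - p) * Λ.expWeight θ u false) ^ (Λ.blk * Λ.cap)) := by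
  set γ := p * Λ.expWeight θ u true + (1 - p) * Λ.expWeight θ u false with hγ
  have hγ0 : 0 ≤ γ := add_nonneg (mul_nonneg hp0 (Real.exp_pos _).le)
    (mul_nonneg (by linarith) (Real.exp_pos _).le)
  let F : Finset ℕ → (Fin Λ.n → Bool) → ℝ := fun Q x =>
    ∏ i : Fin Λ.n, if (i : ℕ) / Λ.blk ∈ Q then Λ.expWeight θ u (x i) else 1
  have hF0 : ∀ Q x, 0 ≤ F Q x := fun Q x => Finset.prod_nonneg fun i _ => by
    split_ifs
    · exact (Real.exp_pos _).le
    · norm_num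
  have hFsum : ∀ Q : Finset ℕ, (∀ q ∈ Q, q < Λ.blocks) →
      ∑ x, bernoulliProb p x * F Q x = γ ^ (Λ.blk * Q.card) := by
    intro Q hQ
    have h1 := sum_bernoulliProb_mul p (n := Λ.n) fun i b =>
      if (i : ℕ) / Λ.blk ∈ Q then Λ.expWeight θ u b else 1
    refine h1.trans ?_
    have h2 : ∀ i : Fin Λ.n, (p * (if (i : ℕ) / Λ.blk ∈ Q then Λ.expWeight θ u true else 1) +
        (1 - p) * (if (i : ℕ) / Λ.blk ∈ Q then Λ.expWeight θ u false else 1))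
          = if (i : ℕ) / Λ.blk ∈ Q then γ else 1 := fun i => by split_ifs <;> simp [hγ]
    rw [Finset.prod_congr rfl fun i _ => h2 i, Fin.prod_univ_eq_prod_range
      (fun i => if i / Λ.blk ∈ Q then γ else 1), prod_blocks hb hbody hQ fun _ => γ]
    simp [pow_mul]
  have hF1 : ∀ Q x, (∀ q ∈ Q, q < Λ.blocks ∧ ¬ Λ.Typ (Λ.srcBlock (ext x) q)) → 1 ≤ F Q x := by
    intro Q x hQ
    have h1 : F Q x = ∏ i : Fin Λ.n, (fun i : ℕ => if i / Λ.blk ∈ Q then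
        Λ.expWeight θ u (ext x i) else 1) i :=
      Finset.prod_congr rfl fun i _ => by simp only [ext_fin]
    rw [h1, Fin.prod_univ_eq_prod_range (fun i : ℕ => if i / Λ.blk ∈ Q then
        Λ.expWeight θ u (ext x i) else 1), prod_blocks hb hbody (fun q hq => (hQ q hq).1)]
    calc (1 : ℝ) = ∏ q ∈ Q, 1 := Finset.prod_const_one.symm
      _ ≤ _ := Finset.prod_le_prod (fun _ _ => zero_le_one) fun q hq =>
        one_le_prod_expWeight hθ hu (hQ q hq).2
  let T : ℕ → Finset (Finset ℕ) := fun g =>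
    {Q ∈ ({q ∈ Finset.range Λ.blocks | q / Λ.num = g}).powerset | Q.card = Λ.cap}
  calc ∑ x ∈ S, bernoulliProb p x
      ≤ ∑ x ∈ S, ∑ g ∈ Finset.range Λ.grp, ∑ Q ∈ T g, bernoulliProb p x * F Q x := by
        refine Finset.sum_le_sum fun x hx => ?_
        have h1 := hS x hx
        rw [Fits] at h1
        push Not at h1
        obtain ⟨g, hg, h2⟩ := h1
        obtain ⟨Q, hQ, hQc⟩ := Finset.exists_subset_card_eq h2.le
        have hpos := bernoulliProb_nonneg hp0 hp1 x
        have hQT : Q ∈ T g := by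
          simp only [T, Finset.mem_filter, Finset.mem_powerset]
          refine ⟨fun q hq => ?_, hQc⟩
          have := hQ hq
          simp only [atyp, Finset.mem_filter] at this ⊢
          exact ⟨this.1, this.2.1⟩
        have h3 : 1 ≤ F Q x := hF1 Q x fun q hq => by
          have := hQ hq
          simp only [atyp, Finset.mem_filter, Finset.mem_range] at this
          exact ⟨this.1, this.2.2⟩
        calc bernoulliProb p x ≤ bernoulliProb p x * F Q x := le_mul_of_one_le_right hpos h3
          _ ≤ ∑ Q ∈ T g, bernoulliProb p x * F Q x :=
            Finset.single_le_sum (f := fun Q => bernoulliProb p x * F Q x)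
              (fun Q _ => mul_nonneg hpos (hF0 Q x)) hQT
          _ ≤ _ := Finset.single_le_sum (f := fun g => ∑ Q ∈ T g, bernoulliProb p x * F Q x)
              (fun g _ => Finset.sum_nonneg fun Q _ => mul_nonneg hpos (hF0 Q x))
              (Finset.mem_range.2 hg)
    _ ≤ ∑ x, ∑ g ∈ Finset.range Λ.grp, ∑ Q ∈ T g, bernoulliProb p x * F Q x :=
        Finset.sum_le_sum_of_subset_of_nonneg (Finset.subset_univ _) fun x _ _ =>
          Finset.sum_nonneg fun g _ => Finset.sum_nonneg fun Q _ =>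
            mul_nonneg (bernoulliProb_nonneg hp0 hp1 x) (hF0 Q x)
    _ = ∑ g ∈ Finset.range Λ.grp, ∑ Q ∈ T g, ∑ x, bernoulliProb p x * F Q x := by
        rw [Finset.sum_comm]
        exact Finset.sum_congr rfl fun g _ => Finset.sum_comm
    _ ≤ ∑ g ∈ Finset.range Λ.grp, 2 ^ Λ.num * γ ^ (Λ.blk * Λ.cap) := by
        refine Finset.sum_le_sum fun g _ => ?_
        have h1 : ∀ Q ∈ T g, ∑ x, bernoulliProb p x * F Q x = γ ^ (Λ.blk * Λ.cap) := by
          intro Q hQ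
          simp only [T, Finset.mem_filter, Finset.mem_powerset] at hQ
          rw [hFsum Q fun q hq => ?_, hQ.2]
          have := hQ.1 hq
          simp only [Finset.mem_filter, Finset.mem_range] at this
          exact this.1
        rw [Finset.sum_congr rfl h1, Finset.sum_const, nsmul_eq_mul]
        refine mul_le_mul_of_nonneg_right ?_ (pow_nonneg hγ0 _)
        have h2 : (T g).card ≤ 2 ^ Λ.num := by
          refine (Finset.card_filter_le _ _).trans ?_
          rw [Finset.card_powerset]
          exact Nat.pow_le_pow_right two_pos (card_group_le g)
        exact_mod_cast h2
    _ = _ := by rw [Finset.sum_const, Finset.card_range, nsmul_eq_mul]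

/-- Kraft's inequality bounds the number of cheap blocks. -/
theorem count_typ_le {ρ : ℝ} (hρ0 : 0 < ρ) (hρ1 : ρ ≤ 1) (hτ : ρ ^ Λ.τ = (1 / 2) ^ Λ.lam)
    (hK : ρ ^ Λ.α₁ + ρ ^ Λ.α₀ ≤ 1) : Nat.count Λ.Typ (2 ^ Λ.blk) ≤ 2 ^ Λ.lam := by
  have h1 : ((Nat.count Λ.Typ (2 ^ Λ.blk) : ℕ) : ℝ) * (1 / 2) ^ Λ.lam ≤ 1 := by
    rw [Nat.count_eq_card_filter_range, ← nsmul_eq_mul, ← Finset.sum_const]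
    calc _ ≤ ∑ w ∈ Finset.range (2 ^ Λ.blk) with Λ.Typ w,
          (ρ ^ Λ.α₁) ^ pop w * (ρ ^ Λ.α₀) ^ (Λ.blk - pop w) := by
          refine Finset.sum_le_sum fun w hw => ?_
          -- A cheap word has weight ρ to its cost, hence at least ρ ^ τ = (1/2) ^ lam.
          rw [← pow_mul, ← pow_mul, ← pow_add, ← hτ]
          exact pow_le_pow_of_le_one hρ0.le hρ1 (Finset.mem_filter.1 hw).2.2
      _ ≤ ∑ w ∈ Finset.range (2 ^ Λ.blk), (ρ ^ Λ.α₁) ^ pop w * (ρ ^ Λ.α₀) ^ (Λ.blk - pop w) :=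
          Finset.sum_le_sum_of_subset_of_nonneg (Finset.filter_subset _ _) fun w _ _ => by
            positivity
      _ = (ρ ^ Λ.α₁ + ρ ^ Λ.α₀) ^ Λ.blk := sum_pow_pop _ _ _
      _ ≤ 1 := pow_le_one₀ (by positivity) hK
  rw [one_div, inv_pow, ← div_eq_mul_inv, div_le_one (by positivity)] at h1
  exact_mod_cast h1

end Layout
end LocalCompression

namespace LocalCompression
open Layout

/-! ### Asymptotics -/

theorem two_pow_size_le {n : ℕ} (hn : n ≠ 0) : 2 ^ Nat.size n ≤ 2 * n := by
  have h1 := Nat.size_pos.2 (Nat.pos_of_ne_zero hn)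
  have h2 : Nat.size n - 1 < Nat.size n := by omega
  rw [Nat.lt_size] at h2
  have h3 : Nat.size n = Nat.size n - 1 + 1 := by omega
  rw [h3, pow_succ]
  omega

theorem size_le_logb {n : ℕ} (hn : n ≠ 0) : (Nat.size n : ℝ) ≤ Real.logb 2 n + 1 := by
  have h1 : ((2 : ℝ) ^ Nat.size n) ≤ 2 * n := by exact_mod_cast two_pow_size_le hn
  have h2 := Real.logb_le_logb_of_le (b := 2) (by norm_num) (by positivity) h1
  have hn' : (n : ℝ) ≠ 0 := by exact_mod_cast hn
  rw [Real.logb_pow, Real.logb_mul (by norm_num) hn', Real.logb_self_eq_one (by norm_num)] at h2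
  linarith

theorem size_le_log {n : ℕ} (hn : 2 ≤ n) : (Nat.size n : ℝ) ≤ 4 * Real.log n := by
  have h1 := size_le_logb (n := n) (by omega)
  have h2 : Real.log 2 ≤ Real.log n := Real.log_le_log (by norm_num) (by exact_mod_cast hn)
  have h3 := Real.log_two_gt_d9
  rw [Real.logb] at h1
  have h4 : Real.log n / Real.log 2 ≤ 2 * Real.log n := by
    rw [div_le_iff₀ (by linarith)]
    nlinarith
  linarith

theorem tendsto_size : Tendsto Nat.size atTop atTop :=
  tendsto_atTop_atTop.2 fun m => ⟨2 ^ m, fun _ hn => (Nat.lt_size.2 hn).le⟩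

theorem tendsto_size_size : Tendsto (fun n => Nat.size (Nat.size n)) atTop atTop :=
  tendsto_size.comp tendsto_size

theorem eventually_mul_size_pow_le (k : ℕ) (C : ℝ) {δ : ℝ} (hδ : 0 < δ) :
    ∀ᶠ n : ℕ in atTop, C * (Nat.size n : ℝ) ^ k ≤ δ * n := by
  have h1 : (fun n : ℕ => Real.log n ^ k) =o[atTop] fun n : ℕ => (n : ℝ) :=
    Real.isLittleO_pow_log_id_atTop.comp_tendsto tendsto_natCast_atTop_atTop
  have h2 := h1.const_mul_left (|C| * 4 ^ k)
  filter_upwards [h2.bound hδ, eventually_ge_atTop 2] with n hn hn2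
  have h3 : 0 ≤ Real.log n := Real.log_natCast_nonneg n
  rw [Real.norm_of_nonneg (by positivity), Real.norm_of_nonneg (by positivity)] at hn
  calc C * (Nat.size n : ℝ) ^ k ≤ |C| * (4 * Real.log n) ^ k := by
        gcongr
        · exact le_abs_self C
        · exact size_le_log hn2
    _ = |C| * 4 ^ k * Real.log n ^ k := by rw [mul_pow]; ring
    _ ≤ _ := hn

theorem two_le_logb_logb {n : ℕ} (hn : 16 ≤ n) : 2 ≤ Real.logb 2 (Real.logb 2 n) := by
  have h1 : (4 : ℝ) ≤ Real.logb 2 n := by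
    rw [Real.le_logb_iff_rpow_le (by norm_num) (by positivity)]
    norm_num
    exact_mod_cast hn
  rw [Real.le_logb_iff_rpow_le (by norm_num) (by linarith)]
  norm_num
  exact h1

/-- The bit length of the bit length is at most log log n + 2, and log log n ≥ 2 from n = 16 on. -/
theorem size_size_le {n : ℕ} (hn : 16 ≤ n) :
    (Nat.size (Nat.size n) : ℝ) ≤ 2 * Real.logb 2 (Real.logb 2 n) := by
  have h0 : Nat.size n ≠ 0 := (Nat.size_pos.2 (by omega)).ne'
  have h1 := size_le_logb (n := n) (by omega)
  have h2 := size_le_logb h0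
  have h3 := two_le_logb_logb hn
  have h4 : 1 ≤ Real.logb 2 n := by
    rw [Real.le_logb_iff_rpow_le (by norm_num) (by positivity)]
    norm_num
    exact_mod_cast (by omega : 2 ≤ n)
  have h5 : Real.logb 2 (Nat.size n) ≤ Real.logb 2 (2 * Real.logb 2 n) :=
    Real.logb_le_logb_of_le (by norm_num) (by exact_mod_cast Nat.pos_of_ne_zero h0) (by linarith)
  rw [Real.logb_mul (by norm_num) (by linarith), Real.logb_self_eq_one (by norm_num)] at h5
  linarith

theorem tendsto_logb_logb :
    Tendsto (fun n : ℕ => Real.logb 2 (Real.logb 2 n)) atTop atTop :=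
  (Real.tendsto_logb_atTop (by norm_num)).comp
    ((Real.tendsto_logb_atTop (by norm_num)).comp tendsto_natCast_atTop_atTop)

/-! ### Rate, running time and error probability for large n -/

namespace Params

variable {P : Params}

theorem num_le {n : ℕ} (hn : n ≠ 0) : (P.layout n).num ≤ 2 * Nat.size n :=
  two_pow_size_le (Nat.size_pos.2 (Nat.pos_of_ne_zero hn)).ne'

theorem size_lt_num (n : ℕ) : Nat.size n < (P.layout n).num := Nat.lt_size_self _

theorem blk_le (n : ℕ) : (P.layout n).blk ≤ (P.layout n).lam * P.v := Nat.div_le_self _ _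

theorem u_mul_blk_le (n : ℕ) : P.u * (P.layout n).blk ≤ (P.layout n).τ := by
  rw [mul_comm]
  exact (Nat.div_mul_le_self _ _).trans (mul_comm _ _).le

theorem lt_u_mul_blk (hu : 0 < P.u) (n : ℕ) :
    (P.layout n).lam * P.v < P.u * ((P.layout n).blk + 1) := Nat.lt_mul_div_succ _ hu

theorem lam_le_blk (hu : 0 < P.u) (huv : P.u ≤ P.v) (n : ℕ) :
    (P.layout n).lam ≤ (P.layout n).blk :=
  (Nat.le_div_iff_mul_le hu).2 (Nat.mul_le_mul_left _ huv)

/-- Since `blk ≤ v * lam` and `2 ^ lam` is O(log n), the tables of all blocks have polylogarithmic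
size. -/
theorem eventually_two_pow_blk_le : ∀ᶠ n in atTop, 2 ^ (P.layout n).blk ≤ n := by
  filter_upwards [eventually_mul_size_pow_le P.v (2 ^ P.v) one_pos, eventually_ne_atTop 0]
    with n hn hn0
  have h1 : 2 ^ (P.layout n).blk ≤ (2 * Nat.size n) ^ P.v :=
    calc 2 ^ (P.layout n).blk ≤ 2 ^ ((P.layout n).lam * P.v) :=
          Nat.pow_le_pow_right two_pos (blk_le n)
      _ = (P.layout n).num ^ P.v := by rw [pow_mul]; rfl
      _ ≤ _ := Nat.pow_le_pow_left (num_le hn0) _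
  have h2 : (((2 * Nat.size n) ^ P.v : ℕ) : ℝ) ≤ n := by
    push_cast
    rw [mul_pow]
    linarith
  exact h1.trans (by exact_mod_cast h2)

theorem eventually_num_mul_blk_le {δ : ℝ} (hδ : 0 < δ) :
    ∀ᶠ n : ℕ in atTop, (((P.layout n).num * (P.layout n).blk : ℕ) : ℝ) ≤ δ * n := by
  filter_upwards [eventually_mul_size_pow_le 2 (2 * P.v) hδ, eventually_ne_atTop 0] with n hn hn0
  have h1 : (P.layout n).num * (P.layout n).blk ≤ 2 * P.v * Nat.size n ^ 2 :=
    calc (P.layout n).num * (P.layout n).blk ≤ 2 * Nat.size n * (Nat.size n * P.v) :=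
          Nat.mul_le_mul (num_le hn0) ((blk_le n).trans (Nat.mul_le_mul_right _ (size_le_self _)))
      _ = _ := by ring
  refine le_trans ?_ hn
  exact_mod_cast h1

/-- Per source bit the fields take about u/v and the slots at most (1/2) ^ d. A head has `lam ≤ num`
bits, so the heads amount to at most one bit per block. The part not divided into groups is shorter
than one group, hence o(n). -/
theorem eventually_len_le (hu : 0 < P.u) (huv : P.u ≤ P.v) {δ : ℝ} (hδ : 0 < δ) :
    ∀ᶠ n : ℕ in atTop, ((P.layout n).len : ℝ) ≤ (P.u / P.v + (1 / 2) ^ P.d + 2 * δ) * n := by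
  have hv : 0 < P.v := hu.trans_le huv
  have hu' : (0 : ℝ) < P.u := by exact_mod_cast hu
  have hv' : (0 : ℝ) < P.v := by exact_mod_cast hv
  have hr : (P.u : ℝ) / P.v ≤ 1 := by rw [div_le_one hv']; exact_mod_cast huv
  -- This makes δ * blk at least 3. That pays for the flag, for one bit per block for the heads, and
  -- for u/v ≤ 1 from the rounding of `blk`.
  have hlarge : ∀ᶠ n : ℕ in atTop, (3 + δ) / δ ≤ ((P.layout n).lam : ℝ) :=
    (tendsto_natCast_atTop_atTop.comp tendsto_size_size).eventually_ge_atTop _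
  filter_upwards [eventually_num_mul_blk_le hδ, hlarge, eventually_ne_atTop 0] with n h1 h2 hn0
  set Λ := P.layout n with hΛ
  rw [div_le_iff₀ hδ] at h2
  have hlam : 1 ≤ Λ.lam := Nat.size_pos.2 (Nat.size_pos.2 (Nat.pos_of_ne_zero hn0))
  have hblk : 0 < Λ.blk := lt_of_lt_of_le hlam (lam_le_blk hu huv n)
  have h3 : ((Λ.lam : ℝ) + 2) ≤ (P.u / P.v + δ) * Λ.blk := by
    have h4 : (Λ.lam : ℝ) * P.v < P.u * (Λ.blk + 1) := by exact_mod_cast lt_u_mul_blk hu n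
    have h5 : (Λ.lam : ℝ) < P.u / P.v * (Λ.blk + 1) := by
      rw [div_mul_eq_mul_div, lt_div_iff₀ hv']; exact h4
    have h6 : (Λ.lam : ℝ) ≤ Λ.blk := by exact_mod_cast lam_le_blk hu huv n
    nlinarith
  have h4 : (Λ.grp : ℝ) * Λ.num * Λ.blk ≤ n := by exact_mod_cast body_le (P := P) n
  have h5 : (n : ℝ) - Λ.grp * Λ.num * Λ.blk ≤ δ * n := by
    refine le_trans ?_ h1
    have h6 := Nat.lt_mul_div_succ n (Nat.mul_pos Λ.num_pos hblk)
    have h7 : (n : ℝ) < Λ.num * Λ.blk * (Λ.grp + 1) := by exact_mod_cast h6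
    push_cast
    linarith
  have h6 : (Λ.cap : ℝ) ≤ (1 / 2) ^ P.d * Λ.num := by
    have h7 : Λ.cap * 2 ^ P.d ≤ Λ.num := Nat.div_mul_le_self _ _
    have h8 : (Λ.cap : ℝ) * 2 ^ P.d ≤ Λ.num := by exact_mod_cast h7
    rw [one_div, inv_pow, ← div_eq_inv_mul, le_div_iff₀ (by positivity)]
    exact h8
  have h7 : (Λ.lam : ℝ) ≤ Λ.num := by
    exact_mod_cast (Nat.lt_two_pow_self (n := Λ.lam)).le
  have hlen : (Λ.len : ℝ) = Λ.grp * Λ.num * (Λ.lam + 1) + Λ.grp * Λ.cap * Λ.blk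
      + Λ.grp * Λ.lam + (n - Λ.grp * Λ.num * Λ.blk) := by
    have h8 : Λ.body ≤ Λ.n := body_le (P := P) n
    have h9 : ((Λ.n - Λ.body : ℕ) : ℝ) = n - Λ.grp * Λ.num * Λ.blk := by
      rw [Nat.cast_sub h8, body, blocks]; push_cast; rfl
    rw [len, Nat.cast_add, h9, tailPos, headPos, slotPos, blocks]
    push_cast
    ring
  have g0 : (0 : ℝ) ≤ Λ.grp := by positivity
  have a1 : (Λ.grp : ℝ) * Λ.num * (Λ.lam + 2) ≤ (P.u / P.v + δ) * n := by
    calc (Λ.grp : ℝ) * Λ.num * (Λ.lam + 2) ≤ Λ.grp * Λ.num * ((P.u / P.v + δ) * Λ.blk) := by gcongr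
      _ = (P.u / P.v + δ) * (Λ.grp * Λ.num * Λ.blk) := by ring
      _ ≤ _ := by gcongr
  have a2 : (Λ.grp : ℝ) * Λ.cap * Λ.blk ≤ (1 / 2) ^ P.d * n := by
    calc (Λ.grp : ℝ) * Λ.cap * Λ.blk ≤ Λ.grp * ((1 / 2) ^ P.d * Λ.num) * Λ.blk := by gcongr
      _ = (1 / 2) ^ P.d * (Λ.grp * Λ.num * Λ.blk) := by ring
      _ ≤ _ := by gcongr
  have a3 : (Λ.grp : ℝ) * Λ.lam ≤ Λ.grp * Λ.num := by gcongr
  rw [hlen]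
  linarith

theorem layout_grp_eq_zero (hv : P.v = 0) (n : ℕ) : (P.layout n).grp = 0 := by
  simp [layout, hv]

theorem len_eq_of_grp (n : ℕ) (h : (P.layout n).grp = 0) : (P.layout n).len = n := by
  simp only [len, tailPos, headPos, slotPos, body, blocks, h]
  simp
  rfl

/-- Numbers have O(log n) bits and the loops make O(n) passes, so a single logarithm suffices. -/
theorem quasilinear_time {C : ℕ} (hC : ∀ᶠ n in atTop, (P.layout n).len ≤ C * n) :
    Quasilinear P.time := by
  obtain ⟨W, hW⟩ : ∃ W : ℕ, ∀ n, P.time n = W * P.bitLength n * P.iterations n :=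
    ⟨_, fun n => by rw [time]⟩
  refine ⟨1, IsBigO.of_bound ((W : ℝ) *
    (((6 + Nat.size C : ℕ) : ℝ) * 4) * ((C + 5 : ℕ) : ℝ)) ?_⟩
  filter_upwards [hC, eventually_two_pow_blk_le (P := P), eventually_ge_atTop 2] with n h1 h2 hn
  have h3 : 0 ≤ Real.log n := Real.log_natCast_nonneg n
  have hsize := size_le_log hn
  have hs1 : 1 ≤ Nat.size n := Nat.size_pos.2 (by omega)
  have hb := Nat.lt_size.2 h2
  have hlam : (P.layout n).lam ≤ Nat.size n := size_le_self _
  have hlam' := size_le_self n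
  have hlen : Nat.size (P.layout n).len ≤ Nat.size C + Nat.size n := by
    rw [Nat.size_le, pow_add]
    exact h1.trans_lt (Nat.mul_lt_mul'' (Nat.lt_size_self _) (Nat.lt_size_self _))
  have hL : P.bitLength n ≤ (6 + Nat.size C) * Nat.size n := by
    rw [bitLength]
    nlinarith
  have hJ : P.iterations n ≤ (C + 5) * n := by
    rw [iterations]
    nlinarith
  have hL' : (P.bitLength n : ℝ) ≤ ((6 + Nat.size C : ℕ) : ℝ) * (4 * Real.log n) := by
    refine le_trans (b := (((6 + Nat.size C) * Nat.size n : ℕ) : ℝ)) (by exact_mod_cast hL) ?_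
    rw [Nat.cast_mul]
    gcongr
  have hJ' : (P.iterations n : ℝ) ≤ ((C + 5 : ℕ) : ℝ) * n := by exact_mod_cast hJ
  rw [Real.norm_of_nonneg (Nat.cast_nonneg _),
    Real.norm_of_nonneg (mul_nonneg (Nat.cast_nonneg n) (pow_nonneg h3 1)), hW, Nat.cast_mul,
    Nat.cast_mul]
  calc (W : ℝ) * P.bitLength n * P.iterations n
      ≤ W * (((6 + Nat.size C : ℕ) : ℝ) * (4 * Real.log n)) * (((C + 5 : ℕ) : ℝ) * n) := by gcongr
    _ = _ := by ring

/-- As γ ^ blk tends to 0, it is eventually at most 8 ^ (-2 ^ d); raised to the power `cap = num / 2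
^ d` this gives 8 ^ (-num). The number of groups is at most n, hence at most 2 ^ num, because `num`
exceeds the bit length of n. With the factor 2 ^ num for the sets of blocks, 2 ^ (-num) remains. -/
theorem tendsto_error_bound (hu : 0 < P.u) (huv : P.u ≤ P.v) {γ : ℝ} (h0 : 0 ≤ γ) (h1 : γ < 1) :
    Tendsto (fun n => ((P.layout n).grp : ℝ) *
      (2 ^ (P.layout n).num * γ ^ ((P.layout n).blk * (P.layout n).cap))) atTop (𝓝 0) := by
  have hnum : Tendsto (fun n => (P.layout n).num) atTop atTop :=
    tendsto_atTop_mono (fun n => (size_lt_num (P := P) n).le) tendsto_size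
  have hblk : Tendsto (fun n => (P.layout n).blk) atTop atTop :=
    tendsto_atTop_mono (lam_le_blk hu huv) tendsto_size_size
  have hlim : Tendsto (fun n => (1 / 2 : ℝ) ^ (P.layout n).num) atTop (𝓝 0) :=
    (tendsto_pow_atTop_nhds_zero_of_lt_one (by norm_num) (by norm_num)).comp hnum
  have hγ : ∀ᶠ n in atTop, γ ^ (P.layout n).blk ≤ (1 / 8) ^ 2 ^ P.d :=
    ((tendsto_pow_atTop_nhds_zero_of_lt_one h0 h1).comp hblk).eventually_le_const (by positivity)
  refine squeeze_zero' (Eventually.of_forall fun n => by positivity) ?_ hlim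
  filter_upwards [hγ, tendsto_size_size.eventually_ge_atTop P.d] with n h2 h3
  have hcap : 2 ^ P.d * (P.layout n).cap = (P.layout n).num :=
    Nat.mul_div_cancel' (pow_dvd_pow 2 h3)
  have hgrp : (P.layout n).grp ≤ 2 ^ (P.layout n).num :=
    (Nat.div_le_self _ _).trans ((Nat.lt_size_self n).le.trans
      (Nat.pow_le_pow_right two_pos (size_lt_num n).le))
  have hgrp' : ((P.layout n).grp : ℝ) ≤ 2 ^ (P.layout n).num := by exact_mod_cast hgrp
  calc ((P.layout n).grp : ℝ) * (2 ^ (P.layout n).num * γ ^ ((P.layout n).blk * (P.layout n).cap))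
      ≤ 2 ^ (P.layout n).num * (2 ^ (P.layout n).num * (1 / 8) ^ (P.layout n).num) := by
        refine mul_le_mul hgrp' (mul_le_mul_of_nonneg_left ?_ (by positivity)) (by positivity)
          (by positivity)
        rw [pow_mul, ← hcap, pow_mul (1 / 8 : ℝ)]
        exact pow_le_pow_left₀ (by positivity) h2 _
    _ = (1 / 2) ^ (P.layout n).num := by
        rw [← mul_pow, ← mul_pow]; norm_num

/-- The constants describe a code for single bits that is good enough. -/
structure Admissible (P : Params) : Prop where
  u_pos : 0 < P.u
  u_le : P.u ≤ P.v
  d_pos : 0 < P.d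
  kraft : ∃ ρ : ℝ, 0 < ρ ∧ ρ ≤ 1 ∧ ρ ^ P.v = 1 / 2 ∧ ρ ^ P.α₁ + ρ ^ P.α₀ ≤ 1
  cheap : P.α₀ ≤ P.u ∨ P.α₁ ≤ P.u

/-- Kraft's inequality bounds the number of cheap blocks. A cheap block exists because one of the
two symbols costs at most `u`, and repeating it costs at most `u * blk ≤ τ`. -/
theorem Admissible.valid (H : P.Admissible) (n : ℕ) : (P.layout n).Valid := by
  have hu := H.u_pos
  refine ⟨lam_le_blk hu H.u_le n, Nat.div_lt_self (by positivity)
    (Nat.one_lt_two_pow H.d_pos.ne'), ?_, ?_⟩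
  · obtain ⟨ρ, h1, h2, h3, h4⟩ := H.kraft
    refine count_typ_le h1 h2 ?_ h4
    change ρ ^ (P.v * (P.layout n).lam) = _
    rw [pow_mul, h3]
  · have hτ := u_mul_blk_le (P := P) n
    rcases H.cheap with h | h
    · refine ⟨0, by positivity, ?_⟩
      rw [pop_zero, mul_zero, zero_add, Nat.sub_zero]
      exact (Nat.mul_le_mul_right _ h).trans hτ
    · refine ⟨val (fun _ => true) 0 (P.layout n).blk, val_lt _ _ _, ?_⟩
      rw [pop_val]
      simp only [Bool.toNat_true, Finset.sum_const, Finset.card_range, smul_eq_mul, mul_one,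
        Nat.sub_self, mul_zero, add_zero]
      exact (Nat.mul_le_mul_right _ h).trans hτ

end Params

/-! ### The choice of the constants -/

theorem entropy_nonneg {p : ℝ} (hp0 : 0 ≤ p) (hp1 : p ≤ 1) : 0 ≤ entropy p :=
  div_nonneg (Real.binEntropy_nonneg hp0 hp1) (Real.log_nonneg (by norm_num))

/-- There is an interior distribution with nearly optimal cross entropy. -/
theorem exists_cross_entropy {p : ℝ} (hp0 : 0 ≤ p) (hp1 : p ≤ 1) {η : ℝ} (hη : 0 < η) :
    ∃ r : ℝ, 0 < r ∧ r < 1 ∧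
      p * (-Real.log r / Real.log 2) + (1 - p) * (-Real.log (1 - r) / Real.log 2)
        ≤ entropy p + η := by
  have hl : 0 < Real.log 2 := Real.log_pos (by norm_num)
  have hr0 : 0 < Real.exp (-(η * Real.log 2)) := Real.exp_pos _
  have hr1 : Real.exp (-(η * Real.log 2)) < 1 := by
    rw [Real.exp_lt_one_iff]; nlinarith
  have hη' : -Real.log (Real.exp (-(η * Real.log 2))) / Real.log 2 = η := by
    rw [Real.log_exp, neg_neg, mul_div_assoc, div_self hl.ne', mul_one]
  have he := entropy_nonneg hp0 hp1
  -- For p = 0 or p = 1 the choice r = p is degenerate. It is moved inwards so that the certain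
  -- symbol has code length exactly η; otherwise r = p.
  rcases hp0.eq_or_lt with rfl | h0
  · refine ⟨1 - Real.exp (-(η * Real.log 2)), by linarith, by linarith, ?_⟩
    rw [sub_sub_cancel, hη']
    linarith
  rcases hp1.eq_or_lt with rfl | h1
  · refine ⟨Real.exp (-(η * Real.log 2)), hr0, hr1, ?_⟩
    rw [hη']
    linarith
  · refine ⟨p, h0, h1, ?_⟩
    rw [entropy, Real.binEntropy, Real.log_inv, Real.log_inv]
    have : p * (-Real.log p / Real.log 2) + (1 - p) * (-Real.log (1 - p) / Real.log 2)
        = (p * -Real.log p + (1 - p) * -Real.log (1 - p)) / Real.log 2 := by ring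
    rw [this]
    linarith

/-- The ideal code lengths for r are multiplied by v and rounded up. With ρ = 2 ^ (-1/v) rounding up
keeps Kraft's inequality, and it adds at most 1 to the mean. So u, which exceeds (entropy + ε/8) * v
+ 1 by at most 1, is strictly above the mean cost. As v ≥ 8/ε, the additional 2/v in the rate is at
most ε/4. The lower bound on u/v will limit the block length. -/
theorem exists_code {p : ℝ} (hp0 : 0 ≤ p) (hp1 : p ≤ 1) {ε : ℝ} (hε : 0 < ε) :
    ∃ u v α₀ α₁ : ℕ, 0 < u ∧ 0 < v ∧ (u : ℝ) / v ≤ entropy p + ε / 2 ∧ ε / 8 ≤ (u : ℝ) / v ∧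
      p * α₁ + (1 - p) * α₀ < u ∧
      ∃ ρ : ℝ, 0 < ρ ∧ ρ ≤ 1 ∧ ρ ^ v = 1 / 2 ∧ ρ ^ α₁ + ρ ^ α₀ ≤ 1 := by
  obtain ⟨r, hr0, hr1, hr⟩ := exists_cross_entropy hp0 hp1 (η := ε / 8) (by linarith)
  have hl : 0 < Real.log 2 := Real.log_pos (by norm_num)
  have he := entropy_nonneg hp0 hp1
  set X₁ := -Real.log r / Real.log 2 with hX₁
  set X₀ := -Real.log (1 - r) / Real.log 2 with hX₀
  have hX₁0 : 0 ≤ X₁ := div_nonneg (by linarith [Real.log_neg hr0 hr1]) hl.le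
  have hX₀0 : 0 ≤ X₀ := div_nonneg
    (by linarith [Real.log_neg (x := 1 - r) (by linarith) (by linarith)]) hl.le
  obtain ⟨v, hv⟩ := exists_nat_ge (8 / ε)
  have hv0 : (0 : ℝ) < v := lt_of_lt_of_le (by positivity) hv
  rw [div_le_iff₀ hε] at hv
  have hY : 0 ≤ (entropy p + ε / 8) * v + 1 := by positivity
  refine ⟨⌊(entropy p + ε / 8) * v + 1⌋₊ + 1, v, ⌈v * X₀⌉₊, ⌈v * X₁⌉₊, Nat.succ_pos _,
    by exact_mod_cast hv0, ?_, ?_, ?_, Real.exp (-(Real.log 2 / v)), Real.exp_pos _, ?_, ?_, ?_⟩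
  · rw [div_le_iff₀ hv0]
    have := Nat.floor_le hY
    push_cast
    nlinarith
  · rw [le_div_iff₀ hv0]
    have := Nat.lt_floor_add_one ((entropy p + ε / 8) * v + 1)
    push_cast
    nlinarith
  · have h1 := Nat.lt_floor_add_one ((entropy p + ε / 8) * v + 1)
    have h2 := (Nat.ceil_lt_add_one (mul_nonneg hv0.le hX₁0)).le
    have h3 := (Nat.ceil_lt_add_one (mul_nonneg hv0.le hX₀0)).le
    push_cast
    nlinarith
  · rw [Real.exp_le_one_iff]
    have : 0 ≤ Real.log 2 / v := by positivity
    linarith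
  · rw [← Real.exp_nat_mul, show (v : ℝ) * -(Real.log 2 / v) = -Real.log 2 by field_simp,
      Real.exp_neg, Real.exp_log (by norm_num), one_div]
  · have key : ∀ s : ℝ, 0 < s → Real.exp (-(Real.log 2 / v)) ^ ⌈v * (-Real.log s / Real.log 2)⌉₊
        ≤ s := by
      intro s hs
      rw [← Real.exp_nat_mul]
      have h1 := Nat.le_ceil (v * (-Real.log s / Real.log 2))
      calc _ ≤ Real.exp (v * (-Real.log s / Real.log 2) * -(Real.log 2 / v)) := by
            rw [Real.exp_le_exp]
            refine mul_le_mul_of_nonpos_right h1 ?_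
            have : 0 ≤ Real.log 2 / v := by positivity
            linarith
        _ = s := by
            rw [show v * (-Real.log s / Real.log 2) * -(Real.log 2 / v) = Real.log s by
              field_simp, Real.exp_log hs]
    have h1 := key r hr0
    have h2 := key (1 - r) (by linarith)
    linarith

/-- A mixture of exponentials with negative mean slope is below one somewhere. -/
theorem exists_exp_lt_one {p a c : ℝ} (h : p * a + (1 - p) * c < 0) :
    ∃ θ : ℝ, 0 < θ ∧ p * Real.exp (θ * a) + (1 - p) * Real.exp (θ * c) < 1 := by
  have hd : HasDerivAt (fun θ : ℝ => p * Real.exp (θ * a) + (1 - p) * Real.exp (θ * c))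
      (p * a + (1 - p) * c) 0 := by
    have h1 : ∀ b : ℝ, HasDerivAt (fun θ : ℝ => Real.exp (θ * b)) b 0 := fun b => by
      simpa using ((hasDerivAt_id (0 : ℝ)).mul_const b).exp
    exact ((h1 a).const_mul p).add ((h1 c).const_mul (1 - p))
  have hs := (hasDerivAt_iff_tendsto_slope.1 hd).eventually_lt_const h
  have hs' := hs.filter_mono (nhdsWithin_mono (0 : ℝ) (fun x (hx : x ∈ Set.Ioi 0) => ne_of_gt hx))
  obtain ⟨θ, h1, h2⟩ := (hs'.and self_mem_nhdsWithin).exists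
  refine ⟨θ, h2, ?_⟩
  rw [slope_def_field, sub_zero, div_neg_iff] at h1
  have h2 : (0 : ℝ) < θ := h2
  simp only [zero_mul, Real.exp_zero, mul_one] at h1
  rcases h1 with h1 | h1
  · linarith [h1.2]
  · linarith [h1.1]

/-! ### The two cases of the theorem -/

namespace Params

variable {P : Params}

theorem tendsto_errorProb (hP : P.Admissible) {p : ℝ} (hp0 : 0 ≤ p) (hp1 : p ≤ 1)
    (hmean : p * P.α₁ + (1 - p) * P.α₀ < P.u) :
    Tendsto (fun n : ℕ => P.scheme.errorProb p n) atTop (𝓝 0) := by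
  -- The mean of the cost of a bit minus u is negative, so Chernoff's bound has a base below 1.
  obtain ⟨θ, hθ, hγ⟩ := exists_exp_lt_one (p := p) (a := P.α₁ - P.u) (c := P.α₀ - P.u)
    (by linarith)
  have hγ0 : 0 ≤ p * Real.exp (θ * (P.α₁ - P.u)) + (1 - p) * Real.exp (θ * (P.α₀ - P.u)) :=
    add_nonneg (mul_nonneg hp0 (Real.exp_pos _).le) (mul_nonneg (by linarith) (Real.exp_pos _).le)
  refine squeeze_zero' (Eventually.of_forall fun n =>
    Finset.sum_nonneg fun x _ => bernoulliProb_nonneg hp0 hp1 x) ?_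
    (tendsto_error_bound hP.u_pos hP.u_le hγ0 hγ)
  filter_upwards [eventually_ge_atTop P.n₀, eventually_ne_atTop 0] with n hn hn0
  have hlam : 0 < (P.layout n).lam := Nat.size_pos.2 (Nat.size_pos.2 (Nat.pos_of_ne_zero hn0))
  rw [Scheme.errorProb]
  refine sum_not_fits_le (Λ := P.layout n) (hlam.trans_le (lam_le_blk hP.u_pos hP.u_le n))
    (body_le n) hp0 hp1 hθ.le (u := P.u) (by exact_mod_cast u_mul_blk_le (P := P) n)
    _ fun x hx => ?_
  have h := not_fits_of_dec_ne (fun n _ _ => hP.valid n) hn (x := x)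
  exact h (Finset.mem_filter (α := Fin n → Bool).1 hx).2

/-- The rate exceeds the entropy by at most ε/2 + ε/8 + 2 * (ε/8) < ε. With ℓ = log log n one has
lam ≤ 2ℓ, 3 ≤ 3ℓ/2 and ε * blk ≤ 8 * lam, so ε times the update cost is at most 14ℓ + 64ℓ + 3ℓ/2,
whence the constant 80. -/
theorem exists_scheme_of_code (hP : P.Admissible) {p ε : ℝ} (hp0 : 0 ≤ p) (hp1 : p ≤ 1)
    (hε : 0 < ε) (hε1 : ε ≤ 1) (hrate : (P.u : ℝ) / P.v ≤ entropy p + ε / 2)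
    (hlow : ε / 8 ≤ (P.u : ℝ) / P.v) (hd : (1 / 2 : ℝ) ^ P.d ≤ ε / 8)
    (hmean : p * P.α₁ + (1 - p) * P.α₀ < P.u) :
    ∃ S : Scheme,
      (∀ n : ℕ, (S.len n : ℝ) ≤ (entropy p + ε) * n) ∧
      Tendsto (fun n : ℕ => S.errorProb p n) atTop (𝓝 0) ∧
      S.LocalDecoderCorrect ∧
      S.UpdaterCorrect ∧
      (∀ᶠ n : ℕ in atTop, ∀ (i : Fin n) (c : Fin (S.len n) → Bool),
        ((S.localDec n i).probes c : ℝ) ≤ 80 * Real.logb 2 (Real.logb 2 n)) ∧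
      (∀ᶠ n : ℕ in atTop, ∀ (i : Fin n) (b : Bool) (c : Fin (S.len n) → Bool),
        ((S.localUpd n i b).cost c : ℝ) ≤ 80 / ε * Real.logb 2 (Real.logb 2 n)) ∧
      S.QuasilinearTime := by
  have hu' : (0 : ℝ) < P.u := by exact_mod_cast hP.u_pos
  have hv' : (0 : ℝ) < P.v := by exact_mod_cast hP.u_pos.trans_le hP.u_le
  have he := entropy_nonneg hp0 hp1
  have hlen : ∀ᶠ n : ℕ in atTop, ((P.layout n).len : ℝ) ≤ (entropy p + ε) * n := by
    filter_upwards [eventually_len_le hP.u_pos hP.u_le (δ := ε / 8) (by linarith)] with n hn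
    exact hn.trans (mul_le_mul_of_nonneg_right (by linarith) (Nat.cast_nonneg n))
  -- The rate is demanded for every n. Lengths below n₁, where rounding may spoil it, get empty
  -- codewords, which does not affect the limit of the error.
  obtain ⟨n₁, hn₁⟩ := eventually_atTop.1 hlen
  let P' : Params := { P with n₀ := n₁ }
  have hP' : P'.Admissible := ⟨hP.u_pos, hP.u_le, hP.d_pos, hP.kraft, hP.cheap⟩
  refine ⟨P'.scheme, fun n => ?_, tendsto_errorProb hP' hp0 hp1 hmean, localDecoderCorrect,
    updaterCorrect fun n _ _ => hP'.valid n, ?_, ?_, ?_⟩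
  · rcases le_or_gt P'.n₀ n with h | h
    · rw [len_of_le h]
      exact hn₁ n h
    · rw [len_of_lt h]
      push_cast
      positivity
  · filter_upwards [eventually_ge_atTop n₁, eventually_ge_atTop 16] with n hn hn16 i c
    rw [localDec_of_le hn]
    have h1 : (((P'.layout n).localDec _ i).probes c : ℝ) ≤ (P'.layout n).lam + 2 := by
      exact_mod_cast probes_localDec c i
    have h2 : ((P'.layout n).lam : ℝ) ≤ _ := size_size_le hn16
    have h3 := two_le_logb_logb hn16
    linarith
  · filter_upwards [eventually_ge_atTop n₁, eventually_ge_atTop 16] with n hn hn16 i b c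
    rw [localUpd_of_le hn]
    have h1 : (((P'.layout n).localUpd _ i b).cost c : ℝ)
        ≤ 7 * (P'.layout n).lam + 4 * (P'.layout n).blk + 3 := by
      exact_mod_cast cost_localUpd i b c
    have h2 : ((P'.layout n).lam : ℝ) ≤ _ := size_size_le hn16
    have h3 := two_le_logb_logb hn16
    have h4 : (P.u : ℝ) * (P'.layout n).blk ≤ P.v * (P'.layout n).lam := by
      exact_mod_cast u_mul_blk_le (P := P') n
    have h5 : ε * (P'.layout n).blk ≤ 8 * (P'.layout n).lam := by
      rw [le_div_iff₀ hv'] at hlow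
      have h6 : (0 : ℝ) ≤ (P'.layout n).blk := by positivity
      have h7 : P.v * (ε * (P'.layout n).blk) ≤ P.v * (8 * ((P'.layout n).lam : ℝ)) := by nlinarith
      exact le_of_mul_le_mul_left h7 hv'
    rw [div_mul_eq_mul_div, le_div_iff₀ hε]
    have h6 : (0 : ℝ) ≤ (P'.layout n).lam := by positivity
    refine (mul_le_mul_of_nonneg_right h1 hε.le).trans ?_
    nlinarith
  · obtain ⟨C, hC⟩ := exists_nat_ge (entropy p + ε)
    refine quasilinearTime (quasilinear_time (C := C) ?_)
    filter_upwards [hlen] with n hn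
    have : ((P.layout n).len : ℝ) ≤ ((C * n : ℕ) : ℝ) := by
      push_cast
      exact hn.trans (by gcongr)
    exact_mod_cast this

/-- With v = 0 the blocks are empty and division by zero gives no groups, so the codeword is the
uncompressed part alone and each access touches one bit. -/
theorem exists_scheme_uncompressed {p ε : ℝ} (hε : 0 < ε) (h1 : 1 ≤ entropy p + ε) :
    ∃ S : Scheme,
      (∀ n : ℕ, (S.len n : ℝ) ≤ (entropy p + ε) * n) ∧
      Tendsto (fun n : ℕ => S.errorProb p n) atTop (𝓝 0) ∧
      S.LocalDecoderCorrect ∧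
      S.UpdaterCorrect ∧
      (∀ᶠ n : ℕ in atTop, ∀ (i : Fin n) (c : Fin (S.len n) → Bool),
        ((S.localDec n i).probes c : ℝ) ≤ 80 * Real.logb 2 (Real.logb 2 n)) ∧
      (∀ᶠ n : ℕ in atTop, ∀ (i : Fin n) (b : Bool) (c : Fin (S.len n) → Bool),
        ((S.localUpd n i b).cost c : ℝ) ≤ 80 / ε * Real.logb 2 (Real.logb 2 n)) ∧
      S.QuasilinearTime := by
  let P : Params := ⟨0, 0, 0, 0, 0, 0⟩
  have hgrp : ∀ n, (P.layout n).grp = 0 := layout_grp_eq_zero rfl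
  have hV : ∀ n, P.n₀ ≤ n → (P.layout n).grp ≠ 0 → (P.layout n).Valid :=
    fun n _ h => absurd (hgrp n) h
  have hbody : ∀ n, (P.layout n).body = 0 := fun n => by simp [body, blocks, hgrp n]
  refine ⟨P.scheme, fun n => ?_, ?_, localDecoderCorrect, updaterCorrect hV, ?_, ?_,
    quasilinearTime (quasilinear_time (C := 1) ?_)⟩
  · rw [len_of_le (Nat.zero_le n), len_eq_of_grp n (hgrp n)]
    exact le_mul_of_one_le_left (by positivity) h1
  · have h : (fun n : ℕ => P.scheme.errorProb p n) = fun _ => 0 := by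
      funext n
      refine Finset.sum_eq_zero fun x hx => ?_
      refine absurd (fun g hg => ?_)
        (not_fits_of_dec_ne hV (Nat.zero_le n) (Finset.mem_filter.1 hx).2)
      rw [hgrp n] at hg
      omega
    rw [h]
    exact tendsto_const_nhds
  · filter_upwards [eventually_ge_atTop 16] with n hn i c
    rw [localDec_of_le (Nat.zero_le n)]
    have h2 : (((P.layout n).localDec _ i).probes c : ℝ) ≤ 1 := by
      exact_mod_cast probes_localDec_of_body_le ((hbody n).le.trans (Nat.zero_le _)) c
    have h3 := two_le_logb_logb hn
    linarith
  -- Here ε may be large, and 80/ε times log log n must reach 1.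
  · filter_upwards [tendsto_logb_logb.eventually_ge_atTop ε, eventually_ge_atTop 16]
      with n hn hn16 i b c
    rw [localUpd_of_le (Nat.zero_le n)]
    have h2 : (((P.layout n).localUpd _ i b).cost c : ℝ) ≤ 1 := by
      exact_mod_cast cost_localUpd_of_body_le ((hbody n).le.trans (Nat.zero_le _)) b c
    rw [div_mul_eq_mul_div, le_div_iff₀ hε]
    nlinarith
  · exact Eventually.of_forall fun n => by rw [len_eq_of_grp n (hgrp n), one_mul]

end Params

end LocalCompression
-- Assembling the two cases
theorem theorem1 (p : ℝ) (hp0 : 0 ≤ p) (hp1 : p ≤ 1) :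
    ∃ K : ℝ, ∀ ε : ℝ, 0 < ε → ∃ S : LocalCompression.Scheme,
      (∀ n : ℕ, (S.len n : ℝ) ≤ (LocalCompression.entropy p + ε) * n) ∧
      Tendsto (fun n : ℕ => S.errorProb p n) atTop (𝓝 0) ∧
      S.LocalDecoderCorrect ∧
      S.UpdaterCorrect ∧
      (∀ᶠ n : ℕ in atTop, ∀ (i : Fin n) (c : Fin (S.len n) → Bool),
        ((S.localDec n i).probes c : ℝ) ≤ K * Real.logb 2 (Real.logb 2 n)) ∧
      (∀ᶠ n : ℕ in atTop, ∀ (i : Fin n) (b : Bool) (c : Fin (S.len n) → Bool),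
        ((S.localUpd n i b).cost c : ℝ) ≤ K / ε * Real.logb 2 (Real.logb 2 n)) ∧
      S.QuasilinearTime := by
  refine ⟨80, fun ε hε => ?_⟩
  -- In the second case ε < 1, and u/v ≤ entropy + ε/2 < 1 gives the u ≤ v that makes blocks at
  -- least as long as their ranks.
  rcases le_or_gt 1 (LocalCompression.entropy p + ε) with h1 | h1
  · exact LocalCompression.Params.exists_scheme_uncompressed hε h1
  have he := LocalCompression.entropy_nonneg hp0 hp1
  obtain ⟨u, v, α₀, α₁, hu, hv, hrate, hlow, hmean, hkraft⟩ :=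
    LocalCompression.exists_code hp0 hp1 hε
  have hv' : (0 : ℝ) < v := by exact_mod_cast hv
  have huv : u ≤ v := by
    have h2 : (u : ℝ) / v ≤ 1 := by linarith
    rw [div_le_one hv'] at h2
    exact_mod_cast h2
  obtain ⟨d, hd⟩ := exists_pow_lt_of_lt_one (show (0 : ℝ) < ε / 8 by linarith)
    (show (1 / 2 : ℝ) < 1 by norm_num)
  have hd0 : 0 < d := by
    rcases Nat.eq_zero_or_pos d with rfl | h
    · rw [pow_zero] at hd; linarith
    · exact h
  -- If both costs exceeded u, so would their mean.
  have hcheap : α₀ ≤ u ∨ α₁ ≤ u := by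
    by_contra! h
    have h2 : (u : ℝ) ≤ α₀ := by exact_mod_cast h.1.le
    have h3 : (u : ℝ) ≤ α₁ := by exact_mod_cast h.2.le
    nlinarith
  exact LocalCompression.Params.exists_scheme_of_code (P := ⟨u, v, α₀, α₁, d, 0⟩)
    ⟨hu, huv, hd0, hkraft, hcheap⟩ hp0 hp1 hε (by linarith) hrate hlow hd.le hmean
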